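/- Let $\beta>0$, let $k\ge 3$ and $p\ge 4$ be integers, and let $V:\mathbb R\to\mathbb R$ be of class $C^p$ with $V(x)/(\beta\log|x|)\to+\infty$ as $|x|\to\infty$. Let $\mu_V$ be the equilibrium measure of $V$, i.e. the minimizer, among probability measures on $\mathbb R$, of $$I_V(\mu)=\tfrac12\iint\bigl(V(x)+V(y)-\beta\log|x-y|\bigr)\,d\mu(x)\,d\mu(y).$$ Assume that $\mu_V$ has support $[a,b]$, $a<b$, and that $$\frac{d\mu_V}{dx}(x)=S(x)\sqrt{(x-a)(b-x)}\ \text{ on }[a,b],\qquad S\ge\bar c>0\ \text{ a.e. on }[a,b],$$ and that $V'(x)\ne\beta\int\frac{d\mu_V(y)}{x-y}$ for every $x\notin[a,b]$. For $f:\mathbb R\to\mathbb R$ set $$\Xi f(x)=-\beta\int\frac{f(x)-f(y)}{x-y}\,d\mu_V(y)+V'(x)f(x),$$ and write $\|h\|_{C^j}=\sum_{r=0}^j\|h^{(r)}\|_{L^\infty(\mathbb R)}\in[0,\infty]$ and $m=\min(k-2,p-3)$. Then there are finite constants $C_j$ (not depending on $g$) such that for every $g:\mathbb R\to\mathbb R$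 of class $C^k$: 1. There is a unique constant $c_g\in\mathbb R$ for which the equation $\Xi f=g+c_g$ on $\mathbb R$ has a solution $f$ of class $C^m$, and this solution $f$ is unique in the class $C^m$. 2. Let $0\le j\le m$ be such that, outside some bounded set, $V'$ does not vanish and the derivatives of $1/V'$ of orders $0,\dots,j$ are bounded. Then $$\|f\|_{C^j}\le C_j\,\|g\|_{C^{j+2}},$$ and $f^{(j)}$ behaves like the $j$-th derivative of $(g+c_g)/V'$ at infinity, in the sense that, as $|x|\to\infty$, $$f^{(j)}(x)-\Bigl(\frac{g+c_g}{V'}\Bigr)^{(j)}(x)=o\Biggl(\sum_{i=0}^{j}\Bigl|\Bigl(\frac{g+c_g}{V'}\Bigr)^{(i)}(x)\Bigr|+\Bigl|\Bigl(\frac1{V'}\Bigr)^{(i)}(x)\Bigr|\Biggr).$$ -/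

import Mathlib

open MeasureTheory Filter Set Asymptotics
open scoped Topology ENNReal NNReal

namespace BetaEnsemble

noncomputable section

/-- The kernel `V(x) + V(y) - β log |x - y|`, with its value `+∞` on the diagonal. -/
def energyKernel (β : ℝ) (V : ℝ → ℝ) (z : ℝ × ℝ) : EReal :=
  open scoped Classical in
  if z.1 = z.2 then ⊤ else ((V z.1 + V z.2 - β * Real.log |z.1 - z.2| : ℝ) : EReal)

/-- The energy `I_V(μ) = (1/2) ∬ (V(x) + V(y) - β log |x - y|) dμ(x) dμ(y)`, as the integral of the
positive part minus the integral of the negative part. (When `V` grows faster than `β log |x|`, the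
kernel is bounded below, so for a probability measure the second integral is finite.) -/
def energy (β : ℝ) (V : ℝ → ℝ) (μ : Measure ℝ) : EReal :=
  ((1 / 2 : ℝ) : EReal) *
    (((∫⁻ z, (energyKernel β V z).toENNReal ∂(μ.prod μ) : ℝ≥0∞) : EReal)
      - ((∫⁻ z, (-energyKernel β V z).toENNReal ∂(μ.prod μ) : ℝ≥0∞) : EReal))

/-- `μ` is an equilibrium measure of `V`: a minimizer of `I_V` among probability measures. -/
def IsEquilibriumMeasure (β : ℝ) (V : ℝ → ℝ) (μ : Measure ℝ) : Prop :=
  IsProbabilityMeasure μ ∧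
    ∀ ν : Measure ℝ, IsProbabilityMeasure ν → energy β V μ ≤ energy β V ν

/-- `Ξ f (x) = -β ∫ (f(x) - f(y)) / (x - y) dμ(y) + V'(x) f(x)`. -/
def Xi (β : ℝ) (V : ℝ → ℝ) (μ : Measure ℝ) (f : ℝ → ℝ) (x : ℝ) : ℝ :=
  -β * ∫ y, (f x - f y) / (x - y) ∂μ + deriv V x * f x

/-- `‖h‖_{C^j(ℝ)} = ∑_{r ≤ j} ‖h^{(r)}‖_{L^∞(ℝ)}`, possibly infinite. -/
def cNorm (j : ℕ) (h : ℝ → ℝ) : ℝ≥0∞ :=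
  ∑ r ∈ Finset.range (j + 1), eLpNorm (iteratedDeriv r h) ∞ volume

/-- Near infinity `V'` does not vanish and `1/V'` has bounded derivatives up to order `j`. -/
def RegularAtInfinity (V : ℝ → ℝ) (j : ℕ) : Prop :=
  ∃ R B : ℝ, ∀ x : ℝ, R ≤ |x| →
    deriv V x ≠ 0 ∧ ∀ i ≤ j, |iteratedDeriv i (fun y => 1 / deriv V y) x| ≤ B

end

end BetaEnsemble

/-! Write [a,b] = [m−ρ, m+ρ], let ω be the arcsine law of this interval and w(x) = ρ² − (x−m)².
Everything rests on two operators, T h(x) = ∫ (h(x)−h(y))/(x−y) dω(y) and U h(x) = (x−m) h(x) − ∫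
(h(x)−h(y))/(x−y) w(y) dω(y). T kills constants and U inverts it up to constants: U T h = h − ∫ h dω
(`U_T`). They are dual, ∫ (U h) ψ dω = ∫ h w (T ψ) dω (`integral_U_mul`), so U h always has ω-mean
zero. Hence U h = G forces ∫ G dω = 0 and h = T G (`eq_T_of_U_eq`). Since h enters through divided
differences, no principal value is needed, and identities are checked on polynomials and extended by
C¹ or C² approximation (`eq_zero_of_polynomial`).

The master operator is a conjugate of U: Ξ f = U(f · T V') (`Xi_eq_U`). As T V' has no zero
(`T_deriv_ne_zero`), the equation Ξ f = g + c is solvable exactly for c = −∫ g dω, with the single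
solution f = T g / T V'.

The conjugation amounts to two facts, β dμ = w (T V') dω and U(T V') = V'. By minimality V − β∫
log|·−y| dμ(y) is constant μ-a.e., hence ω-a.e. because the density of μ is positive. Chebyshev
polynomials diagonalise the logarithmic potential of ω (`integral_log_mul_cheb`); integrating the
Euler–Lagrange equation against them yields β dμ = (β − U V') dω at the level of moments
(`integral_polynomial`). Varying μ by dilations about m gives ∫ (x−m) V' dμ = β/2, and a
sum-of-squares identity turns this into ∫ V' dω = 0 and ∫ (x−m) V' dω = β (`integral_deriv`). The
algebraic relation between U and T (`U_add_mul_T`) then rewrites β − U V' as w · T V', and the first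
of these two moments gives U(T V') = V'.

On [a,b] the lower bound on S becomes a positive lower bound for T V'; outside, a zero of T V' would
make V' equal to β times the Stieltjes transform of μ, which is excluded.

For the estimates, T h is an average of h', so T costs one derivative and T g / T V' is controlled
on compacts. Near infinity (x−m) T g(x) = g(x) − ∫ g dω plus Cauchy transforms that vanish with all
derivatives (`sub_mul_T_eq`). Dividing by the same formula for V', whose ω-mean is zero, gives (g +
c)/V' up to small relative errors, linearly in g (`exists_expansion`), hence both the norm bound and
the asymptotics. -/

namespace BetaEnsemble

noncomputable section

/-! ### Integrals over compact sets. -/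

section CompactlySupported

variable {X : Type*} [TopologicalSpace X] [MeasurableSpace X] [OpensMeasurableSpace X]
  [T2Space X]

/-- A function continuous on a compact set carrying a finite measure is integrable. -/
lemma integrable_of_continuousOn_compact {π : Measure X} [IsFiniteMeasure π] {K : Set X}
    (hK : IsCompact K) (hπ : ∀ᵐ z ∂π, z ∈ K) {φ : X → ℝ} (hφ : ContinuousOn φ K) :
    Integrable φ π := by
  have h := hφ.integrableOn_compact (μ := π) hK
  rwa [IntegrableOn, Measure.restrict_eq_self_of_ae_mem hπ] at h

/-- Differentiation under an integral over a compact set. -/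
lemma hasDerivAt_integral_of_compact [SecondCountableTopology X] {π : Measure X} [IsFiniteMeasure π] {K : Set X}
    (hK : IsCompact K) (hπ : ∀ᵐ z ∂π, z ∈ K) {F F' : ℝ → X → ℝ} {s : Set ℝ} (hs : IsOpen s)
    (hF : ∀ x ∈ s, ContinuousOn (F x) K)
    (hF' : ContinuousOn (fun w : ℝ × X => F' w.1 w.2) (s ×ˢ K))
    (hd : ∀ x ∈ s, ∀ z ∈ K, HasDerivAt (fun y => F y z) (F' x z) x) {x : ℝ} (hx : x ∈ s) :
    HasDerivAt (fun x => ∫ z, F x z ∂π) (∫ z, F' x z ∂π) x := by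
  obtain ⟨r, hr, hrs⟩ := Metric.nhds_basis_closedBall.mem_iff.1 (hs.mem_nhds hx)
  -- Compactness of ball times K turns joint continuity of the derivative into a constant dominating
  -- function.
  obtain ⟨M, hM⟩ := ((isCompact_closedBall x r).prod hK).exists_bound_of_continuousOn
    (hF'.mono (Set.prod_mono hrs Subset.rfl))
  have hF'x : ContinuousOn (F' x) K :=
    hF'.comp (f := fun z => (x, z)) (by fun_prop) fun z hz => ⟨hx, hz⟩
  refine (hasDerivAt_integral_of_dominated_loc_of_deriv_le (bound := fun _ => M)
    (Metric.closedBall_mem_nhds x hr) ?_ ?_ ?_ ?_ (integrable_const _) ?_).2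
  · filter_upwards [hs.mem_nhds hx] with y hy
    exact (integrable_of_continuousOn_compact hK hπ (hF y hy)).aestronglyMeasurable
  · exact integrable_of_continuousOn_compact hK hπ (hF x hx)
  · exact (integrable_of_continuousOn_compact hK hπ hF'x).aestronglyMeasurable
  · filter_upwards [hπ] with z hz y hy using hM (y, z) ⟨hy, hz⟩
  · filter_upwards [hπ] with z hz y hy using hd y (hrs hy) z hz

end CompactlySupported

/-! ### The arcsine law and polynomial approximation. -/

/-- The arcsine law on `[m - ρ, m + ρ]`. -/
def arcsine (m ρ : ℝ) : Measure ℝ :=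
  Measure.map (fun θ => m + ρ * Real.cos θ)
    (ENNReal.ofReal Real.pi⁻¹ • volume.restrict (Ioc 0 Real.pi))

variable {m ρ : ℝ}

instance : IsProbabilityMeasure (arcsine m ρ) := by
  constructor
  rw [arcsine, Measure.map_apply (by fun_prop) MeasurableSet.univ]
  simp [← ENNReal.ofReal_mul, Real.pi_pos.le, Real.pi_ne_zero]

lemma integral_arcsine {φ : ℝ → ℝ} (hφ : AEStronglyMeasurable φ (arcsine m ρ)) :
    ∫ x, φ x ∂(arcsine m ρ) = Real.pi⁻¹ * ∫ θ in 0..Real.pi, φ (m + ρ * Real.cos θ) := by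
  rw [arcsine, integral_map (by fun_prop) hφ, integral_smul_measure,
    ENNReal.toReal_ofReal (by positivity), intervalIntegral.integral_of_le Real.pi_pos.le, smul_eq_mul]

lemma mem_Icc_angle (hρ : 0 ≤ ρ) (θ : ℝ) : m + ρ * Real.cos θ ∈ Icc (m - ρ) (m + ρ) := by
  constructor <;> nlinarith [Real.neg_one_le_cos θ, Real.cos_le_one θ]

lemma exists_angle (hρ : 0 < ρ) {x : ℝ} (hx : x ∈ Icc (m - ρ) (m + ρ)) :
    ∃ θ ∈ Icc 0 Real.pi, m + ρ * Real.cos θ = x := by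
  refine ⟨Real.arccos ((x - m) / ρ), ⟨Real.arccos_nonneg _, Real.arccos_le_pi _⟩, ?_⟩
  rw [Real.cos_arccos]
  · field_simp; ring
  · rw [le_div_iff₀ hρ]; linarith [hx.1]
  · rw [div_le_iff₀ hρ]; linarith [hx.2]

lemma arcsine_ae_mem (hρ : 0 ≤ ρ) : ∀ᵐ x ∂(arcsine m ρ), x ∈ Icc (m - ρ) (m + ρ) := by
  rw [arcsine]
  refine (ae_map_iff (p := fun x => x ∈ Icc (m - ρ) (m + ρ)) (by fun_prop) measurableSet_Icc).2 ?_
  exact Eventually.of_forall fun θ => mem_Icc_angle hρ θ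

lemma integrable_arcsine (hρ : 0 ≤ ρ) {φ : ℝ → ℝ} (hφ : ContinuousOn φ (Icc (m - ρ) (m + ρ))) :
    Integrable φ (arcsine m ρ) :=
  integrable_of_continuousOn_compact isCompact_Icc (arcsine_ae_mem hρ) hφ

lemma Continuous.integrable_arcsine (hρ : 0 ≤ ρ) {φ : ℝ → ℝ} (hφ : Continuous φ) :
    Integrable φ (arcsine m ρ) :=
  BetaEnsemble.integrable_arcsine hρ hφ.continuousOn

/-- The angles in (0, π) mapped into a null set form its image under the rescaled arccos. That map
is differentiable away from the endpoints, so it preserves null sets. -/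
lemma arcsine_absolutelyContinuous (hρ : 0 < ρ) : arcsine m ρ ≪ volume := by
  refine Measure.AbsolutelyContinuous.mk fun s hs h0 => ?_
  rw [arcsine, Measure.map_apply (by fun_prop) hs, Measure.smul_apply, smul_eq_mul]
  refine mul_eq_zero_of_right _ ?_
  rw [← restrict_Ioo_eq_restrict_Ioc, Measure.restrict_apply (measurableSet_preimage (by fun_prop) hs)]
  have hnull : volume ((fun x => Real.arccos ((x - m) / ρ)) '' (s ∩ Ioo (m - ρ) (m + ρ))) = 0 := by
    refine addHaar_image_eq_zero_of_differentiableOn_of_addHaar_eq_zero volume ?_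
      (measure_mono_null inter_subset_left h0)
    intro x hx
    have h1 : (x - m) / ρ ≠ -1 := by
      rw [Ne, div_eq_iff hρ.ne']; linarith [hx.2.1]
    have h2 : (x - m) / ρ ≠ 1 := by
      rw [Ne, div_eq_iff hρ.ne']; linarith [hx.2.2]
    have h3 : DifferentiableAt ℝ (fun x => (x - m) / ρ) x := by fun_prop
    exact (DifferentiableAt.fun_comp' x (Real.differentiableAt_arccos.2 ⟨h1, h2⟩)
      h3).differentiableWithinAt
  refine measure_mono_null ?_ hnull
  intro θ hθ
  refine ⟨m + ρ * Real.cos θ, ⟨hθ.1, ?_⟩, ?_⟩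
  · have h1 : Real.cos θ < 1 := by
      simpa using Real.cos_lt_cos_of_nonneg_of_le_pi le_rfl hθ.2.2.le hθ.2.1
    have h2 : -1 < Real.cos θ := by
      simpa using Real.cos_lt_cos_of_nonneg_of_le_pi hθ.2.1.le le_rfl hθ.2.2
    constructor <;> nlinarith
  · simp only [add_sub_cancel_left, mul_div_cancel_left₀ _ hρ.ne']
    exact Real.arccos_cos hθ.2.1.le hθ.2.2.le

/-- The arcsine law charges every nonempty relatively open subset of its interval. -/
lemma eq_zero_of_integral_arcsine_eq_zero (hρ : 0 < ρ) {F : ℝ → ℝ} (hF : Continuous F)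
    (h0 : ∀ x ∈ Icc (m - ρ) (m + ρ), 0 ≤ F x) (hint : ∫ x, F x ∂(arcsine m ρ) = 0) :
    ∀ x ∈ Icc (m - ρ) (m + ρ), F x = 0 := by
  intro x hx
  obtain ⟨θ, hθ, rfl⟩ := exists_angle hρ hx
  rw [integral_arcsine hF.aestronglyMeasurable] at hint
  have hint' := (mul_eq_zero.1 hint).resolve_left (inv_ne_zero Real.pi_ne_zero)
  by_contra hne
  have hpos : 0 < F (m + ρ * Real.cos θ) :=
    lt_of_le_of_ne (h0 _ (mem_Icc_angle hρ.le θ)) (Ne.symm hne)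
  have := intervalIntegral.integral_pos Real.pi_pos
    (f := fun θ => F (m + ρ * Real.cos θ)) (by fun_prop)
    (fun t _ => h0 _ (mem_Icc_angle hρ.le t)) ⟨θ, hθ, hpos⟩
  linarith

/-- A continuous function orthogonal to all polynomials for the arcsine law vanishes. -/
lemma eq_zero_of_integral_mul_polynomial (hρ : 0 < ρ) {G : ℝ → ℝ} (hG : Continuous G)
    (h : ∀ P : Polynomial ℝ, ∫ x, G x * P.eval x ∂(arcsine m ρ) = 0) :
    ∀ x ∈ Icc (m - ρ) (m + ρ), G x = 0 := by
  -- Orthogonality lets one factor G be replaced by G − P, so ∫ G² is at most ‖G‖₁ sup|G − P|; the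
  -- `+ 1` in the denominator covers ‖G‖₁ = 0.
  have key : ∫ x, G x * G x ∂(arcsine m ρ) = 0 := by
    rw [← norm_le_zero_iff]
    have hC : 0 ≤ ∫ x, |G x| ∂(arcsine m ρ) := integral_nonneg fun _ => abs_nonneg _
    refine le_of_forall_pos_le_add fun ε hε => ?_
    set C := ∫ x, |G x| ∂(arcsine m ρ)
    obtain ⟨P, hP⟩ := exists_polynomial_near_of_continuousOn (m - ρ) (m + ρ) G hG.continuousOn
      (ε / (C + 1)) (by positivity)
    have e : ∫ x, G x * G x ∂(arcsine m ρ) = ∫ x, G x * (G x - P.eval x) ∂(arcsine m ρ) := by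
      simp_rw [mul_sub]
      rw [integral_sub (Continuous.integrable_arcsine hρ.le (by fun_prop))
        (Continuous.integrable_arcsine hρ.le (by fun_prop)), h P, sub_zero]
    rw [e, zero_add]
    calc ‖∫ x, G x * (G x - P.eval x) ∂(arcsine m ρ)‖
        ≤ ∫ x, |G x| * (ε / (C + 1)) ∂(arcsine m ρ) := by
          refine norm_integral_le_of_norm_le (Continuous.integrable_arcsine hρ.le (by fun_prop)) ?_
          filter_upwards [arcsine_ae_mem hρ.le] with x hx
          rw [norm_mul, Real.norm_eq_abs, Real.norm_eq_abs, abs_sub_comm]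
          exact mul_le_mul_of_nonneg_left (hP x hx).le (abs_nonneg _)
      _ = C * (ε / (C + 1)) := by rw [integral_mul_const]
      _ ≤ ε := by
          rw [mul_div_assoc', div_le_iff₀ (by positivity)]; nlinarith
  intro x hx
  exact mul_self_eq_zero.1 (eq_zero_of_integral_arcsine_eq_zero hρ (F := fun x => G x * G x)
    (by fun_prop) (fun x _ => mul_self_nonneg _) key x hx)

/-- If a finite measure on `[m - ρ, m + ρ]` and a continuous multiple of the arcsine law agree on
polynomials, they agree on continuous functions. -/
lemma integral_eq_of_polynomial (hρ : 0 < ρ) {μ : Measure ℝ} [IsFiniteMeasure μ]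
    (hμ : ∀ᵐ x ∂μ, x ∈ Icc (m - ρ) (m + ρ)) {β : ℝ} {G : ℝ → ℝ} (hG : Continuous G)
    (h : ∀ P : Polynomial ℝ, β * ∫ x, P.eval x ∂μ = ∫ x, G x * P.eval x ∂(arcsine m ρ))
    {φ : ℝ → ℝ} (hφ : ContinuousOn φ (Icc (m - ρ) (m + ρ))) :
    β * ∫ x, φ x ∂μ = ∫ x, G x * φ x ∂(arcsine m ρ) := by
  rw [← sub_eq_zero, ← norm_le_zero_iff]
  refine le_of_forall_pos_le_add fun ε hε => ?_
  have hC : 0 ≤ ∫ x, |G x| ∂(arcsine m ρ) := integral_nonneg fun _ => abs_nonneg _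
  set C := ∫ x, |G x| ∂(arcsine m ρ)
  set δ := ε / (|β| * μ.real univ + C + 1) with hδ
  have hδ0 : 0 < δ := by positivity
  obtain ⟨P, hP⟩ := exists_polynomial_near_of_continuousOn (m - ρ) (m + ρ) φ hφ δ hδ0
  have iμ := integrable_of_continuousOn_compact isCompact_Icc hμ hφ
  have iP := integrable_of_continuousOn_compact isCompact_Icc hμ (P.continuous.continuousOn)
  have e : β * ∫ x, φ x ∂μ - ∫ x, G x * φ x ∂(arcsine m ρ) =
      β * (∫ x, (φ x - P.eval x) ∂μ) - ∫ x, G x * (φ x - P.eval x) ∂(arcsine m ρ) := by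
    have i1 : Integrable (fun x => G x * φ x) (arcsine m ρ) :=
      integrable_arcsine hρ.le (hG.continuousOn.mul hφ)
    have i2 : Integrable (fun x => G x * P.eval x) (arcsine m ρ) :=
      Continuous.integrable_arcsine hρ.le (by fun_prop)
    simp_rw [mul_sub]
    rw [integral_sub iμ iP, integral_sub i1 i2, mul_sub, h P]
    ring
  have b1 : ‖∫ x, (φ x - P.eval x) ∂μ‖ ≤ δ * μ.real univ := by
    refine norm_integral_le_of_norm_le_const ?_
    filter_upwards [hμ] with x hx
    rw [Real.norm_eq_abs, abs_sub_comm]; exact (hP x hx).le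
  have b2 : ‖∫ x, G x * (φ x - P.eval x) ∂(arcsine m ρ)‖ ≤ C * δ := by
    rw [← integral_mul_const]
    refine norm_integral_le_of_norm_le (Continuous.integrable_arcsine hρ.le (by fun_prop)) ?_
    filter_upwards [arcsine_ae_mem hρ.le] with x hx
    rw [norm_mul, Real.norm_eq_abs, Real.norm_eq_abs, abs_sub_comm (φ x)]
    exact mul_le_mul_of_nonneg_left (hP x hx).le (abs_nonneg _)
  rw [e, zero_add]
  calc _ ≤ ‖β * (∫ x, (φ x - P.eval x) ∂μ)‖ + ‖∫ x, G x * (φ x - P.eval x) ∂(arcsine m ρ)‖ :=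
        norm_sub_le _ _
    _ ≤ |β| * (δ * μ.real univ) + C * δ := by
        rw [norm_mul, Real.norm_eq_abs]
        gcongr
    _ ≤ δ * (|β| * μ.real univ + C + 1) := by nlinarith
    _ = ε := by rw [hδ]; field_simp

/-- Polynomial approximation of a smooth function together with its derivatives. -/
lemma exists_polynomial_near_deriv (n : ℕ) (R : ℝ) (hR : 0 ≤ R) :
    ∀ (h : ℝ → ℝ), ContDiff ℝ n h → ∀ ε > 0, ∃ P : Polynomial ℝ, ∀ x ∈ Icc (-R) R, ∀ i ≤ n,
      |iteratedDeriv i (fun y => h y - P.eval y) x| ≤ ε := by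
  induction n with
  | zero =>
    intro h hh ε hε
    obtain ⟨P, hP⟩ := exists_polynomial_near_of_continuousOn (-R) R h
      (hh.continuous.continuousOn) ε hε
    refine ⟨P, fun x hx i hi => ?_⟩
    obtain rfl : i = 0 := by omega
    rw [iteratedDeriv_zero, abs_sub_comm]
    exact (hP x hx).le
  | succ n ih =>
    intro h hh ε hε
    have hd : Differentiable ℝ h := hh.differentiable (by simp)
    have hh' : ContDiff ℝ n (deriv h) := by
      have : ContDiff ℝ ((n : WithTop ℕ∞) + 1) h := by exact_mod_cast hh
      exact (contDiff_succ_iff_deriv.1 this).2.2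
    -- Approximate h' by Q and integrate, fixing the constant so that P and h agree at 0. Over a
    -- length at most R the slope error ε/(R + 1) accumulates to at most ε.
    obtain ⟨Q, hQ⟩ := ih (deriv h) hh' (ε / (R + 1)) (by positivity)
    obtain ⟨Q', hQ'⟩ : ∃ Q' : Polynomial ℝ, Polynomial.derivative Q' = Q := by
      refine ⟨∑ i ∈ Q.support, Polynomial.C (Q.coeff i / (i + 1)) * Polynomial.X ^ (i + 1), ?_⟩
      rw [Polynomial.derivative_sum]
      conv_rhs => rw [Q.as_sum_support_C_mul_X_pow]
      refine Finset.sum_congr rfl fun i _ => ?_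
      rw [Polynomial.derivative_C_mul_X_pow]
      congr 2
      push_cast
      field_simp
    set P := Q' + Polynomial.C (h 0 - Q'.eval 0) with hPdef
    have hP' : Polynomial.derivative P = Q := by simp [hPdef, hQ']
    have hP0 : P.eval 0 = h 0 := by simp [hPdef]
    have hder : deriv (fun y => h y - P.eval y) = fun y => deriv h y - Q.eval y := by
      ext y
      rw [deriv_fun_sub (hd y) P.differentiableAt, P.deriv, hP']
    have hle : ε / (R + 1) ≤ ε := div_le_self hε.le (by linarith)
    refine ⟨P, fun x hx i hi => ?_⟩
    rcases i with _ | i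
    · rw [iteratedDeriv_zero]
      have hdiff : ∀ y ∈ Icc (-R) R,
          HasDerivWithinAt (fun y => h y - P.eval y) (deriv h y - Q.eval y) (Icc (-R) R) y := by
        intro y _
        have := ((hd y).hasDerivAt.sub (P.hasDerivAt y)).hasDerivWithinAt (s := Icc (-R) R)
        rwa [hP'] at this
      have := (convex_Icc (-R) R).norm_image_sub_le_of_norm_hasDerivWithin_le hdiff
        (C := ε / (R + 1)) (fun y hy => by simpa using hQ y hy 0 (Nat.zero_le _))
        (x := 0) (y := x) ⟨by linarith, hR⟩ hx
      simp only [hP0, sub_self, sub_zero, Real.norm_eq_abs] at this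
      have hxR : |x| ≤ R := abs_le.2 hx
      calc _ ≤ ε / (R + 1) * |x| := this
        _ ≤ ε / (R + 1) * (R + 1) := by gcongr; linarith
        _ = ε := by field_simp
    · rw [iteratedDeriv_succ', hder]
      exact (hQ x hx i (by omega)).trans hle

end

end BetaEnsemble

/-! ### Divided differences and the operators T, U, M. -/

namespace BetaEnsemble

noncomputable section

/-- The difference quotient `(h x - h y) / (x - y)`, extended by `h'` to the diagonal. -/
def dq (h : ℝ → ℝ) (x y : ℝ) : ℝ := ∫ t in (0 : ℝ)..1, deriv h (y + t * (x - y))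

variable {f h ψ : ℝ → ℝ}

lemma sub_mul_dq (hh : ContDiff ℝ 1 h) (x y : ℝ) : (x - y) * dq h x y = h x - h y := by
  have hc : Continuous (deriv h) := hh.continuous_deriv le_rfl
  have := intervalIntegral.integral_eq_sub_of_hasDerivAt (a := (0 : ℝ)) (b := 1)
    (f := fun t => h (y + t * (x - y))) (f' := fun t => (x - y) * deriv h (y + t * (x - y)))
    (fun t _ => by
      have h1 : HasDerivAt (fun t => y + t * (x - y)) (x - y) t := by
        simpa using ((hasDerivAt_id t).mul_const (x - y)).const_add y
      have h2 := ((hh.differentiable one_ne_zero) (y + t * (x - y))).hasDerivAt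
      refine (h2.comp t h1).congr_deriv (mul_comm _ _))
    ((by fun_prop : Continuous _).intervalIntegrable _ _)
  rw [intervalIntegral.integral_const_mul] at this
  simpa [dq] using this

lemma dq_of_ne (hh : ContDiff ℝ 1 h) {x y : ℝ} (hxy : x ≠ y) :
    dq h x y = (h x - h y) / (x - y) := by
  rw [eq_div_iff (sub_ne_zero.2 hxy), mul_comm, sub_mul_dq hh]

lemma dq_self (h : ℝ → ℝ) (x : ℝ) : dq h x x = deriv h x := by simp [dq]

lemma continuous_dq (hh : ContDiff ℝ 1 h) : Continuous fun z : ℝ × ℝ => dq h z.1 z.2 := by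
  have hc : Continuous (deriv h) := hh.continuous_deriv le_rfl
  unfold dq
  fun_prop

lemma continuous_dq_right (hh : ContDiff ℝ 1 h) (x : ℝ) : Continuous (dq h x) :=
  (continuous_dq hh).comp (by fun_prop : Continuous fun y => (x, y))

lemma dq_sub (hf : ContDiff ℝ 1 f) (hh : ContDiff ℝ 1 h) (x y : ℝ) :
    dq (fun z => f z - h z) x y = dq f x y - dq h x y := by
  rcases eq_or_ne x y with rfl | hxy
  · simp_rw [dq_self]
    exact deriv_fun_sub (hf.differentiable one_ne_zero x) (hh.differentiable one_ne_zero x)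
  · rw [dq_of_ne (hf.sub hh) hxy, dq_of_ne hf hxy, dq_of_ne hh hxy]; ring

lemma dq_add (hf : ContDiff ℝ 1 f) (hh : ContDiff ℝ 1 h) (x y : ℝ) :
    dq (fun z => f z + h z) x y = dq f x y + dq h x y := by
  rcases eq_or_ne x y with rfl | hxy
  · simp_rw [dq_self]
    exact deriv_fun_add (hf.differentiable one_ne_zero x) (hh.differentiable one_ne_zero x)
  · rw [dq_of_ne (hf.add hh) hxy, dq_of_ne hf hxy, dq_of_ne hh hxy]; ring

lemma dq_mul (hf : ContDiff ℝ 1 f) (hh : ContDiff ℝ 1 h) (x y : ℝ) :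
    dq (fun z => f z * h z) x y = dq f x y * h y + f x * dq h x y := by
  rcases eq_or_ne x y with rfl | hxy
  · simp_rw [dq_self]
    exact deriv_fun_mul (hf.differentiable one_ne_zero x) (hh.differentiable one_ne_zero x)
  · rw [dq_of_ne (hf.mul hh) hxy, dq_of_ne hf hxy, dq_of_ne hh hxy]
    ring

lemma dq_const (c x y : ℝ) : dq (fun _ => c) x y = 0 := by simp [dq]

lemma dq_sub_const (m x y : ℝ) : dq (fun z => z - m) x y = 1 := by simp [dq]

lemma abs_dq_le {R C : ℝ} (hh : ∀ z ∈ Icc (-R) R, |deriv h z| ≤ C) {x y : ℝ}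
    (hx : x ∈ Icc (-R) R) (hy : y ∈ Icc (-R) R) : |dq h x y| ≤ C := by
  have := intervalIntegral.norm_integral_le_of_norm_le_const (a := (0 : ℝ)) (b := 1) (C := C)
    (f := fun t => deriv h (y + t * (x - y))) (fun t ht => by
      rw [uIoc_of_le zero_le_one] at ht
      refine hh _ ?_
      have := (convex_Icc (-R) R).add_smul_sub_mem hy hx ⟨ht.1.le, ht.2⟩
      simpa using this)
  simpa [dq] using this

/-- The averaged difference quotient `T h x = ∫ (h x - h y) / (x - y) dω(y)` for the arcsine law. -/
def T (m ρ : ℝ) (h : ℝ → ℝ) (x : ℝ) : ℝ := ∫ y, dq h x y ∂(arcsine m ρ)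

/-- The regular part of the principal value `∫ h(y) (ρ² - (y - m)²) / (x - y) dω(y)`. -/
def U (m ρ : ℝ) (h : ℝ → ℝ) (x : ℝ) : ℝ :=
  (x - m) * h x - ∫ y, dq h x y * (ρ ^ 2 - (y - m) ^ 2) ∂(arcsine m ρ)

/-- The operator `M r φ x = ∬ t ^ r φ(y + t (x - y)) dt dω(y)`. -/
def M (m ρ : ℝ) (r : ℕ) (φ : ℝ → ℝ) (x : ℝ) : ℝ :=
  ∫ z : ℝ × ℝ, z.2 ^ r * φ (z.1 + z.2 * (x - z.1))
    ∂((arcsine m ρ).prod (volume.restrict (Icc (0 : ℝ) 1)))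

variable {m ρ : ℝ}

instance : IsProbabilityMeasure (volume.restrict (Icc (0 : ℝ) 1)) := ⟨by simp⟩

lemma ae_prod_mem (hρ : 0 ≤ ρ) : ∀ᵐ z ∂((arcsine m ρ).prod (volume.restrict (Icc (0 : ℝ) 1))),
    z ∈ Icc (m - ρ) (m + ρ) ×ˢ Icc (0 : ℝ) 1 := by
  have h1 := Measure.quasiMeasurePreserving_fst (μ := arcsine m ρ)
    (ν := volume.restrict (Icc (0 : ℝ) 1)) |>.ae (arcsine_ae_mem hρ)
  have h2 := Measure.quasiMeasurePreserving_snd (μ := arcsine m ρ)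
    (ν := volume.restrict (Icc (0 : ℝ) 1)) |>.ae (ae_restrict_mem measurableSet_Icc)
  filter_upwards [h1, h2] with z hz1 hz2 using ⟨hz1, hz2⟩

lemma isCompact_prod_Icc : IsCompact (Icc (m - ρ) (m + ρ) ×ˢ Icc (0 : ℝ) 1) :=
  isCompact_Icc.prod isCompact_Icc

lemma hasDerivAt_M (hρ : 0 ≤ ρ) (r : ℕ) {φ : ℝ → ℝ} (hφ : ContDiff ℝ 1 φ) (x : ℝ) :
    HasDerivAt (M m ρ r φ) (M m ρ (r + 1) (deriv φ) x) x := by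
  have hc : Continuous (deriv φ) := hφ.continuous_deriv le_rfl
  have hc0 : Continuous φ := hφ.continuous
  refine hasDerivAt_integral_of_compact isCompact_prod_Icc (ae_prod_mem hρ) isOpen_univ
    (F' := fun x z => z.2 ^ (r + 1) * deriv φ (z.1 + z.2 * (x - z.1)))
    (fun x _ => by fun_prop) (by fun_prop) (fun x _ z _ => ?_) (mem_univ x)
  have h1 : HasDerivAt (fun x => z.1 + z.2 * (x - z.1)) z.2 x := by
    simpa using (((hasDerivAt_id x).sub_const z.1).const_mul z.2).const_add z.1
  have h2 := ((hφ.differentiable one_ne_zero) (z.1 + z.2 * (x - z.1))).hasDerivAt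
  have := (h2.comp x h1).const_mul (z.2 ^ r)
  refine this.congr_deriv ?_
  ring

lemma continuous_M (hρ : 0 ≤ ρ) (r : ℕ) {φ : ℝ → ℝ} (hφ : Continuous φ) :
    Continuous (M m ρ r φ) := by
  have := continuous_parametric_integral_of_continuous
    (μ := (arcsine m ρ).prod (volume.restrict (Icc (0 : ℝ) 1)))
    (f := fun (x : ℝ) (z : ℝ × ℝ) => z.2 ^ r * φ (z.1 + z.2 * (x - z.1))) (by fun_prop)
    (isCompact_prod_Icc (m := m) (ρ := ρ))
  rwa [Measure.restrict_eq_self_of_ae_mem (ae_prod_mem hρ)] at this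

/-- Each differentiation moves φ to φ' and raises r by one, so induction stays within the family M
r; this is the reason for carrying the weight t^r. -/
lemma contDiff_M (hρ : 0 ≤ ρ) (n : ℕ) : ∀ (r : ℕ) (φ : ℝ → ℝ), ContDiff ℝ n φ →
    ContDiff ℝ n (M m ρ r φ) := by
  induction n with
  | zero =>
    intro r φ hφ
    exact contDiff_zero.2 (continuous_M hρ r hφ.continuous)
  | succ n ih =>
    intro r φ hφ
    have h1 : ContDiff ℝ 1 φ := hφ.of_le (by exact_mod_cast Nat.succ_le_succ (Nat.zero_le n))
    have h2 : ContDiff ℝ ((n : WithTop ℕ∞) + 1) φ := by exact_mod_cast hφ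
    have h3 : ContDiff ℝ ((n : WithTop ℕ∞) + 1) (M m ρ r φ) := by
      refine contDiff_succ_iff_deriv.2 ⟨fun x => (hasDerivAt_M hρ r h1 x).differentiableAt,
        by simp, ?_⟩
      rw [show deriv (M m ρ r φ) = M m ρ (r + 1) (deriv φ) from
        funext fun x => (hasDerivAt_M hρ r h1 x).deriv]
      exact ih _ _ (contDiff_succ_iff_deriv.1 h2).2.2
    exact_mod_cast h3

lemma iteratedDeriv_M (hρ : 0 ≤ ρ) (n : ℕ) : ∀ (r : ℕ) (φ : ℝ → ℝ), ContDiff ℝ n φ →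
    iteratedDeriv n (M m ρ r φ) = M m ρ (r + n) (iteratedDeriv n φ) := by
  induction n with
  | zero => intro r φ _; simp
  | succ n ih =>
    intro r φ hφ
    have h1 : ContDiff ℝ 1 φ := hφ.of_le (by exact_mod_cast Nat.succ_le_succ (Nat.zero_le n))
    have h2 : ContDiff ℝ ((n : WithTop ℕ∞) + 1) φ := by exact_mod_cast hφ
    rw [iteratedDeriv_succ', show deriv (M m ρ r φ) = M m ρ (r + 1) (deriv φ) from
        funext fun x => (hasDerivAt_M hρ r h1 x).deriv,
      ih _ _ (contDiff_succ_iff_deriv.1 h2).2.2, ← iteratedDeriv_succ']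
    congr 1
    ring

lemma abs_M_le (hρ : 0 ≤ ρ) (r : ℕ) {φ : ℝ → ℝ} {R C : ℝ}
    (hI : Icc (m - ρ) (m + ρ) ⊆ Icc (-R) R) (hφ : ∀ z ∈ Icc (-R) R, |φ z| ≤ C)
    {x : ℝ} (hx : x ∈ Icc (-R) R) : |M m ρ r φ x| ≤ C := by
  have hC : 0 ≤ C := (abs_nonneg _).trans (hφ x hx)
  have := norm_integral_le_of_norm_le_const (C := C)
    (μ := (arcsine m ρ).prod (volume.restrict (Icc (0 : ℝ) 1)))
    (f := fun z : ℝ × ℝ => z.2 ^ r * φ (z.1 + z.2 * (x - z.1))) (by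
      filter_upwards [ae_prod_mem hρ] with z hz
      rw [norm_mul, norm_pow]
      have h1 : ‖z.2‖ ^ r ≤ 1 := pow_le_one₀ (norm_nonneg _) (by
        rw [Real.norm_eq_abs, abs_of_nonneg hz.2.1]; exact hz.2.2)
      have h2 : ‖φ (z.1 + z.2 * (x - z.1))‖ ≤ C := by
        refine hφ _ ?_
        simpa using (convex_Icc (-R) R).add_smul_sub_mem (hI hz.1) hx hz.2
      calc _ ≤ 1 * C := by gcongr
        _ = C := one_mul C)
  rwa [probReal_univ, mul_one] at this

/-- A divided difference is the average of h' over a segment, so T h is an average of h': T loses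
exactly one derivative, with sup-norm constant 1 on intervals containing the support. -/
lemma T_eq_M (hρ : 0 ≤ ρ) (hh : ContDiff ℝ 1 h) : T m ρ h = M m ρ 0 (deriv h) := by
  have hc : Continuous (deriv h) := hh.continuous_deriv le_rfl
  ext x
  rw [M, integral_prod _ (integrable_of_continuousOn_compact isCompact_prod_Icc (ae_prod_mem hρ)
    (by fun_prop))]
  simp [T, dq, intervalIntegral.integral_of_le, integral_Icc_eq_integral_Ioc]

lemma contDiff_T (hρ : 0 ≤ ρ) {n : ℕ} (hh : ContDiff ℝ (n + 1 : ℕ) h) :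
    ContDiff ℝ n (T m ρ h) := by
  have h1 : ContDiff ℝ 1 h := hh.of_le (by exact_mod_cast Nat.succ_le_succ (Nat.zero_le n))
  have h2 : ContDiff ℝ ((n : WithTop ℕ∞) + 1) h := by exact_mod_cast hh
  rw [T_eq_M hρ h1]
  exact contDiff_M hρ n _ _ (contDiff_succ_iff_deriv.1 h2).2.2

lemma abs_iteratedDeriv_T_le (hρ : 0 ≤ ρ) {n : ℕ} (hh : ContDiff ℝ (n + 1 : ℕ) h) {R C : ℝ}
    (hI : Icc (m - ρ) (m + ρ) ⊆ Icc (-R) R)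
    (hC : ∀ z ∈ Icc (-R) R, |iteratedDeriv (n + 1) h z| ≤ C) {x : ℝ} (hx : x ∈ Icc (-R) R) :
    |iteratedDeriv n (T m ρ h) x| ≤ C := by
  have h1 : ContDiff ℝ 1 h := hh.of_le (by exact_mod_cast Nat.succ_le_succ (Nat.zero_le n))
  have h2 : ContDiff ℝ ((n : WithTop ℕ∞) + 1) h := by exact_mod_cast hh
  rw [T_eq_M hρ h1, iteratedDeriv_M hρ n _ _ (contDiff_succ_iff_deriv.1 h2).2.2,
    ← iteratedDeriv_succ']
  exact abs_M_le hρ _ hI hC hx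

lemma continuous_T (hρ : 0 ≤ ρ) (hh : ContDiff ℝ 1 h) : Continuous (T m ρ h) :=
  contDiff_zero.1 (contDiff_T hρ (n := 0) (by simpa using hh))

lemma continuous_U (hρ : 0 ≤ ρ) (hh : ContDiff ℝ 1 h) : Continuous (U m ρ h) := by
  have hd := continuous_dq hh
  have h0 := hh.continuous
  have := continuous_parametric_integral_of_continuous (μ := arcsine m ρ)
    (f := fun (x y : ℝ) => dq h x y * (ρ ^ 2 - (y - m) ^ 2))
    (hd.mul (by fun_prop)) (isCompact_Icc (a := m - ρ) (b := m + ρ))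
  rw [Measure.restrict_eq_self_of_ae_mem (arcsine_ae_mem hρ)] at this
  unfold U
  fun_prop

section Linear

lemma integrable_dq (hρ : 0 ≤ ρ) (hh : ContDiff ℝ 1 h) (x : ℝ) :
    Integrable (dq h x) (arcsine m ρ) :=
  Continuous.integrable_arcsine hρ (continuous_dq_right hh x)

lemma integrable_dq_mul (hρ : 0 ≤ ρ) (hh : ContDiff ℝ 1 h) (x : ℝ) :
    Integrable (fun y => dq h x y * (ρ ^ 2 - (y - m) ^ 2)) (arcsine m ρ) :=
  Continuous.integrable_arcsine hρ ((continuous_dq_right hh x).mul (by fun_prop))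

lemma T_sub (hρ : 0 ≤ ρ) (hf : ContDiff ℝ 1 f) (hh : ContDiff ℝ 1 h) (x : ℝ) :
    T m ρ (fun z => f z - h z) x = T m ρ f x - T m ρ h x := by
  simp_rw [T, dq_sub hf hh]
  exact integral_sub (integrable_dq hρ hf x) (integrable_dq hρ hh x)

lemma T_add (hρ : 0 ≤ ρ) (hf : ContDiff ℝ 1 f) (hh : ContDiff ℝ 1 h) (x : ℝ) :
    T m ρ (fun z => f z + h z) x = T m ρ f x + T m ρ h x := by
  simp_rw [T, dq_add hf hh]
  exact integral_add (integrable_dq hρ hf x) (integrable_dq hρ hh x)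

lemma T_const (c x : ℝ) : T m ρ (fun _ => c) x = 0 := by simp [T, dq_const]

lemma T_sub_const (x : ℝ) : T m ρ (fun z => z - m) x = 1 := by simp [T, dq_sub_const]

lemma T_const_mul (c : ℝ) (hh : ContDiff ℝ 1 h) (x : ℝ) :
    T m ρ (fun z => c * h z) x = c * T m ρ h x := by
  simp_rw [T, dq_mul contDiff_const hh, dq_const, zero_mul, zero_add]
  exact integral_const_mul _ _

/-- Product rule for divided differences. With its analogue for U, it drives the inductions on
polynomials in x − m. -/
lemma T_sub_mul (hρ : 0 ≤ ρ) (hh : ContDiff ℝ 1 h) (x : ℝ) :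
    T m ρ (fun z => (z - m) * h z) x = ∫ y, h y ∂(arcsine m ρ) + (x - m) * T m ρ h x := by
  have h0 := hh.continuous
  have hx : ContDiff ℝ 1 fun z : ℝ => z - m := contDiff_id.sub contDiff_const
  simp_rw [T, dq_mul hx hh,
    dq_sub_const, one_mul]
  rw [integral_add (Continuous.integrable_arcsine hρ h0) ((integrable_dq hρ hh x).const_mul _),
    integral_const_mul]

lemma U_sub (hρ : 0 ≤ ρ) (hf : ContDiff ℝ 1 f) (hh : ContDiff ℝ 1 h) (x : ℝ) :
    U m ρ (fun z => f z - h z) x = U m ρ f x - U m ρ h x := by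
  simp_rw [U, dq_sub hf hh, sub_mul]
  rw [integral_sub (integrable_dq_mul hρ hf x) (integrable_dq_mul hρ hh x)]
  ring

lemma U_add (hρ : 0 ≤ ρ) (hf : ContDiff ℝ 1 f) (hh : ContDiff ℝ 1 h) (x : ℝ) :
    U m ρ (fun z => f z + h z) x = U m ρ f x + U m ρ h x := by
  simp_rw [U, dq_add hf hh, add_mul]
  rw [integral_add (integrable_dq_mul hρ hf x) (integrable_dq_mul hρ hh x)]
  ring

lemma U_const (c x : ℝ) : U m ρ (fun _ => c) x = (x - m) * c := by simp [U, dq_const]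

lemma U_sub_mul (hρ : 0 ≤ ρ) (hh : ContDiff ℝ 1 h) (x : ℝ) :
    U m ρ (fun z => (z - m) * h z) x =
      (x - m) * U m ρ h x - ∫ y, h y * (ρ ^ 2 - (y - m) ^ 2) ∂(arcsine m ρ) := by
  have h0 := hh.continuous
  have hx : ContDiff ℝ 1 fun z : ℝ => z - m := contDiff_id.sub contDiff_const
  simp_rw [U, dq_mul hx hh,
    dq_sub_const, one_mul, add_mul, mul_assoc]
  rw [integral_add (Continuous.integrable_arcsine hρ (by fun_prop))
    ((integrable_dq_mul hρ hh x).const_mul _), integral_const_mul]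
  ring

end Linear

lemma abs_sub_sq_le {y : ℝ} (hy : y ∈ Icc (m - ρ) (m + ρ)) : |ρ ^ 2 - (y - m) ^ 2| ≤ ρ ^ 2 := by
  rw [abs_le]
  constructor <;> nlinarith [hy.1, hy.2, sq_nonneg (y - m)]

lemma abs_U_le (hρ : 0 ≤ ρ) {R ε : ℝ} (hI : Icc (m - ρ) (m + ρ) ⊆ Icc (-R) R)
    (h0 : ∀ z ∈ Icc (-R) R, |h z| ≤ ε) (h1 : ∀ z ∈ Icc (-R) R, |deriv h z| ≤ ε)
    {x : ℝ} (hx : x ∈ Icc (-R) R) : |U m ρ h x| ≤ (|x - m| + ρ ^ 2) * ε := by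
  have hε : 0 ≤ ε := (abs_nonneg _).trans (h0 x hx)
  have := norm_integral_le_of_norm_le_const (C := ε * ρ ^ 2) (μ := arcsine m ρ)
    (f := fun y => dq h x y * (ρ ^ 2 - (y - m) ^ 2)) (by
      filter_upwards [arcsine_ae_mem hρ] with y hy
      rw [norm_mul]
      exact mul_le_mul (abs_dq_le h1 hx (hI hy)) (abs_sub_sq_le hy) (abs_nonneg _) hε)
  simp only [probReal_univ, mul_one, Real.norm_eq_abs] at this
  calc |U m ρ h x| ≤ |(x - m) * h x| + |∫ y, dq h x y * (ρ ^ 2 - (y - m) ^ 2) ∂(arcsine m ρ)| :=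
        abs_sub _ _
    _ ≤ |x - m| * ε + ε * ρ ^ 2 := by
        rw [abs_mul]
        gcongr
        exact h0 x hx
    _ = _ := by ring

/-- A linear functional which is continuous for a `C^n` norm on a compact interval and vanishes on
polynomials vanishes on all `C^n` functions. -/
lemma eq_zero_of_polynomial (n : ℕ) {R : ℝ} (hR : 0 ≤ R) (L : (ℝ → ℝ) → ℝ) (C : ℝ)
    (hsub : ∀ ψ, ContDiff ℝ n ψ → ∀ P : Polynomial ℝ,
      L (fun x => ψ x - P.eval x) = L ψ - L (fun x => P.eval x))
    (hbound : ∀ ψ, ContDiff ℝ n ψ → ∀ ε, 0 ≤ ε →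
      (∀ x ∈ Icc (-R) R, ∀ i ≤ n, |iteratedDeriv i ψ x| ≤ ε) → |L ψ| ≤ C * ε)
    (hpoly : ∀ P : Polynomial ℝ, L (fun x => P.eval x) = 0) {ψ : ℝ → ℝ} (hψ : ContDiff ℝ n ψ) :
    L ψ = 0 := by
  rw [← abs_nonpos_iff]
  refine le_of_forall_pos_le_add fun ε hε => ?_
  obtain ⟨P, hP⟩ := exists_polynomial_near_deriv n R hR ψ hψ (ε / (|C| + 1)) (by positivity)
  have hP' : ContDiff ℝ n fun x => P.eval x := P.contDiff_aeval (𝕜 := ℝ) (n := n)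
  have h1 := hbound _ (hψ.sub hP') (ε / (|C| + 1)) (by positivity) hP
  rw [hsub ψ hψ P, hpoly P, sub_zero] at h1
  calc |L ψ| ≤ C * (ε / (|C| + 1)) := h1
    _ ≤ (|C| + 1) * (ε / (|C| + 1)) := by gcongr; linarith [le_abs_self C]
    _ = 0 + ε := by field_simp; ring

end

end BetaEnsemble

/-! ### Chebyshev polynomials; duality and inversion of T and U. -/

namespace BetaEnsemble

noncomputable section

variable {m ρ : ℝ} {f h ψ : ℝ → ℝ}

lemma contDiff_sub_const (m : ℝ) {n : WithTop ℕ∞} : ContDiff ℝ n fun z : ℝ => z - m :=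
  contDiff_id.sub contDiff_const

/-- The Chebyshev polynomial of the first kind on `[m - ρ, m + ρ]`. -/
def cheb (m ρ : ℝ) (n : ℕ) : Polynomial ℝ :=
  (Polynomial.Chebyshev.T ℝ n).comp (Polynomial.C ρ⁻¹ * (Polynomial.X - Polynomial.C m))

lemma eval_cheb (n : ℕ) (x : ℝ) :
    (cheb m ρ n).eval x = (Polynomial.Chebyshev.T ℝ n).eval (ρ⁻¹ * (x - m)) := by
  simp [cheb]

lemma eval_cheb_angle (hρ : ρ ≠ 0) (n : ℕ) (θ : ℝ) :
    (cheb m ρ n).eval (m + ρ * Real.cos θ) = Real.cos (n * θ) := by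
  rw [eval_cheb, add_sub_cancel_left, inv_mul_cancel_left₀ hρ, Polynomial.Chebyshev.T_real_cos]
  simp

lemma cheb_zero : cheb m ρ 0 = 1 := by simp [cheb]

lemma eval_cheb_one (x : ℝ) : (cheb m ρ 1).eval x = ρ⁻¹ * (x - m) := by simp [eval_cheb]

lemma eval_cheb_add_two (n : ℕ) (x : ℝ) :
    (cheb m ρ (n + 2)).eval x =
      2 * ρ⁻¹ * ((x - m) * (cheb m ρ (n + 1)).eval x) - (cheb m ρ n).eval x := by
  simp only [eval_cheb]
  push_cast
  rw [Polynomial.Chebyshev.T_add_two]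
  simp only [Polynomial.eval_sub, Polynomial.eval_mul, Polynomial.eval_ofNat, Polynomial.eval_X]
  ring

/-- Induction on polynomials in the variable `X - m`. -/
lemma polynomial_induction (m : ℝ) {p : Polynomial ℝ → Prop} (hC : ∀ c, p (Polynomial.C c))
    (hadd : ∀ P Q, p P → p Q → p (P + Q))
    (hmul : ∀ P, p P → p ((Polynomial.X - Polynomial.C m) * P)) (P : Polynomial ℝ) : p P := by
  induction P using Polynomial.induction_on' with
  | add P Q hP hQ => exact hadd P Q hP hQ
  | monomial n a =>
    induction n generalizing a with
    | zero => exact hC a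
    | succ n ih =>
      have : Polynomial.monomial (n + 1) a =
          (Polynomial.X - Polynomial.C m) * Polynomial.monomial n a +
            Polynomial.monomial n (m * a) := by
        rw [sub_mul, Polynomial.X_mul_monomial, Polynomial.C_mul_monomial, sub_add_cancel]
      rw [this]
      exact hadd _ _ (hmul _ (ih a)) (ih _)

/-- A linear property of polynomials can be checked on Chebyshev polynomials. -/
lemma cheb_induction (hρ : ρ ≠ 0) {p : Polynomial ℝ → Prop} (hT : ∀ n, p (cheb m ρ n))
    (hadd : ∀ P Q, p P → p Q → p (P + Q)) (hsmul : ∀ (c : ℝ) P, p P → p (c • P))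
    (P : Polynomial ℝ) : p P := by
  have h0 : p 0 := by simpa using hsmul 0 _ (hT 0)
  suffices H : P ∈ Submodule.span ℝ (range (cheb m ρ)) by
    refine Submodule.span_induction ?_ h0 (fun P Q _ _ => hadd P Q) (fun c P _ => hsmul c P) H
    rintro _ ⟨n, rfl⟩
    exact hT n
  have hmem (n : ℕ) : cheb m ρ n ∈ Submodule.span ℝ (range (cheb m ρ)) :=
    Submodule.subset_span ⟨n, rfl⟩
  refine polynomial_induction m (p := fun P => P ∈ Submodule.span ℝ (range (cheb m ρ)))
    (fun c => ?_) (fun P Q => Submodule.add_mem _) (fun P hP => ?_) P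
  · have : Polynomial.C c = c • cheb m ρ 0 := by
      rw [cheb_zero, Polynomial.smul_eq_C_mul, mul_one]
    rw [this]
    exact Submodule.smul_mem _ _ (hmem 0)
  · refine Submodule.span_induction ?_ (by simp) (fun P Q _ _ hP hQ => ?_) (fun c P _ hP => ?_) hP
    · rintro _ ⟨n, rfl⟩
      rcases n with _ | n
      · have : (Polynomial.X - Polynomial.C m) * cheb m ρ 0 = ρ • cheb m ρ 1 := by
          refine Polynomial.funext fun x => ?_
          simp only [cheb_zero, Polynomial.eval_mul, Polynomial.eval_sub, Polynomial.eval_X,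
            Polynomial.eval_C, Polynomial.eval_one, Polynomial.eval_smul, eval_cheb_one, smul_eq_mul]
          field_simp
        rw [this]
        exact Submodule.smul_mem _ _ (hmem 1)
      · have : (Polynomial.X - Polynomial.C m) * cheb m ρ (n + 1) =
            (ρ / 2) • (cheb m ρ (n + 2) + cheb m ρ n) := by
          refine Polynomial.funext fun x => ?_
          simp only [Polynomial.eval_mul, Polynomial.eval_sub, Polynomial.eval_X,
            Polynomial.eval_C, Polynomial.eval_smul, Polynomial.eval_add, eval_cheb_add_two,
            smul_eq_mul]
          field_simp
          ring
        rw [this]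
        exact Submodule.smul_mem _ _ (Submodule.add_mem _ (hmem _) (hmem _))
    · rw [mul_add]; exact Submodule.add_mem _ hP hQ
    · rw [mul_smul_comm]; exact Submodule.smul_mem _ _ hP

lemma contDiff_polynomial (P : Polynomial ℝ) {n : WithTop ℕ∞} :
    ContDiff ℝ n fun x => P.eval x := P.contDiff_aeval (𝕜 := ℝ) (n := n)

lemma integral_cos_nat_mul {n : ℕ} (hn : n ≠ 0) :
    ∫ θ in (0 : ℝ)..Real.pi, Real.cos (n * θ) = 0 := by
  have hn' : (n : ℝ) ≠ 0 := by exact_mod_cast hn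
  rw [intervalIntegral.integral_comp_mul_left (fun x => Real.cos x) hn']
  simp [Real.sin_nat_mul_pi]

lemma integral_cheb (hρ : ρ ≠ 0) {n : ℕ} (hn : n ≠ 0) :
    ∫ x, (cheb m ρ n).eval x ∂(arcsine m ρ) = 0 := by
  rw [integral_arcsine (Polynomial.continuous _).aestronglyMeasurable]
  simp_rw [eval_cheb_angle hρ]
  rw [integral_cos_nat_mul hn, mul_zero]

/-- Because the Chebyshev polynomial of degree n + 1 has mean zero, T preserves the three-term
recurrence. The index n − 1 is an integer: at n = 0 it gives the second-kind polynomial of index −1,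
which is 0. -/
lemma T_cheb (hρ : 0 < ρ) (n : ℕ) (x : ℝ) :
    T m ρ (fun z => (cheb m ρ n).eval z) x =
      ρ⁻¹ * (Polynomial.Chebyshev.U ℝ (n - 1)).eval (ρ⁻¹ * (x - m)) := by
  induction n using Nat.twoStepInduction with
  | zero => simp [cheb_zero, T_const]
  | one =>
    simp_rw [eval_cheb_one]
    rw [T_const_mul _ (contDiff_sub_const m), T_sub_const]
    simp
  | more n ih1 ih2 =>
    have hs := contDiff_polynomial (n := 1)
    simp_rw [eval_cheb_add_two]
    have hx : ContDiff ℝ 1 fun z => (z - m) * (cheb m ρ (n + 1)).eval z :=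
      (contDiff_sub_const m).mul (hs _)
    rw [T_sub hρ.le (contDiff_const.mul hx) (hs _), T_const_mul _ hx, T_sub_mul hρ.le (hs _),
      integral_cheb hρ.ne' (by simp), ih1, ih2]
    have e1 : ((n + 2 : ℕ) : ℤ) - 1 = (n - 1 : ℤ) + 2 := by push_cast; ring
    have e2 : ((n + 1 : ℕ) : ℤ) - 1 = (n - 1 : ℤ) + 1 := by push_cast; ring
    rw [e1, e2, Polynomial.Chebyshev.U_add_two]
    simp only [Polynomial.eval_sub, Polynomial.eval_mul, Polynomial.eval_ofNat, Polynomial.eval_X]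
    ring

/-- In the angle variable T is harmonic conjugation divided by ρ sin θ: it sends cos nθ to sin nθ.
-/
lemma T_cheb_angle (hρ : 0 < ρ) (n : ℕ) (θ : ℝ) :
    T m ρ (fun z => (cheb m ρ n).eval z) (m + ρ * Real.cos θ) * (ρ * Real.sin θ) =
      Real.sin (n * θ) := by
  rw [T_cheb hρ, add_sub_cancel_left, inv_mul_cancel_left₀ hρ.ne']
  have := Polynomial.Chebyshev.U_real_cos θ (n - 1)
  push_cast at this
  rw [sub_add_cancel] at this
  rw [← this]
  field_simp

lemma exists_Icc_subset (m ρ x : ℝ) : ∃ R : ℝ, 0 ≤ R ∧ Icc (m - ρ) (m + ρ) ⊆ Icc (-R) R ∧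
    x ∈ Icc (-R) R := by
  refine ⟨|m| + |ρ| + |x|, by positivity, ?_, ?_⟩
  · refine Icc_subset_Icc ?_ ?_ <;>
      linarith [neg_abs_le m, le_abs_self m, neg_abs_le ρ, le_abs_self ρ, abs_nonneg x]
  · constructor <;> linarith [neg_abs_le x, le_abs_self x, abs_nonneg m, abs_nonneg ρ]

lemma abs_integral_arcsine_le (hρ : 0 ≤ ρ) {φ : ℝ → ℝ} {C : ℝ}
    (h : ∀ x ∈ Icc (m - ρ) (m + ρ), |φ x| ≤ C) : |∫ x, φ x ∂(arcsine m ρ)| ≤ C := by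
  have := norm_integral_le_of_norm_le_const (μ := arcsine m ρ) (f := φ) (C := C) (by
    filter_upwards [arcsine_ae_mem hρ] with x hx using h x hx)
  rwa [probReal_univ, mul_one] at this

/-- Integration by parts for the arcsine law. -/
lemma integral_sub_mul_arcsine (hρ : 0 < ρ) (hψ : ContDiff ℝ 1 ψ) :
    ∫ x, (x - m) * ψ x ∂(arcsine m ρ) =
      ∫ x, (ρ ^ 2 - (x - m) ^ 2) * T m ρ ψ x ∂(arcsine m ρ) := by
  have hi1 : ∀ ψ : ℝ → ℝ, ContDiff ℝ 1 ψ → Integrable (fun x => (x - m) * ψ x) (arcsine m ρ) := by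
    intro ψ hψ
    have := hψ.continuous
    exact Continuous.integrable_arcsine hρ.le (by fun_prop)
  have hi2 : ∀ ψ : ℝ → ℝ, ContDiff ℝ 1 ψ →
      Integrable (fun x => (ρ ^ 2 - (x - m) ^ 2) * T m ρ ψ x) (arcsine m ρ) := by
    intro ψ hψ
    have := continuous_T (m := m) hρ.le hψ
    exact Continuous.integrable_arcsine hρ.le (by fun_prop)
  obtain ⟨R, hR, hI, -⟩ := exists_Icc_subset m ρ 0
  rw [← sub_eq_zero]
  -- The first integral costs ρ sup|ψ|; the second costs ρ² sup|ψ'|, because T is an average of the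
  -- derivative.
  refine eq_zero_of_polynomial 1 hR (fun ψ => ∫ x, (x - m) * ψ x ∂(arcsine m ρ) -
      ∫ x, (ρ ^ 2 - (x - m) ^ 2) * T m ρ ψ x ∂(arcsine m ρ)) (ρ + ρ ^ 2) ?_ ?_ ?_
      (by exact_mod_cast hψ)
  · intro ψ hψ P
    have hψ' : ContDiff ℝ 1 ψ := by exact_mod_cast hψ
    have hP := contDiff_polynomial P (n := 1)
    simp_rw [T_sub hρ.le hψ' hP, mul_sub]
    rw [integral_sub (hi1 _ hψ') (hi1 _ hP), integral_sub (hi2 _ hψ') (hi2 _ hP)]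
    ring
  · intro ψ hψ ε hε hb
    have b1 : |∫ x, (x - m) * ψ x ∂(arcsine m ρ)| ≤ ρ * ε := by
      refine abs_integral_arcsine_le hρ.le fun x hx => ?_
      rw [abs_mul]
      have : |x - m| ≤ ρ := abs_le.2 ⟨by linarith [hx.1], by linarith [hx.2]⟩
      exact mul_le_mul this (by simpa using hb x (hI hx) 0 (by simp)) (abs_nonneg _) hρ.le
    have b2 : |∫ x, (ρ ^ 2 - (x - m) ^ 2) * T m ρ ψ x ∂(arcsine m ρ)| ≤ ρ ^ 2 * ε := by
      refine abs_integral_arcsine_le hρ.le fun x hx => ?_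
      rw [abs_mul]
      refine mul_le_mul (abs_sub_sq_le hx) ?_ (abs_nonneg _) (sq_nonneg _)
      simpa using abs_iteratedDeriv_T_le (n := 0) hρ.le (by simpa using hψ) hI
        (fun z hz => hb z hz 1 le_rfl) (hI hx)
    refine (abs_sub _ _).trans ?_
    linarith
  · intro P
    rw [sub_eq_zero]
    induction P using cheb_induction (m := m) hρ.ne' with
    | hT n =>
      have c1 := continuous_T (m := m) hρ.le (contDiff_polynomial (cheb m ρ n) (n := 1))
      rw [integral_arcsine (Continuous.aestronglyMeasurable (by fun_prop)),
        integral_arcsine (Continuous.aestronglyMeasurable (by fun_prop)), ← sub_eq_zero, ← mul_sub,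
        ← intervalIntegral.integral_sub (Continuous.intervalIntegrable (by fun_prop) _ _)
          (Continuous.intervalIntegrable (by fun_prop) _ _)]
      -- The integrands are ρ cos θ cos nθ and ρ sin θ sin nθ. Their difference has frequency n + 1
      -- ≠ 0, so its integral vanishes even for n = 0.
      have e : ∀ θ, (m + ρ * Real.cos θ - m) * (cheb m ρ n).eval (m + ρ * Real.cos θ) -
          (ρ ^ 2 - (m + ρ * Real.cos θ - m) ^ 2) *
            T m ρ (fun z => (cheb m ρ n).eval z) (m + ρ * Real.cos θ) =
          ρ * Real.cos ((n + 1 : ℕ) * θ) := by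
        intro θ
        have h1 : ρ ^ 2 - (m + ρ * Real.cos θ - m) ^ 2 =
            (ρ * Real.sin θ) * (ρ * Real.sin θ) := by
          have := Real.sin_sq_add_cos_sq θ
          linear_combination ρ ^ 2 * (-this)
        rw [h1, mul_assoc (ρ * Real.sin θ), mul_comm (ρ * Real.sin θ) (T _ _ _ _),
          T_cheb_angle hρ, eval_cheb_angle hρ.ne']
        push_cast
        rw [add_mul, one_mul, Real.cos_add]
        ring
      simp_rw [e]
      rw [intervalIntegral.integral_const_mul, integral_cos_nat_mul (by simp)]
      simp
    | hadd P Q hP hQ =>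
      have sP := contDiff_polynomial P (n := 1)
      have sQ := contDiff_polynomial Q (n := 1)
      simp_rw [Polynomial.eval_add, T_add hρ.le sP sQ, mul_add]
      rw [integral_add (hi1 _ sP) (hi1 _ sQ), integral_add (hi2 _ sP) (hi2 _ sQ), hP, hQ]
    | hsmul c P hP =>
      have sP := contDiff_polynomial P (n := 1)
      simp_rw [Polynomial.eval_smul, smul_eq_mul, T_const_mul c sP, mul_left_comm _ c]
      rw [integral_const_mul, integral_const_mul, hP]

/-- Duality of `U` and `T` for polynomials `h`. -/
lemma integral_U_mul_polynomial (hρ : 0 < ρ) (P : Polynomial ℝ) :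
    ∀ ψ : ℝ → ℝ, ContDiff ℝ 1 ψ →
      ∫ x, U m ρ (fun z => P.eval z) x * ψ x ∂(arcsine m ρ) =
        ∫ x, P.eval x * (ρ ^ 2 - (x - m) ^ 2) * T m ρ ψ x ∂(arcsine m ρ) := by
  induction P using polynomial_induction m with
  | hC c =>
    intro ψ hψ
    simp_rw [Polynomial.eval_C, U_const, mul_comm _ c, mul_assoc c]
    rw [integral_const_mul, integral_const_mul, integral_sub_mul_arcsine hρ hψ]
  | hadd P Q hP hQ =>
    intro ψ hψ
    have sP := contDiff_polynomial P (n := 1)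
    have sQ := contDiff_polynomial Q (n := 1)
    have c1 := continuous_U (m := m) hρ.le sP
    have c2 := continuous_U (m := m) hρ.le sQ
    have c3 := continuous_T (m := m) hρ.le hψ
    have c4 := hψ.continuous
    simp_rw [Polynomial.eval_add, U_add hρ.le sP sQ, add_mul]
    rw [integral_add (Continuous.integrable_arcsine hρ.le (by fun_prop))
        (Continuous.integrable_arcsine hρ.le (by fun_prop)),
      integral_add (Continuous.integrable_arcsine hρ.le (by fun_prop))
        (Continuous.integrable_arcsine hρ.le (by fun_prop)), hP ψ hψ, hQ ψ hψ]
  | hmul P hP =>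
    intro ψ hψ
    have sP := contDiff_polynomial P (n := 1)
    have c1 := continuous_U (m := m) hρ.le sP
    have c3 := continuous_T (m := m) hρ.le hψ
    have c4 := hψ.continuous
    -- The extra factor x − m is moved onto the test function, which is why ψ is quantified inside
    -- the induction. The two mean-value corrections then cancel.
    have hx : ContDiff ℝ 1 fun z => (z - m) * ψ z := (contDiff_sub_const m).mul hψ
    have := hP _ hx
    simp_rw [Polynomial.eval_mul, Polynomial.eval_sub, Polynomial.eval_X, Polynomial.eval_C,
      U_sub_mul hρ.le sP, sub_mul (_ * _)]
    rw [integral_sub (Continuous.integrable_arcsine hρ.le (by fun_prop))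
        (Continuous.integrable_arcsine hρ.le (by fun_prop)), integral_const_mul]
    simp_rw [T_sub_mul hρ.le hψ, mul_add] at this
    rw [integral_add (Continuous.integrable_arcsine hρ.le (by fun_prop))
        (Continuous.integrable_arcsine hρ.le (by fun_prop)), integral_mul_const] at this
    have e1 : ∫ x, (x - m) * U m ρ (fun z => P.eval z) x * ψ x ∂(arcsine m ρ) =
        ∫ x, U m ρ (fun z => P.eval z) x * ((x - m) * ψ x) ∂(arcsine m ρ) :=
      integral_congr_ae (Eventually.of_forall fun x => by ring)
    have e2 : ∫ x, (x - m) * P.eval x * (ρ ^ 2 - (x - m) ^ 2) * T m ρ ψ x ∂(arcsine m ρ) =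
        ∫ x, P.eval x * (ρ ^ 2 - (x - m) ^ 2) * ((x - m) * T m ρ ψ x) ∂(arcsine m ρ) :=
      integral_congr_ae (Eventually.of_forall fun x => by ring)
    rw [e1, e2, this]
    ring

/-- Duality of `U` and `T` for the arcsine law. -/
lemma integral_U_mul (hρ : 0 < ρ) (hh : ContDiff ℝ 1 h) (hψ : ContDiff ℝ 1 ψ) :
    ∫ x, U m ρ h x * ψ x ∂(arcsine m ρ) =
      ∫ x, h x * (ρ ^ 2 - (x - m) ^ 2) * T m ρ ψ x ∂(arcsine m ρ) := by
  have c3 := continuous_T (m := m) hρ.le hψ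
  have c4 := hψ.continuous
  have hi1 : ∀ h : ℝ → ℝ, ContDiff ℝ 1 h →
      Integrable (fun x => U m ρ h x * ψ x) (arcsine m ρ) := by
    intro h hh
    have := continuous_U (m := m) hρ.le hh
    exact Continuous.integrable_arcsine hρ.le (by fun_prop)
  have hi2 : ∀ h : ℝ → ℝ, ContDiff ℝ 1 h →
      Integrable (fun x => h x * (ρ ^ 2 - (x - m) ^ 2) * T m ρ ψ x) (arcsine m ρ) := by
    intro h hh
    have := hh.continuous
    exact Continuous.integrable_arcsine hρ.le (by fun_prop)
  obtain ⟨R, hR, hI, -⟩ := exists_Icc_subset m ρ 0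
  obtain ⟨A, hA⟩ := isCompact_Icc.exists_bound_of_continuousOn
    (s := Icc (m - ρ) (m + ρ)) c4.continuousOn
  obtain ⟨B, hB⟩ := isCompact_Icc.exists_bound_of_continuousOn
    (s := Icc (m - ρ) (m + ρ)) c3.continuousOn
  rw [← sub_eq_zero]
  refine eq_zero_of_polynomial 1 hR (fun h => ∫ x, U m ρ h x * ψ x ∂(arcsine m ρ) -
      ∫ x, h x * (ρ ^ 2 - (x - m) ^ 2) * T m ρ ψ x ∂(arcsine m ρ))
      ((ρ + ρ ^ 2) * A + ρ ^ 2 * B) ?_ ?_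
      (fun P => sub_eq_zero.2 (integral_U_mul_polynomial hρ P ψ hψ)) (by exact_mod_cast hh)
  · intro h hh P
    have hh' : ContDiff ℝ 1 h := by exact_mod_cast hh
    have hP := contDiff_polynomial P (n := 1)
    have e1 : ∀ x, U m ρ (fun z => h z - P.eval z) x * ψ x =
        U m ρ h x * ψ x - U m ρ (fun z => P.eval z) x * ψ x := fun x => by
      rw [U_sub hρ.le hh' hP]; ring
    have e2 : ∀ x, (h x - P.eval x) * (ρ ^ 2 - (x - m) ^ 2) * T m ρ ψ x =
        h x * (ρ ^ 2 - (x - m) ^ 2) * T m ρ ψ x -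
          P.eval x * (ρ ^ 2 - (x - m) ^ 2) * T m ρ ψ x := fun x => by ring
    simp only [e1, e2]
    rw [integral_sub (hi1 _ hh') (hi1 _ hP), integral_sub (hi2 _ hh') (hi2 _ hP)]
    ring
  · intro h hh ε hε hb
    have b0 : ∀ z ∈ Icc (-R) R, |h z| ≤ ε := fun z hz => by simpa using hb z hz 0 (by simp)
    have b1 : ∀ z ∈ Icc (-R) R, |deriv h z| ≤ ε := fun z hz => by
      simpa using hb z hz 1 le_rfl
    have b2 : |∫ x, U m ρ h x * ψ x ∂(arcsine m ρ)| ≤ ((ρ + ρ ^ 2) * ε) * A := by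
      refine abs_integral_arcsine_le hρ.le fun x hx => ?_
      rw [abs_mul]
      have : |x - m| ≤ ρ := abs_le.2 ⟨by linarith [hx.1], by linarith [hx.2]⟩
      refine mul_le_mul ((abs_U_le hρ.le hI b0 b1 (hI hx)).trans ?_) (hA x hx) (abs_nonneg _)
        (by positivity)
      gcongr
    have b3 : |∫ x, h x * (ρ ^ 2 - (x - m) ^ 2) * T m ρ ψ x ∂(arcsine m ρ)| ≤ (ε * ρ ^ 2) * B := by
      refine abs_integral_arcsine_le hρ.le fun x hx => ?_
      rw [abs_mul, abs_mul]
      refine mul_le_mul (mul_le_mul (b0 x (hI hx)) (abs_sub_sq_le hx) (abs_nonneg _) hε)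
        (hB x hx) (abs_nonneg _) (by positivity)
    refine (abs_sub _ _).trans ?_
    linarith

lemma integral_U (hρ : 0 < ρ) (hh : ContDiff ℝ 1 h) : ∫ x, U m ρ h x ∂(arcsine m ρ) = 0 := by
  have := integral_U_mul (m := m) hρ hh (contDiff_const (c := (1 : ℝ)))
  simpa [T_const] using this

/-- On polynomials, `U` is a right inverse of `T`. -/
lemma exists_polynomial_T_eq (hρ : 0 < ρ) (P : Polynomial ℝ) : ∃ Q : Polynomial ℝ,
    (∀ x, U m ρ (fun z => P.eval z) x = Q.eval x) ∧
      ∀ x, T m ρ (fun z => Q.eval z) x = P.eval x := by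
  induction P using polynomial_induction m with
  | hC c =>
    refine ⟨Polynomial.C c * (Polynomial.X - Polynomial.C m), fun x => ?_, fun x => ?_⟩
    · simp [U_const, mul_comm]
    · simp only [Polynomial.eval_mul, Polynomial.eval_C, Polynomial.eval_sub, Polynomial.eval_X]
      rw [T_const_mul _ (contDiff_sub_const m), T_sub_const, mul_one]
  | hadd P P' hP hP' =>
    obtain ⟨Q, hQ1, hQ2⟩ := hP
    obtain ⟨Q', hQ1', hQ2'⟩ := hP'
    refine ⟨Q + Q', fun x => ?_, fun x => ?_⟩
    · simp_rw [Polynomial.eval_add]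
      rw [U_add hρ.le (contDiff_polynomial P) (contDiff_polynomial P'), hQ1, hQ1']
    · simp_rw [Polynomial.eval_add]
      rw [T_add hρ.le (contDiff_polynomial Q) (contDiff_polynomial Q'), hQ2, hQ2']
  | hmul P hP =>
    obtain ⟨Q, hQ1, hQ2⟩ := hP
    have sP := contDiff_polynomial P (n := 1)
    have sQ := contDiff_polynomial Q (n := 1)
    refine ⟨(Polynomial.X - Polynomial.C m) * Q -
      Polynomial.C (∫ y, P.eval y * (ρ ^ 2 - (y - m) ^ 2) ∂(arcsine m ρ)), fun x => ?_, fun x => ?_⟩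
    · simp_rw [Polynomial.eval_sub, Polynomial.eval_mul, Polynomial.eval_sub, Polynomial.eval_X,
        Polynomial.eval_C]
      rw [U_sub_mul hρ.le sP, hQ1]
    · simp_rw [Polynomial.eval_sub, Polynomial.eval_mul, Polynomial.eval_sub, Polynomial.eval_X,
        Polynomial.eval_C]
      rw [T_sub hρ.le ((contDiff_sub_const m).mul sQ) contDiff_const, T_const,
        sub_zero]
      rw [T_sub_mul hρ.le sQ, hQ2]
      -- T((X−m)Q) is the mean of Q plus (x−m)P; the mean is zero because Q is a value of U.
      have h0 := integral_U (m := m) hρ sP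
      simp_rw [hQ1] at h0
      rw [h0, zero_add]

/-- `U` is a left inverse of `T` up to constants. -/
lemma U_T (hρ : 0 < ρ) (hh : ContDiff ℝ 2 h) (x : ℝ) :
    U m ρ (T m ρ h) x = h x - ∫ y, h y ∂(arcsine m ρ) := by
  obtain ⟨R, hR, hI, hx⟩ := exists_Icc_subset m ρ x
  have hT : ∀ h : ℝ → ℝ, ContDiff ℝ 2 h → ContDiff ℝ 1 (T m ρ h) := fun h hh => by
    exact_mod_cast contDiff_T (n := 1) hρ.le (by exact_mod_cast hh)
  have h21 : ∀ h : ℝ → ℝ, ContDiff ℝ 2 h → ContDiff ℝ 1 h := fun h hh =>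
    hh.of_le one_le_two
  rw [← sub_eq_zero]
  -- T and U cost one derivative each, hence the C² norm. The constant is |x−m| + ρ² for U, plus 2
  -- for h(x) and the mean of h.
  refine eq_zero_of_polynomial 2 hR (fun h => U m ρ (T m ρ h) x -
    (h x - ∫ y, h y ∂(arcsine m ρ))) (|x - m| + ρ ^ 2 + 2) ?_ ?_ ?_ (by exact_mod_cast hh)
  · intro h hh P
    have hh' : ContDiff ℝ 2 h := by exact_mod_cast hh
    have hP := contDiff_polynomial P (n := 2)
    have e : T m ρ (fun z => h z - P.eval z) =
        fun z => T m ρ h z - T m ρ (fun z => P.eval z) z :=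
      funext fun z => T_sub hρ.le (h21 _ hh') (h21 _ hP) z
    simp only [e]
    rw [U_sub hρ.le (hT _ hh') (hT _ hP),
      integral_sub (Continuous.integrable_arcsine hρ.le hh.continuous)
        (Continuous.integrable_arcsine hρ.le hP.continuous)]
    ring
  · intro h hh ε hε hb
    have hh' : ContDiff ℝ 2 h := by exact_mod_cast hh
    have b0 : ∀ z ∈ Icc (-R) R, |h z| ≤ ε := fun z hz => by simpa using hb z hz 0 (by simp)
    have b1 := abs_U_le (m := m) (h := T m ρ h) (ε := ε) hρ.le hI
      (fun z hz => by
        simpa using abs_iteratedDeriv_T_le (n := 0) hρ.le (by simpa using h21 h hh') hI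
          (fun z hz => hb z hz 1 (by simp)) hz)
      (fun z hz => by
        simpa using abs_iteratedDeriv_T_le (n := 1) hρ.le (by simpa using hh) hI
          (fun z hz => hb z hz 2 le_rfl) hz) hx
    have b2 : |∫ y, h y ∂(arcsine m ρ)| ≤ ε :=
      abs_integral_arcsine_le hρ.le fun y hy => b0 y (hI hy)
    have b3 := abs_sub (h x) (∫ y, h y ∂(arcsine m ρ))
    have b4 := abs_sub (U m ρ (T m ρ h) x) (h x - ∫ y, h y ∂(arcsine m ρ))
    have b5 := b0 x hx
    linarith
  · intro P
    rw [sub_eq_zero]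
    clear hx hI hR
    induction P using polynomial_induction m generalizing x with
    | hC c =>
      have : T m ρ (fun _ => c) = fun _ => 0 := funext fun z => T_const c z
      simp [this, U_const]
    | hadd P Q hP hQ =>
      have sP := contDiff_polynomial P (n := 2)
      have sQ := contDiff_polynomial Q (n := 2)
      have e : T m ρ (fun z => P.eval z + Q.eval z) =
          fun z => T m ρ (fun z => P.eval z) z + T m ρ (fun z => Q.eval z) z :=
        funext fun z => T_add hρ.le (h21 _ sP) (h21 _ sQ) z
      simp only [Polynomial.eval_add]
      rw [e, U_add hρ.le (hT _ sP) (hT _ sQ), hP, hQ,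
        integral_add (Continuous.integrable_arcsine hρ.le sP.continuous)
        (Continuous.integrable_arcsine hρ.le sQ.continuous)]
      ring
    | hmul P hP =>
      have sP := contDiff_polynomial P (n := 2)
      have sx : ContDiff ℝ 1 fun z => (z - m) * T m ρ (fun z => P.eval z) z :=
        (contDiff_sub_const m).mul (hT _ sP)
      simp only [Polynomial.eval_mul, Polynomial.eval_sub, Polynomial.eval_X, Polynomial.eval_C]
      have e : T m ρ (fun z => (z - m) * P.eval z) =
          fun z => ∫ y, P.eval y ∂(arcsine m ρ) + (z - m) * T m ρ (fun z => P.eval z) z :=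
        funext fun z => T_sub_mul hρ.le (h21 _ sP) z
      rw [e, U_add hρ.le contDiff_const sx, U_const, U_sub_mul hρ.le (hT _ sP), hP,
        integral_sub_mul_arcsine hρ (h21 _ sP)]
      have e2 : ∫ y, T m ρ (fun z => P.eval z) y * (ρ ^ 2 - (y - m) ^ 2) ∂(arcsine m ρ) =
          ∫ y, (ρ ^ 2 - (y - m) ^ 2) * T m ρ (fun z => P.eval z) y ∂(arcsine m ρ) :=
        integral_congr_ae (Eventually.of_forall fun x => mul_comm _ _)
      rw [e2]
      ring

lemma integral_sub_arcsine (hρ : 0 < ρ) : ∫ x, (x - m) ∂(arcsine m ρ) = 0 := by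
  have := integral_U (m := m) hρ (contDiff_const (c := (1 : ℝ)))
  simpa [U_const] using this

/-- The algebraic relation between `U` and `T`. -/
lemma U_add_mul_T (hρ : 0 < ρ) (hh : ContDiff ℝ 1 h) (x : ℝ) :
    U m ρ h x + (ρ ^ 2 - (x - m) ^ 2) * T m ρ h x =
      (x - m) * ∫ y, h y ∂(arcsine m ρ) + ∫ y, (y - m) * h y ∂(arcsine m ρ) := by
  have c := continuous_dq_right hh x
  have c0 := hh.continuous
  have e : ∫ y, dq h x y * (ρ ^ 2 - (y - m) ^ 2) ∂(arcsine m ρ) =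
      (ρ ^ 2 - (x - m) ^ 2) * ∫ y, dq h x y ∂(arcsine m ρ) + (h x * (x - m)
        + h x * ∫ y, (y - m) ∂(arcsine m ρ) - (x - m) * ∫ y, h y ∂(arcsine m ρ)
        - ∫ y, (y - m) * h y ∂(arcsine m ρ)) := by
    -- Uses w(y) = w(x) + (x−y)((x−m)+(y−m)): the factor x − y clears the divided difference and
    -- leaves moments of h.
    have e1 : ∀ y, dq h x y * (ρ ^ 2 - (y - m) ^ 2) = (ρ ^ 2 - (x - m) ^ 2) * dq h x y +
        (h x * (x - m) + h x * (y - m) - (x - m) * h y - (y - m) * h y) := by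
      intro y
      have := sub_mul_dq hh x y
      linear_combination (x - m + (y - m)) * this
    simp_rw [e1]
    rw [integral_add (Continuous.integrable_arcsine hρ.le (by fun_prop))
        (Continuous.integrable_arcsine hρ.le (by fun_prop)),
      integral_sub (Continuous.integrable_arcsine hρ.le (by fun_prop))
        (Continuous.integrable_arcsine hρ.le (by fun_prop)),
      integral_sub (Continuous.integrable_arcsine hρ.le (by fun_prop))
        (Continuous.integrable_arcsine hρ.le (by fun_prop)),
      integral_add (Continuous.integrable_arcsine hρ.le (by fun_prop))
        (Continuous.integrable_arcsine hρ.le (by fun_prop)), integral_const_mul,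
        integral_const_mul, integral_const_mul, integral_const_mul]
    simp
  rw [U, e, integral_sub_arcsine hρ, T]
  ring

/-- For a point outside the interval, `U h` is governed by this nonvanishing factor. -/
lemma sub_integral_ne_zero (hρ : 0 < ρ) {x : ℝ} (hx : x ∉ Icc (m - ρ) (m + ρ)) :
    (x - m) - ∫ y, (ρ ^ 2 - (y - m) ^ 2) / (x - y) ∂(arcsine m ρ) ≠ 0 := by
  have hne : ∀ y ∈ Icc (m - ρ) (m + ρ), x - y ≠ 0 := fun y hy h =>
    hx (by rwa [sub_eq_zero.1 h])
  have hint : Integrable (fun y => (ρ ^ 2 - (y - m) ^ 2) / (x - y)) (arcsine m ρ) :=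
    integrable_arcsine hρ.le (ContinuousOn.div (by fun_prop) (by fun_prop) hne)
  have h0 := integral_sub_arcsine (m := m) hρ
  have i1 : Integrable (fun y => y - m) (arcsine m ρ) :=
    Continuous.integrable_arcsine hρ.le (by fun_prop)
  -- To the right of the interval x − y exceeds ρ − (y−m), so the quotient is at most (y−m) + ρ,
  -- whose mean ρ is less than x − m. The left side is symmetric.
  by_cases h1 : m + ρ < x
  · have : ∫ y, (ρ ^ 2 - (y - m) ^ 2) / (x - y) ∂(arcsine m ρ) ≤
        ∫ y, ((y - m) + ρ) ∂(arcsine m ρ) := by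
      refine integral_mono_ae hint (i1.add (integrable_const _)) ?_
      filter_upwards [arcsine_ae_mem hρ.le] with y hy
      rw [div_le_iff₀ (by linarith [hy.2])]
      nlinarith [hy.1, hy.2]
    rw [integral_add i1 (integrable_const _), h0] at this
    simp at this
    intro h
    linarith
  · have h2 : x < m - ρ := by
      by_contra h2
      exact hx ⟨not_lt.1 h2, not_lt.1 h1⟩
    have : ∫ y, ((y - m) - ρ) ∂(arcsine m ρ) ≤
        ∫ y, (ρ ^ 2 - (y - m) ^ 2) / (x - y) ∂(arcsine m ρ) := by
      refine integral_mono_ae (i1.sub (integrable_const _)) hint ?_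
      filter_upwards [arcsine_ae_mem hρ.le] with y hy
      rw [le_div_iff_of_neg (by linarith [hy.1])]
      nlinarith [hy.1, hy.2]
    rw [integral_sub i1 (integrable_const _), h0] at this
    simp at this
    intro h
    linarith

/-- `U h` outside the interval. -/
lemma U_of_notMem (hρ : 0 < ρ) (hh : ContDiff ℝ 1 h) {x : ℝ} (hx : x ∉ Icc (m - ρ) (m + ρ)) :
    U m ρ h x = h x * ((x - m) - ∫ y, (ρ ^ 2 - (y - m) ^ 2) / (x - y) ∂(arcsine m ρ)) +
      ∫ y, (ρ ^ 2 - (y - m) ^ 2) * h y * (1 / (x - y)) ∂(arcsine m ρ) := by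
  have hne : ∀ y ∈ Icc (m - ρ) (m + ρ), x - y ≠ 0 := fun y hy h =>
    hx (by rwa [sub_eq_zero.1 h])
  have c0 := hh.continuous
  have hint : Integrable (fun y => (ρ ^ 2 - (y - m) ^ 2) / (x - y)) (arcsine m ρ) :=
    integrable_arcsine hρ.le (ContinuousOn.div (by fun_prop) (by fun_prop) hne)
  have hint2 : Integrable (fun y => (ρ ^ 2 - (y - m) ^ 2) * h y * (1 / (x - y))) (arcsine m ρ) :=
    integrable_arcsine hρ.le (ContinuousOn.mul (by fun_prop)
      (ContinuousOn.div (by fun_prop) (by fun_prop) hne))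
  have e : ∫ y, dq h x y * (ρ ^ 2 - (y - m) ^ 2) ∂(arcsine m ρ) =
      ∫ y, (h x * ((ρ ^ 2 - (y - m) ^ 2) / (x - y)) -
        (ρ ^ 2 - (y - m) ^ 2) * h y * (1 / (x - y))) ∂(arcsine m ρ) := by
    refine integral_congr_ae ?_
    filter_upwards [arcsine_ae_mem hρ.le] with y hy
    rw [dq_of_ne hh (sub_ne_zero.1 (hne y hy))]
    have := hne y hy
    field_simp
  rw [U, e, integral_sub (hint.const_mul _) hint2, integral_const_mul]
  ring

/-- The equation `U h = G` determines `h` and forces `G` to have mean zero. -/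
lemma eq_T_of_U_eq (hρ : 0 < ρ) (hh : ContDiff ℝ 1 h) {G : ℝ → ℝ} (hG : ContDiff ℝ 2 G)
    (hU : ∀ x, U m ρ h x = G x) : ∫ x, G x ∂(arcsine m ρ) = 0 ∧ h = T m ρ G := by
  have hG1 : ContDiff ℝ 1 G := hG.of_le one_le_two
  have hmean : ∫ x, G x ∂(arcsine m ρ) = 0 := by
    simpa [hU] using integral_U (m := m) hρ hh
  have hTG : ContDiff ℝ 1 (T m ρ G) := by
    exact_mod_cast contDiff_T (n := 1) hρ.le (by exact_mod_cast hG)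
  set d : ℝ → ℝ := fun x => h x - T m ρ G x with hd
  have sd : ContDiff ℝ 1 d := hh.sub hTG
  have cd := sd.continuous
  have hUd : ∀ x, U m ρ d x = 0 := fun x => by
    rw [hd, U_sub hρ.le hh hTG, hU, U_T hρ hG, hmean]; ring
  -- Every polynomial is some T Q, so duality with U d = 0 makes w·d orthogonal to all polynomials.
  have h1 : ∀ P : Polynomial ℝ,
      ∫ x, (d x * (ρ ^ 2 - (x - m) ^ 2)) * P.eval x ∂(arcsine m ρ) = 0 := by
    intro P
    obtain ⟨Q, -, hQ⟩ := exists_polynomial_T_eq (m := m) hρ P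
    have := integral_U_mul (m := m) hρ sd (contDiff_polynomial Q)
    simp_rw [hUd, hQ] at this
    simpa using this.symm
  have h2 := eq_zero_of_integral_mul_polynomial hρ (by fun_prop) h1
  -- The weight vanishes at the endpoints, so d = 0 is obtained first inside and extended by
  -- continuity.
  have h3 : EqOn d (fun _ => 0) (Ioo (m - ρ) (m + ρ)) := fun x hx => by
    refine (mul_eq_zero.1 (h2 x (Ioo_subset_Icc_self hx))).resolve_right ?_
    nlinarith [hx.1, hx.2]
  have h4 : EqOn d (fun _ => 0) (Icc (m - ρ) (m + ρ)) := by
    have := h3.closure cd continuous_const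
    rwa [closure_Ioo (by linarith)] at this
  refine ⟨hmean, funext fun x => sub_eq_zero.1 (?_ : d x = 0)⟩
  by_cases hx : x ∈ Icc (m - ρ) (m + ρ)
  · exact h4 hx
  -- Once d vanishes on the interval, U d outside is d times a nonvanishing factor.
  · have := U_of_notMem hρ sd hx
    rw [hUd] at this
    have h5 : ∫ y, (ρ ^ 2 - (y - m) ^ 2) * d y * (1 / (x - y)) ∂(arcsine m ρ) = 0 := by
      refine integral_eq_zero_of_ae ?_
      filter_upwards [arcsine_ae_mem hρ.le] with y hy
      simp [h4 hy]
    rw [h5, add_zero] at this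
    exact (mul_eq_zero.1 this.symm).resolve_right (sub_integral_ne_zero hρ hx)

end

end BetaEnsemble

/-! ### Fourier coefficients of the logarithm and the logarithmic potential of the arcsine law. -/

namespace BetaEnsemble

noncomputable section

variable {m ρ : ℝ}

section Fourier

open Real

/-- Consecutive odd second-kind polynomials differ by twice a first-kind one; times cos u this is a
sum of cosines of nonzero frequency. The value is therefore that at n = 0, namely ∫ 2cos². -/
lemma integral_cos_mul_chebyshev_U (n : ℕ) :
    ∫ u in (0 : ℝ)..π, cos u * (Polynomial.Chebyshev.U ℝ (2 * n + 1)).eval (cos u) = π := by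
  induction n with
  | zero =>
    have : ∀ u, cos u * (Polynomial.Chebyshev.U ℝ (2 * (0 : ℕ) + 1)).eval (cos u) =
        2 * cos u ^ 2 := fun u => by
      simp only [Nat.cast_zero, mul_zero, zero_add, Polynomial.Chebyshev.U_one,
        Polynomial.eval_mul, Polynomial.eval_ofNat, Polynomial.eval_X]
      ring
    simp_rw [this]
    rw [intervalIntegral.integral_const_mul, integral_cos_sq]
    simp
    ring
  | succ n ih =>
    have e : ∀ u, cos u * (Polynomial.Chebyshev.U ℝ (2 * (n + 1 : ℕ) + 1)).eval (cos u) =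
        cos u * (Polynomial.Chebyshev.U ℝ (2 * n + 1)).eval (cos u) +
          (cos ((2 * n + 4 : ℕ) * u) + cos ((2 * n + 2 : ℕ) * u)) := fun u => by
      rw [show (2 * (n + 1 : ℕ) + 1 : ℤ) = (2 * n + 1) + 2 by push_cast; ring,
        Polynomial.Chebyshev.U_eq_two_mul_T_add_U]
      simp only [Polynomial.eval_add, Polynomial.eval_mul, Polynomial.eval_ofNat,
        Polynomial.Chebyshev.T_real_cos]
      push_cast
      have e1 : (2 * n + 4 : ℝ) * u = (2 * n + 1 + 2) * u + u := by ring
      have e2 : (2 * n + 2 : ℝ) * u = (2 * n + 1 + 2) * u - u := by ring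
      rw [e1, e2, cos_add, cos_sub]
      ring
    simp_rw [e]
    rw [intervalIntegral.integral_add (Continuous.intervalIntegrable (by fun_prop) _ _)
        (Continuous.intervalIntegrable (by fun_prop) _ _), ih,
      intervalIntegral.integral_add (Continuous.intervalIntegrable (by fun_prop) _ _)
        (Continuous.intervalIntegrable (by fun_prop) _ _),
      integral_cos_nat_mul (by omega), integral_cos_nat_mul (by omega)]
    simp

/-- Integration by parts. Writing sin(2(n+1)u) as sin u times a polynomial in cos u puts the
singularity into sin u log sin u, continuous up to the endpoints, where it vanishes. -/
lemma integral_log_sin_mul_cos (n : ℕ) :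
    ∫ u in (0 : ℝ)..π, log (sin u) * cos (2 * (n + 1) * u) = -π / (2 * (n + 1)) := by
  have hU : ∀ u, (Polynomial.Chebyshev.U ℝ (2 * n + 1)).eval (cos u) * sin u =
      sin (2 * (n + 1) * u) := fun u => by
    rw [Polynomial.Chebyshev.U_real_cos]
    push_cast
    ring_nf
  set W : ℝ → ℝ := fun u => (Polynomial.Chebyshev.U ℝ (2 * n + 1)).eval (cos u) with hW
  have hint : IntervalIntegrable (fun u => log (sin u) * cos (2 * (n + 1) * u)) volume 0 π :=
    (intervalIntegrable_log_sin (a := 0) (b := π)).mul_continuousOn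
      (Continuous.continuousOn (by fun_prop))
  have hint' : IntervalIntegrable (fun u => cos u * W u) volume 0 π :=
    Continuous.intervalIntegrable (by fun_prop) _ _
  have key := intervalIntegral.integral_eq_sub_of_hasDerivAt_of_le pi_pos.le
    (f := fun u => (sin u * log (sin u)) * W u)
    (f' := fun u => cos u * W u + (2 * (n + 1)) * (log (sin u) * cos (2 * (n + 1) * u)))
    (by
      have := continuous_mul_log.comp continuous_sin
      exact (this.mul (by fun_prop : Continuous W)).continuousOn)
    (fun u hu => by
      have hs : sin u ≠ 0 := (sin_pos_of_pos_of_lt_pi hu.1 hu.2).ne'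
      have e : (fun u => (sin u * log (sin u)) * W u) =
          fun u => log (sin u) * sin (2 * (n + 1) * u) := by
        ext u; rw [← hU]; ring
      rw [e]
      have h1 := (hasDerivAt_sin u).log hs
      have h2 : HasDerivAt (fun u => sin (2 * (n + 1) * u))
          (cos (2 * (n + 1) * u) * (2 * (n + 1))) u := by
        have := ((hasDerivAt_id u).const_mul (2 * (n + 1 : ℝ))).sin
        simpa using this
      refine (h1.mul h2).congr_deriv ?_
      rw [← hU u]
      field_simp
      ring)
    (hint'.add (hint.const_mul _))
  rw [intervalIntegral.integral_add hint' (hint.const_mul _),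
    intervalIntegral.integral_const_mul] at key
  have h0 : ∫ u in (0 : ℝ)..π, cos u * W u = π := integral_cos_mul_chebyshev_U n
  rw [h0] at key
  simp only [sin_pi, sin_zero, zero_mul, sub_zero] at key
  field_simp
  linarith

/-- The periodic logarithm `log |2 sin (u / 2)|`. -/
def logSine (u : ℝ) : ℝ := log (2 * sin (u / 2))

lemma logSine_neg (u : ℝ) : logSine (-u) = logSine u := by
  rw [logSine, logSine, neg_div, sin_neg, mul_neg, log_neg_eq_log]

lemma logSine_periodic : Function.Periodic logSine (2 * π) := fun u => by
  rw [logSine, logSine, add_div, mul_div_cancel_left₀ _ two_ne_zero, sin_add_pi, mul_neg,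
    log_neg_eq_log]

lemma intervalIntegrable_logSine (a b : ℝ) : IntervalIntegrable logSine volume a b := by
  refine MeromorphicOn.intervalIntegrable_log (f := fun u => 2 * sin (u / 2)) fun u _ => ?_
  exact AnalyticAt.meromorphicAt (by fun_prop)

lemma integral_logSine_mul_cos {n : ℕ} (hn : n ≠ 0) :
    ∫ u in (0 : ℝ)..(2 * π), logSine u * cos (n * u) = -π / n := by
  obtain ⟨k, rfl⟩ := Nat.exists_eq_succ_of_ne_zero hn
  have h1 := intervalIntegral.mul_integral_comp_mul_left (a := 0) (b := π) (c := 2)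
    (f := fun u => logSine u * cos ((k + 1 : ℕ) * u))
  rw [mul_zero] at h1
  rw [Nat.succ_eq_add_one, ← h1]
  have e : ∫ u in (0 : ℝ)..π, logSine (2 * u) * cos ((k + 1 : ℕ) * (2 * u)) =
      ∫ u in (0 : ℝ)..π,
        (log 2 * cos ((2 * (k + 1) : ℕ) * u) + log (sin u) * cos (2 * (k + 1) * u)) := by
    refine intervalIntegral.integral_congr_ae ?_
    have h0 : ∀ᵐ u : ℝ, u ≠ π := by simp [ae_iff, measure_singleton]
    filter_upwards [h0] with u hu h
    rw [uIoc_of_le pi_pos.le] at h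
    have hs : sin u ≠ 0 := (sin_pos_of_pos_of_lt_pi h.1 (lt_of_le_of_ne h.2 hu)).ne'
    rw [logSine, mul_div_cancel_left₀ _ two_ne_zero, log_mul two_ne_zero hs]
    push_cast
    ring_nf
  have hint : IntervalIntegrable (fun u => log (sin u) * cos (2 * (k + 1) * u)) volume 0 π :=
    (intervalIntegrable_log_sin (a := 0) (b := π)).mul_continuousOn
      (Continuous.continuousOn (by fun_prop))
  rw [e, intervalIntegral.integral_add (Continuous.intervalIntegrable (by fun_prop) _ _) hint,
    intervalIntegral.integral_const_mul,
    integral_cos_nat_mul (by simp), integral_log_sin_mul_cos]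
  push_cast
  field_simp
  ring

lemma integral_logSine_mul_sin (n : ℕ) :
    ∫ u in (0 : ℝ)..(2 * π), logSine u * sin (n * u) = 0 := by
  have h := intervalIntegral.integral_comp_sub_left (a := 0) (b := 2 * π)
    (fun u => logSine u * sin (n * u)) (2 * π)
  rw [sub_self, sub_zero] at h
  have e : ∀ u, logSine (2 * π - u) * sin (n * (2 * π - u)) = -(logSine u * sin (n * u)) := by
    intro u
    rw [sub_eq_neg_add, logSine_periodic, logSine_neg, mul_add, mul_neg, sin_add_nat_mul_two_pi,
      sin_neg, mul_neg]
  simp_rw [e, intervalIntegral.integral_neg] at h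
  linarith

/-- Folding an integral of an even periodic function over `[0, π]`. -/
lemma integral_even_periodic {G c : ℝ → ℝ} (hG : Function.Periodic G (2 * π))
    (hc : Function.Periodic c (2 * π)) (hGe : ∀ u, G (-u) = G u) (hce : ∀ u, c (-u) = c u)
    (hi : ∀ a b, IntervalIntegrable G volume a b) (hcc : Continuous c) (φ : ℝ) :
    ∫ θ in (0 : ℝ)..π, (G (θ + φ) + G (θ - φ)) * c θ =
      ∫ u in (0 : ℝ)..(2 * π), G u * c (u + φ) := by
  have hm : ∀ a b, IntervalIntegrable (fun θ => G (θ - φ) * c θ) volume a b := fun a b =>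
    (by simpa using (hi (a - φ) (b - φ)).comp_sub_right φ :
      IntervalIntegrable (fun θ => G (θ - φ)) volume a b).mul_continuousOn hcc.continuousOn
  have hp : ∀ a b, IntervalIntegrable (fun θ => G (θ + φ) * c θ) volume a b := fun a b =>
    (by simpa using (hi (a + φ) (b + φ)).comp_add_right φ :
      IntervalIntegrable (fun θ => G (θ + φ)) volume a b).mul_continuousOn hcc.continuousOn
  have h1 : ∫ θ in (0 : ℝ)..π, G (θ + φ) * c θ = ∫ θ in (-π)..0, G (θ - φ) * c θ := by
    have := intervalIntegral.integral_comp_neg (a := -π) (b := 0) (fun θ => G (θ + φ) * c θ)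
    rw [neg_neg, neg_zero] at this
    rw [← this]
    refine intervalIntegral.integral_congr fun θ _ => ?_
    rw [hce, ← hGe (θ - φ)]
    ring_nf
  simp_rw [add_mul]
  rw [intervalIntegral.integral_add (hp _ _) (hm _ _), h1,
    intervalIntegral.integral_add_adjacent_intervals (hm _ _) (hm _ _)]
  have h2 := intervalIntegral.integral_comp_add_right (a := -π - φ) (b := π - φ)
    (fun θ => G (θ - φ) * c θ) φ
  simp only [sub_add_cancel, add_sub_cancel_right] at h2
  rw [← h2]
  have hper : Function.Periodic (fun u => G u * c (u + φ)) (2 * π) := fun u => by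
    change G (u + 2 * π) * c (u + 2 * π + φ) = _
    rw [hG, add_right_comm, hc]
  have := hper.intervalIntegral_add_eq (-π - φ) 0
  rw [zero_add] at this
  rw [← this]
  congr 1
  ring

/-- The sum-to-product formula splits the logarithm. Signs are immaterial since `Real.log` is even.
-/
lemma log_cos_sub_cos {θ φ : ℝ} (h : cos θ ≠ cos φ) :
    log (cos θ - cos φ) = logSine (θ + φ) + logSine (θ - φ) - log 2 := by
  have h1 := cos_sub_cos θ φ
  have h0 : cos θ - cos φ ≠ 0 := sub_ne_zero.2 h
  have hs1 : sin ((θ + φ) / 2) ≠ 0 := fun h => h0 (by rw [h1, h]; ring)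
  have hs2 : sin ((θ - φ) / 2) ≠ 0 := fun h => h0 (by rw [h1, h]; ring)
  rw [logSine, logSine, h1, log_mul two_ne_zero hs1, log_mul two_ne_zero hs2, mul_assoc, neg_mul,
    log_neg_eq_log, log_mul two_ne_zero (mul_ne_zero hs1 hs2), log_mul hs1 hs2]
  ring

lemma ae_cos_ne_cos {φ : ℝ} (hφ : φ ∈ Icc 0 π) : ∀ᵐ θ : ℝ, θ ∈ uIoc 0 π → cos θ ≠ cos φ := by
  have h0 : ∀ᵐ u : ℝ, u ≠ φ := by simp [ae_iff, measure_singleton]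
  filter_upwards [h0] with θ hθ h hc
  rw [uIoc_of_le pi_pos.le] at h
  exact hθ (injOn_cos (Ioc_subset_Icc_self h) hφ hc)

lemma intervalIntegrable_logSine_add (φ a b : ℝ) :
    IntervalIntegrable (fun θ => logSine (θ + φ)) volume a b := by
  simpa using (intervalIntegrable_logSine (a + φ) (b + φ)).comp_add_right φ

lemma intervalIntegrable_logSine_sub (φ a b : ℝ) :
    IntervalIntegrable (fun θ => logSine (θ - φ)) volume a b := by
  simpa using (intervalIntegrable_logSine (a - φ) (b - φ)).comp_sub_right φ

/-- After the split, folding [0, π] onto a full period gives a convolution of an even periodic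
function with a cosine, hence a multiple of that cosine. -/
lemma integral_log_cos_sub_cos {n : ℕ} (hn : n ≠ 0) {φ : ℝ} (hφ : φ ∈ Icc 0 π) :
    ∫ θ in (0 : ℝ)..π, log (cos θ - cos φ) * cos (n * θ) = -π / n * cos (n * φ) := by
  have e : ∫ θ in (0 : ℝ)..π, log (cos θ - cos φ) * cos (n * θ) =
      ∫ θ in (0 : ℝ)..π, ((logSine (θ + φ) + logSine (θ - φ)) * cos (n * θ) -
        log 2 * cos (n * θ)) := by
    refine intervalIntegral.integral_congr_ae ?_
    filter_upwards [ae_cos_ne_cos hφ] with θ hθ h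
    rw [log_cos_sub_cos (hθ h)]
    ring
  rw [e, intervalIntegral.integral_sub
    (((intervalIntegrable_logSine_add φ 0 π).add
      (intervalIntegrable_logSine_sub φ 0 π)).mul_continuousOn
        (Continuous.continuousOn (by fun_prop))) (Continuous.intervalIntegrable (by fun_prop) _ _),
    intervalIntegral.integral_const_mul, integral_cos_nat_mul hn, mul_zero, sub_zero,
    integral_even_periodic logSine_periodic (c := fun θ => cos (n * θ)) (fun u => by
      change cos (n * (u + 2 * π)) = _; rw [mul_add, cos_add_nat_mul_two_pi]) logSine_neg
      (fun u => by rw [mul_neg, cos_neg]) intervalIntegrable_logSine (by fun_prop)]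
  have e2 : ∀ u, logSine u * cos (n * (u + φ)) =
      cos (n * φ) * (logSine u * cos (n * u)) - sin (n * φ) * (logSine u * sin (n * u)) := by
    intro u
    rw [mul_add, cos_add]
    ring
  simp_rw [e2]
  rw [intervalIntegral.integral_sub, intervalIntegral.integral_const_mul,
    intervalIntegral.integral_const_mul, integral_logSine_mul_cos hn, integral_logSine_mul_sin]
  · ring
  · exact ((intervalIntegrable_logSine _ _).mul_continuousOn
      (Continuous.continuousOn (by fun_prop))).const_mul _
  · exact ((intervalIntegrable_logSine _ _).mul_continuousOn
      (Continuous.continuousOn (by fun_prop))).const_mul _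

lemma intervalIntegrable_log_cos_sub_cos (φ a b : ℝ) :
    IntervalIntegrable (fun θ => log (cos θ - cos φ)) volume a b := by
  refine MeromorphicOn.intervalIntegrable_log (f := fun θ => cos θ - cos φ) fun u _ => ?_
  exact AnalyticAt.meromorphicAt (by fun_prop)

lemma integral_abs_log_cos_sub_cos_le {φ : ℝ} (hφ : φ ∈ Icc 0 π) :
    ∫ θ in (0 : ℝ)..π, |log (cos θ - cos φ)| ≤
      (∫ u in (0 : ℝ)..(2 * π), |logSine u|) + π * |log 2| := by
  have hi1 := (intervalIntegrable_logSine_add φ 0 π).abs.add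
    (intervalIntegrable_logSine_sub φ 0 π).abs
  calc ∫ θ in (0 : ℝ)..π, |log (cos θ - cos φ)|
      ≤ ∫ θ in (0 : ℝ)..π, ((|logSine (θ + φ)| + |logSine (θ - φ)|) * 1 + |log 2|) := by
        refine intervalIntegral.integral_mono_ae_restrict pi_pos.le
          (intervalIntegrable_log_cos_sub_cos φ 0 π).abs
          ((by simpa using hi1 : IntervalIntegrable (fun θ =>
            (|logSine (θ + φ)| + |logSine (θ - φ)|) * 1) volume 0 π).add (by simp)) ?_
        have h0 : ∀ᵐ u : ℝ, u ≠ 0 := by simp [ae_iff, measure_singleton]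
        refine (ae_restrict_iff' measurableSet_Icc).2 ?_
        filter_upwards [ae_cos_ne_cos hφ, h0] with θ hθ hθ0 h
        rw [log_cos_sub_cos (hθ (by
          rw [uIoc_of_le pi_pos.le]; exact ⟨lt_of_le_of_ne h.1 (Ne.symm hθ0), h.2⟩))]
        have := abs_sub (logSine (θ + φ) + logSine (θ - φ)) (log 2)
        have := abs_add_le (logSine (θ + φ)) (logSine (θ - φ))
        linarith
    _ = _ := by
        rw [intervalIntegral.integral_add (by simpa using hi1) (by simp),
          integral_even_periodic (G := fun u => |logSine u|) (c := fun _ => 1)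
            (fun u => by simp only [logSine_periodic u]) (fun _ => rfl)
            (fun u => by simp only [logSine_neg]) (fun _ => rfl)
            (fun a b => (intervalIntegrable_logSine a b).abs) continuous_const]
        simp

end Fourier

lemma log_abs_angle (hρ : 0 < ρ) {θ φ : ℝ} (h : Real.cos θ ≠ Real.cos φ) :
    Real.log |m + ρ * Real.cos θ - (m + ρ * Real.cos φ)| =
      Real.log ρ + Real.log (Real.cos θ - Real.cos φ) := by
  rw [Real.log_abs, show m + ρ * Real.cos θ - (m + ρ * Real.cos φ) =
    ρ * (Real.cos θ - Real.cos φ) by ring, Real.log_mul hρ.ne' (sub_ne_zero.2 h)]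

lemma measurable_log_abs_sub (y : ℝ) : Measurable fun x : ℝ => Real.log |x - y| := by
  fun_prop

/-- Chebyshev polynomials are eigenfunctions of the logarithmic potential of ω; the scale
contributes only log ρ, a constant orthogonal to them for n ≠ 0. -/
lemma integral_log_mul_cheb (hρ : 0 < ρ) {n : ℕ} (hn : n ≠ 0) {y : ℝ}
    (hy : y ∈ Icc (m - ρ) (m + ρ)) :
    ∫ x, Real.log |x - y| * (cheb m ρ n).eval x ∂(arcsine m ρ) =
      -(1 / n) * (cheb m ρ n).eval y := by
  obtain ⟨φ, hφ, rfl⟩ := exists_angle hρ hy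
  have hP := (cheb m ρ n).continuous.measurable
  rw [integral_arcsine (Measurable.aestronglyMeasurable (by fun_prop))]
  have e : ∫ θ in (0 : ℝ)..Real.pi,
      Real.log |m + ρ * Real.cos θ - (m + ρ * Real.cos φ)| *
        (cheb m ρ n).eval (m + ρ * Real.cos θ) =
      ∫ θ in (0 : ℝ)..Real.pi, (Real.log ρ * Real.cos (n * θ) +
        Real.log (Real.cos θ - Real.cos φ) * Real.cos (n * θ)) := by
    refine intervalIntegral.integral_congr_ae ?_
    filter_upwards [ae_cos_ne_cos hφ] with θ hθ h
    rw [log_abs_angle hρ (hθ h), eval_cheb_angle hρ.ne', add_mul]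
  rw [e, intervalIntegral.integral_add (Continuous.intervalIntegrable (by fun_prop) _ _)
    ((intervalIntegrable_log_cos_sub_cos φ 0 _).mul_continuousOn
      (Continuous.continuousOn (by fun_prop))), intervalIntegral.integral_const_mul,
    integral_cos_nat_mul hn, integral_log_cos_sub_cos hn hφ, eval_cheb_angle hρ.ne']
  field_simp [Real.pi_ne_zero]
  ring

lemma integrable_log_arcsine (hρ : 0 < ρ) {y : ℝ} (hy : y ∈ Icc (m - ρ) (m + ρ)) :
    Integrable (fun x => Real.log |x - y|) (arcsine m ρ) := by
  obtain ⟨φ, hφ, rfl⟩ := exists_angle hρ hy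
  rw [arcsine, integrable_map_measure (measurable_log_abs_sub _).aestronglyMeasurable
    (by fun_prop)]
  refine Integrable.smul_measure ?_ ENNReal.ofReal_ne_top
  have := (intervalIntegrable_const (a := 0) (b := Real.pi) (c := Real.log ρ)
    (μ := volume)).add (intervalIntegrable_log_cos_sub_cos φ 0 Real.pi)
  rw [intervalIntegrable_iff_integrableOn_Ioc_of_le Real.pi_pos.le] at this
  refine this.congr ?_
  refine (ae_restrict_iff' measurableSet_Ioc).2 ?_
  filter_upwards [ae_cos_ne_cos hφ] with θ hθ h
  rw [uIoc_of_le Real.pi_pos.le] at hθ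
  exact (log_abs_angle hρ (hθ h)).symm

/-- Folding gives a full-period integral of |`logSine`|, independent of the angle of y. This
uniformity allows Fubini against an arbitrary finite measure on the interval. -/
lemma exists_integral_abs_log_le (m : ℝ) (hρ : 0 < ρ) :
    ∃ K : ℝ, ∀ y ∈ Icc (m - ρ) (m + ρ), ∫ x, ‖Real.log |x - y|‖ ∂(arcsine m ρ) ≤ K := by
  refine ⟨Real.pi⁻¹ * (Real.pi * |Real.log ρ| + ((∫ u in (0 : ℝ)..(2 * Real.pi), |logSine u|) +
    Real.pi * |Real.log 2|)), fun y hy => ?_⟩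
  obtain ⟨φ, hφ, rfl⟩ := exists_angle hρ hy
  rw [integral_arcsine ((measurable_log_abs_sub _).norm.aestronglyMeasurable)]
  refine mul_le_mul_of_nonneg_left ?_ (by positivity)
  have hi : IntervalIntegrable (fun _ : ℝ => |Real.log ρ|) volume 0 Real.pi := by simp
  calc _ ≤ ∫ θ in (0 : ℝ)..Real.pi, (|Real.log ρ| + |Real.log (Real.cos θ - Real.cos φ)|) := by
        have h2 := hi.add (intervalIntegrable_log_cos_sub_cos φ 0 Real.pi).abs
        rw [intervalIntegral.integral_of_le Real.pi_pos.le,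
          intervalIntegral.integral_of_le Real.pi_pos.le]
        refine integral_mono_of_nonneg (Eventually.of_forall fun _ => norm_nonneg _)
          ((intervalIntegrable_iff_integrableOn_Ioc_of_le Real.pi_pos.le).1 h2) ?_
        refine (ae_restrict_iff' measurableSet_Ioc).2 ?_
        filter_upwards [ae_cos_ne_cos hφ] with θ hθ h
        rw [uIoc_of_le Real.pi_pos.le] at hθ
        rw [log_abs_angle hρ (hθ h)]
        exact abs_add_le _ _
    _ ≤ _ := by
        rw [intervalIntegral.integral_add hi (intervalIntegrable_log_cos_sub_cos φ 0 _).abs]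
        have := integral_abs_log_cos_sub_cos_le hφ
        simp only [intervalIntegral.integral_const, sub_zero, smul_eq_mul]
        linarith

/-- The logarithm is integrable for the product of the arcsine law and any finite measure on the
same interval. -/
lemma integrable_log_prod (hρ : 0 < ρ) {ν : Measure ℝ} [IsFiniteMeasure ν]
    (hν : ∀ᵐ x ∂ν, x ∈ Icc (m - ρ) (m + ρ)) :
    Integrable (fun z : ℝ × ℝ => Real.log |z.1 - z.2|) ((arcsine m ρ).prod ν) := by
  have hmeas : Measurable fun z : ℝ × ℝ => Real.log |z.1 - z.2| := by fun_prop
  obtain ⟨K, hK⟩ := exists_integral_abs_log_le m hρ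
  rw [integrable_prod_iff' hmeas.aestronglyMeasurable]
  refine ⟨hν.mono fun y hy => integrable_log_arcsine hρ hy, ?_⟩
  refine Integrable.mono' (integrable_const K)
    hmeas.norm.stronglyMeasurable.integral_prod_left'.aestronglyMeasurable ?_
  filter_upwards [hν] with y hy
  rw [Real.norm_of_nonneg (integral_nonneg fun _ => norm_nonneg _)]
  exact hK y hy

end

end BetaEnsemble

/-! ### First variations of the energy. -/

namespace BetaEnsemble

noncomputable section

variable {m ρ β : ℝ} {V : ℝ → ℝ} {μ ν : Measure ℝ}

/-- The real-valued kernel of the energy. -/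
def realKernel (β : ℝ) (V : ℝ → ℝ) (z : ℝ × ℝ) : ℝ :=
  V z.1 + V z.2 - β * Real.log |z.1 - z.2|

lemma measurable_realKernel (hV : Continuous V) : Measurable (realKernel β V) := by
  have := hV.measurable
  unfold realKernel
  fun_prop

lemma energyKernel_ae_eq (hdiag : ∀ᵐ z ∂(ν.prod ν), z.1 ≠ z.2) :
    ∀ᵐ z ∂(ν.prod ν), energyKernel β V z = (realKernel β V z : EReal) := by
  filter_upwards [hdiag] with z hz
  rw [energyKernel, if_neg hz, realKernel]

/-- The diagonal is null, so the value ⊤ of the kernel there contributes nothing. -/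
lemma energy_eq_lintegral (hdiag : ∀ᵐ z ∂(ν.prod ν), z.1 ≠ z.2) :
    energy β V ν = ((1 / 2 : ℝ) : EReal) *
      (((∫⁻ z, ENNReal.ofReal (realKernel β V z) ∂(ν.prod ν) : ℝ≥0∞) : EReal)
        - ((∫⁻ z, ENNReal.ofReal (-realKernel β V z) ∂(ν.prod ν) : ℝ≥0∞) : EReal)) := by
  have h := energyKernel_ae_eq (β := β) (V := V) hdiag
  have h1 : ∫⁻ z, (energyKernel β V z).toENNReal ∂(ν.prod ν) =
      ∫⁻ z, ENNReal.ofReal (realKernel β V z) ∂(ν.prod ν) := by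
    refine lintegral_congr_ae ?_
    filter_upwards [h] with z hz
    rw [hz, EReal.real_coe_toENNReal]
  have h2 : ∫⁻ z, (-energyKernel β V z).toENNReal ∂(ν.prod ν) =
      ∫⁻ z, ENNReal.ofReal (-realKernel β V z) ∂(ν.prod ν) := by
    refine lintegral_congr_ae ?_
    filter_upwards [h] with z hz
    rw [hz, ← EReal.coe_neg, EReal.real_coe_toENNReal]
  rw [energy, h1, h2]

lemma energy_eq_integral (hdiag : ∀ᵐ z ∂(ν.prod ν), z.1 ≠ z.2)
    (hint : Integrable (realKernel β V) (ν.prod ν)) :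
    energy β V ν = ((1 / 2 * ∫ z, realKernel β V z ∂(ν.prod ν) : ℝ) : EReal) := by
  rw [energy_eq_lintegral hdiag, integral_eq_lintegral_pos_part_sub_lintegral_neg_part hint,
    EReal.coe_mul, EReal.coe_sub, EReal.coe_ennreal_toReal, EReal.coe_ennreal_toReal]
  · exact hint.neg.lintegral_lt_top.ne
  · exact hint.lintegral_lt_top.ne

/-- The energy of a measure of finite logarithmic energy. -/
lemma energy_eq [IsProbabilityMeasure ν] (hdiag : ∀ᵐ z ∂(ν.prod ν), z.1 ≠ z.2)
    (hV : Integrable V ν) (hlog : Integrable (fun z : ℝ × ℝ => Real.log |z.1 - z.2|) (ν.prod ν)) :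
    energy β V ν =
      ((∫ x, V x ∂ν - β / 2 * ∫ z : ℝ × ℝ, Real.log |z.1 - z.2| ∂(ν.prod ν) : ℝ) : EReal) := by
  have i1 : Integrable (fun z : ℝ × ℝ => V z.1) (ν.prod ν) := hV.comp_fst ν
  have i2 : Integrable (fun z : ℝ × ℝ => V z.2) (ν.prod ν) := hV.comp_snd ν
  have i12 : Integrable (fun z : ℝ × ℝ => V z.1 + V z.2) (ν.prod ν) := i1.add i2
  rw [energy_eq_integral hdiag (i12.sub (hlog.const_mul β))]
  congr 1
  unfold realKernel
  rw [integral_sub i12 (hlog.const_mul β), integral_add i1 i2, integral_const_mul,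
    integral_fun_fst, integral_fun_snd]
  simp
  ring

lemma ae_prod_ne {ν' : Measure ℝ} [SFinite ν] [SFinite ν'] (hν : ν ≪ volume) :
    ∀ᵐ z ∂(ν'.prod ν), z.1 ≠ z.2 := by
  have hs : MeasurableSet {z : ℝ × ℝ | z.1 = z.2} := measurableSet_eq_fun (by fun_prop) (by fun_prop)
  have : (ν'.prod ν) {z : ℝ × ℝ | z.1 = z.2} = 0 := by
    rw [Measure.measure_prod_null hs]
    refine Eventually.of_forall fun x => hν ?_
    have : Prod.mk x ⁻¹' {z : ℝ × ℝ | z.1 = z.2} = {x} := by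
      ext y; simp [eq_comm]
    rw [this, measure_singleton]
  rw [ae_iff]
  simpa using this

lemma ae_prod_mem_Icc [SFinite ν] {a b : ℝ} (hν : ∀ᵐ x ∂ν, x ∈ Icc a b) :
    ∀ᵐ z ∂(ν.prod ν), z.1 ∈ Icc a b ∧ z.2 ∈ Icc a b := by
  have h1 := Measure.quasiMeasurePreserving_fst (μ := ν) (ν := ν) |>.ae hν
  have h2 := Measure.quasiMeasurePreserving_snd (μ := ν) (ν := ν) |>.ae hν
  filter_upwards [h1, h2] with z hz1 hz2 using ⟨hz1, hz2⟩

/-- An equilibrium measure carried by an interval has finite logarithmic energy. -/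
lemma integrable_log_equilibrium (hβ : 0 < β) (hV : Continuous V) (hρ : 0 < ρ)
    (hμ : IsEquilibriumMeasure β V μ) (hsupp : ∀ᵐ x ∂μ, x ∈ Icc (m - ρ) (m + ρ))
    (hac : μ ≪ volume) :
    Integrable (fun z : ℝ × ℝ => Real.log |z.1 - z.2|) (μ.prod μ) := by
  have := hμ.1
  have iV : Integrable V μ :=
    integrable_of_continuousOn_compact isCompact_Icc hsupp hV.continuousOn
  have i1 : Integrable (fun z : ℝ × ℝ => V z.1) (μ.prod μ) := iV.comp_fst μ
  have i2 : Integrable (fun z : ℝ × ℝ => V z.2) (μ.prod μ) := iV.comp_snd μ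
  suffices hk : Integrable (realKernel β V) (μ.prod μ) by
    have := ((i1.add i2).sub hk).const_mul β⁻¹
    refine this.congr (Eventually.of_forall fun z => ?_)
    simp only [Pi.sub_apply, Pi.add_apply, realKernel]
    field_simp
    ring
  have hdiag : ∀ᵐ z ∂(μ.prod μ), z.1 ≠ z.2 := ae_prod_ne hac
  -- The arcsine law is a competitor of finite energy. The negative part of the kernel is bounded on
  -- the interval, so an infinite positive part would give μ energy ⊤.
  have hle := hμ.2 (arcsine m ρ) inferInstance
  rw [energy_eq (ae_prod_ne (arcsine_absolutelyContinuous hρ))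
    (Continuous.integrable_arcsine hρ.le hV) (integrable_log_prod hρ (arcsine_ae_mem hρ.le)),
    energy_eq_lintegral hdiag] at hle
  have hneg : ∫⁻ z, ENNReal.ofReal (-realKernel β V z) ∂(μ.prod μ) ≠ ⊤ := by
    obtain ⟨B, hB⟩ := isCompact_Icc.exists_bound_of_continuousOn
      (s := Icc (m - ρ) (m + ρ)) hV.continuousOn
    refine ne_top_of_le_ne_top (b := ∫⁻ _, ENNReal.ofReal (2 * B + β * (2 * ρ)) ∂(μ.prod μ))
      (by simp) (lintegral_mono_ae ?_)
    filter_upwards [ae_prod_mem_Icc hsupp] with z hz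
    refine ENNReal.ofReal_le_ofReal ?_
    have b1 := abs_le.1 (hB z.1 hz.1)
    have b2 := abs_le.1 (hB z.2 hz.2)
    have b3 : Real.log |z.1 - z.2| ≤ 2 * ρ :=
      (Real.log_le_self (abs_nonneg _)).trans
        (abs_le.2 ⟨by linarith [hz.1.1, hz.2.2], by linarith [hz.1.2, hz.2.1]⟩)
    have b4 := mul_le_mul_of_nonneg_left b3 hβ.le
    rw [realKernel]
    linarith
  have hpos : ∫⁻ z, ENNReal.ofReal (realKernel β V z) ∂(μ.prod μ) ≠ ⊤ := by
    intro htop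
    rw [htop, ← EReal.coe_ennreal_toReal hneg, EReal.coe_ennreal_top, EReal.top_sub_coe,
      EReal.coe_mul_top_of_pos (by norm_num)] at hle
    exact EReal.coe_ne_top _ (top_le_iff.1 hle)
  refine ⟨(measurable_realKernel hV).aestronglyMeasurable, ?_⟩
  have : ∀ z, ‖realKernel β V z‖ₑ ≤
      ENNReal.ofReal (realKernel β V z) + ENNReal.ofReal (-realKernel β V z) := fun z => by
    rw [Real.enorm_eq_ofReal_abs]
    rcases le_total 0 (realKernel β V z) with h | h
    · rw [abs_of_nonneg h]; exact le_self_add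
    · rw [abs_of_nonpos h]; exact le_add_self
  refine (lintegral_mono this).trans_lt ?_
  rw [lintegral_add_left (measurable_realKernel hV).ennreal_ofReal]
  exact ENNReal.add_lt_top.2 ⟨hpos.lt_top, hneg.lt_top⟩

lemma eq_zero_of_quadratic_nonneg {a b r : ℝ} (hr : 0 < r)
    (h : ∀ t : ℝ, |t| ≤ r → 0 ≤ t * a + t ^ 2 * b) : a = 0 := by
  have hmin : IsLocalMin (fun t : ℝ => t * a + t ^ 2 * b) 0 := by
    filter_upwards [Metric.ball_mem_nhds (0 : ℝ) hr] with t ht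
    simpa using h t (by simpa using (Metric.mem_ball.1 ht).le)
  have hd : HasDerivAt (fun t : ℝ => t * a + t ^ 2 * b) a 0 := by
    have := ((hasDerivAt_id' (0 : ℝ)).mul_const a).fun_add
      (((hasDerivAt_id' (0 : ℝ)).fun_pow 2).mul_const b)
    simpa using this
  exact hmin.hasDerivAt_eq_zero hd

/-- First variation of the energy along bounded densities of mean zero. -/
lemma integral_mul_potential_eq_zero (hβ : 0 < β) (hV : Continuous V) (hρ : 0 < ρ)
    (hμ : IsEquilibriumMeasure β V μ) (hsupp : ∀ᵐ x ∂μ, x ∈ Icc (m - ρ) (m + ρ))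
    (hac : μ ≪ volume) {ψ : ℝ → ℝ} (hψ : Measurable ψ) (hψ1 : ∀ x, |ψ x| ≤ 1)
    (hψ0 : ∫ x, ψ x ∂μ = 0) :
    ∫ x, ψ x * (V x - β * ∫ y, Real.log |x - y| ∂μ) ∂μ = 0 := by
  have := hμ.1
  have iV : Integrable V μ :=
    integrable_of_continuousOn_compact isCompact_Icc hsupp hV.continuousOn
  have iL := integrable_log_equilibrium hβ hV hρ hμ hsupp hac
  have iψ : Integrable ψ μ := Integrable.of_bound hψ.aestronglyMeasurable 1
    (Eventually.of_forall hψ1)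
  have iψV : Integrable (fun x => ψ x * V x) μ := iV.bdd_mul hψ.aestronglyMeasurable
    (c := 1) (Eventually.of_forall hψ1)
  have iL1 : Integrable (fun z : ℝ × ℝ => ψ z.1 * Real.log |z.1 - z.2|) (μ.prod μ) :=
    iL.bdd_mul (hψ.comp measurable_fst).aestronglyMeasurable (c := 1)
      (Eventually.of_forall fun z => hψ1 z.1)
  have iL2 : Integrable (fun z : ℝ × ℝ => ψ z.2 * Real.log |z.1 - z.2|) (μ.prod μ) :=
    iL.bdd_mul (hψ.comp measurable_snd).aestronglyMeasurable (c := 1)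
      (Eventually.of_forall fun z => hψ1 z.2)
  have iL3 : Integrable (fun z : ℝ × ℝ => ψ z.1 * (ψ z.2 * Real.log |z.1 - z.2|)) (μ.prod μ) :=
    iL2.bdd_mul (hψ.comp measurable_fst).aestronglyMeasurable (c := 1)
      (Eventually.of_forall fun z => hψ1 z.1)
  have hsymm : ∫ z : ℝ × ℝ, ψ z.2 * Real.log |z.1 - z.2| ∂(μ.prod μ) =
      ∫ z : ℝ × ℝ, ψ z.1 * Real.log |z.1 - z.2| ∂(μ.prod μ) := by
    rw [← integral_prod_swap]
    simp only [Prod.fst_swap, Prod.snd_swap]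
    simp_rw [abs_sub_comm]
  have hiter : ∫ z : ℝ × ℝ, ψ z.1 * Real.log |z.1 - z.2| ∂(μ.prod μ) =
      ∫ x, ψ x * ∫ y, Real.log |x - y| ∂μ ∂μ := by
    rw [integral_prod _ iL1]
    simp_rw [integral_const_mul]
  have iL4 : Integrable (fun x => ψ x * ∫ y, Real.log |x - y| ∂μ) μ :=
    iL.integral_prod_left.bdd_mul hψ.aestronglyMeasurable (c := 1) (Eventually.of_forall hψ1)
  have hE0 := energy_eq (β := β) (ae_prod_ne hac) iV iL
  set J := ∫ z : ℝ × ℝ, Real.log |z.1 - z.2| ∂(μ.prod μ)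
  set A := ∫ x, ψ x * V x ∂μ with hA
  set B := ∫ x, ψ x * ∫ y, Real.log |x - y| ∂μ ∂μ
  set C := ∫ z : ℝ × ℝ, ψ z.1 * (ψ z.2 * Real.log |z.1 - z.2|) ∂(μ.prod μ) with hC
  have key : A - β * B = 0 := by
    -- The competitor is (1 + tψ)μ, a probability measure for |t| ≤ 1 because |ψ| ≤ 1 and ψ has mean
    -- zero. The energy changes by t(A − βB) − t²(β/2)C.
    refine eq_zero_of_quadratic_nonneg (b := - (β / 2) * C) (r := 1) one_pos fun t ht => ?_
    have hw0 : ∀ x, 0 ≤ 1 + t * ψ x := fun x => by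
      have : |t * ψ x| ≤ 1 := by
        rw [abs_mul]; exact mul_le_one₀ ht (abs_nonneg _) (hψ1 x)
      linarith [(abs_le.1 this).1]
    have hwm : Measurable fun x => ENNReal.ofReal (1 + t * ψ x) := by fun_prop
    set νt := μ.withDensity fun x => ENNReal.ofReal (1 + t * ψ x) with hνt
    have hνac : νt ≪ μ := withDensity_absolutelyContinuous _ _
    have iw : Integrable (fun x => 1 + t * ψ x) μ := (integrable_const _).add (iψ.const_mul t)
    have hprob : IsProbabilityMeasure νt := by
      constructor
      rw [hνt, withDensity_apply _ MeasurableSet.univ, Measure.restrict_univ,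
        ← ofReal_integral_eq_lintegral_ofReal iw (Eventually.of_forall hw0),
        integral_add (integrable_const _) (iψ.const_mul t), integral_const_mul, hψ0]
      simp
    have hprod : νt.prod νt = (μ.prod μ).withDensity
        (fun z => ENNReal.ofReal (1 + t * ψ z.1) * ENNReal.ofReal (1 + t * ψ z.2)) :=
      prod_withDensity hwm hwm
    have hwm2 : Measurable fun z : ℝ × ℝ =>
        ENNReal.ofReal (1 + t * ψ z.1) * ENNReal.ofReal (1 + t * ψ z.2) := by fun_prop
    have htop : ∀ᵐ z ∂(μ.prod μ),
        ENNReal.ofReal (1 + t * ψ z.1) * ENNReal.ofReal (1 + t * ψ z.2) < ⊤ :=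
      Eventually.of_forall fun z => ENNReal.mul_lt_top ENNReal.ofReal_lt_top ENNReal.ofReal_lt_top
    have hexp : ∀ z : ℝ × ℝ, (ENNReal.ofReal (1 + t * ψ z.1) *
        ENNReal.ofReal (1 + t * ψ z.2)).toReal • Real.log |z.1 - z.2| =
        Real.log |z.1 - z.2| + t * (ψ z.1 * Real.log |z.1 - z.2|) +
          t * (ψ z.2 * Real.log |z.1 - z.2|) +
          t ^ 2 * (ψ z.1 * (ψ z.2 * Real.log |z.1 - z.2|)) := fun z => by
      rw [ENNReal.toReal_mul, ENNReal.toReal_ofReal (hw0 _), ENNReal.toReal_ofReal (hw0 _),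
        smul_eq_mul]
      ring
    have iS1 : Integrable (fun z : ℝ × ℝ =>
        Real.log |z.1 - z.2| + t * (ψ z.1 * Real.log |z.1 - z.2|)) (μ.prod μ) :=
      iL.add (iL1.const_mul t)
    have iS2 : Integrable (fun z : ℝ × ℝ => Real.log |z.1 - z.2| +
        t * (ψ z.1 * Real.log |z.1 - z.2|) + t * (ψ z.2 * Real.log |z.1 - z.2|)) (μ.prod μ) :=
      iS1.add (iL2.const_mul t)
    have iLt : Integrable (fun z : ℝ × ℝ => Real.log |z.1 - z.2|) (νt.prod νt) := by
      rw [hprod, integrable_withDensity_iff_integrable_smul' hwm2 htop]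
      simp_rw [hexp]
      exact iS2.add (iL3.const_mul _)
    have hLt : ∫ z : ℝ × ℝ, Real.log |z.1 - z.2| ∂(νt.prod νt) =
        J + t * B + t * B + t ^ 2 * C := by
      rw [hprod, integral_withDensity_eq_integral_toReal_smul hwm2 htop]
      simp_rw [hexp]
      rw [integral_add iS2 (iL3.const_mul _), integral_add iS1 (iL2.const_mul t),
        integral_add iL (iL1.const_mul t), integral_const_mul, integral_const_mul,
        integral_const_mul, hsymm, hiter]
    have htop1 : ∀ᵐ x ∂μ, ENNReal.ofReal (1 + t * ψ x) < ⊤ :=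
      Eventually.of_forall fun x => ENNReal.ofReal_lt_top
    have hVt : ∫ x, V x ∂νt = ∫ x, V x ∂μ + t * A := by
      rw [hνt, integral_withDensity_eq_integral_toReal_smul hwm htop1]
      have : ∀ x, (ENNReal.ofReal (1 + t * ψ x)).toReal • V x = V x + t * (ψ x * V x) := fun x => by
        rw [ENNReal.toReal_ofReal (hw0 _), smul_eq_mul]; ring
      simp_rw [this]
      rw [integral_add iV (iψV.const_mul t), integral_const_mul]
    have iVt : Integrable V νt :=
      integrable_of_continuousOn_compact isCompact_Icc (hνac.ae_le hsupp) hV.continuousOn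
    have hle := hμ.2 νt hprob
    rw [hE0, energy_eq (ae_prod_ne (hνac.trans hac)) iVt iLt, hLt, hVt, EReal.coe_le_coe_iff] at hle
    linarith
  have e : ∀ x, ψ x * (V x - β * ∫ y, Real.log |x - y| ∂μ) =
      ψ x * V x - β * (ψ x * ∫ y, Real.log |x - y| ∂μ) := fun x => by ring
  simp_rw [e]
  rw [integral_sub iψV (iL4.const_mul β), integral_const_mul]
  exact key

/-- The Euler–Lagrange equation: the effective potential is constant. -/
lemma exists_potential_ae_eq (hβ : 0 < β) (hV : Continuous V) (hρ : 0 < ρ)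
    (hμ : IsEquilibriumMeasure β V μ) (hsupp : ∀ᵐ x ∂μ, x ∈ Icc (m - ρ) (m + ρ))
    (hac : μ ≪ volume) :
    ∃ c : ℝ, ∀ᵐ x ∂μ, V x - β * ∫ y, Real.log |x - y| ∂μ = c := by
  have := hμ.1
  have iV : Integrable V μ :=
    integrable_of_continuousOn_compact isCompact_Icc hsupp hV.continuousOn
  have iL := integrable_log_equilibrium hβ hV hρ hμ hsupp hac
  set H : ℝ → ℝ := fun x => V x - β * ∫ y, Real.log |x - y| ∂μ with hH
  have iH : Integrable H μ := iV.sub (iL.integral_prod_left.const_mul β)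
  refine ⟨∫ x, H x ∂μ, ?_⟩
  refine iH.ae_eq_of_forall_setIntegral_eq H (fun _ => ∫ x, H x ∂μ) (integrable_const _) ?_
  intro s hs _
  -- The centred indicator of s gives ∫_s H dμ = μ(s) ∫ H dμ for every measurable s, so H equals its
  -- mean a.e.
  have h0 := integral_mul_potential_eq_zero hβ hV hρ hμ hsupp hac
    (ψ := fun x => s.indicator (fun _ => (1 : ℝ)) x - μ.real s)
    ((measurable_const.indicator hs).sub measurable_const) (fun x => by
      have h1 : μ.real s ≤ 1 := measureReal_le_one
      have h2 : 0 ≤ μ.real s := measureReal_nonneg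
      rw [abs_le]
      by_cases hx : x ∈ s
      · rw [indicator_of_mem hx]; constructor <;> linarith
      · rw [indicator_of_notMem hx]; constructor <;> linarith)
    (by
      rw [integral_sub ((integrable_const _).indicator hs) (integrable_const _),
        integral_indicator_const _ hs]
      simp)
  have e : ∀ x, (s.indicator (fun _ => (1 : ℝ)) x - μ.real s) * H x =
      s.indicator H x - μ.real s * H x := fun x => by
    by_cases hx : x ∈ s <;> (simp [hx]; try ring)
  change ∫ x, (s.indicator (fun _ => (1 : ℝ)) x - μ.real s) * H x ∂μ = 0 at h0
  simp_rw [e] at h0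
  rw [integral_sub (iH.indicator hs) (iH.const_mul _), integral_indicator hs,
    integral_const_mul] at h0
  rw [setIntegral_const, smul_eq_mul]
  linarith

/-- The dilation identity for an equilibrium measure. -/
lemma integral_sub_mul_deriv (hβ : 0 < β) (hV : ContDiff ℝ 1 V) (hρ : 0 < ρ)
    (hμ : IsEquilibriumMeasure β V μ) (hsupp : ∀ᵐ x ∂μ, x ∈ Icc (m - ρ) (m + ρ))
    (hac : μ ≪ volume) : ∫ x, (x - m) * deriv V x ∂μ = β / 2 := by
  have := hμ.1
  have hVc := hV.continuous
  have hVc' : Continuous (deriv V) := hV.continuous_deriv le_rfl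
  have iV : Integrable V μ :=
    integrable_of_continuousOn_compact isCompact_Icc hsupp hVc.continuousOn
  have iL := integrable_log_equilibrium hβ hVc hρ hμ hsupp hac
  have hE0 := energy_eq (β := β) (ae_prod_ne hac) iV iL
  set J := ∫ z : ℝ × ℝ, Real.log |z.1 - z.2| ∂(μ.prod μ)
  -- The competitor is the image of μ under dilation by s about m, whose logarithmic energy is that
  -- of μ plus log s. The derivative at s = 1 gives the identity.
  have hEs : ∀ s : ℝ, 0 < s → ∫ x, V x ∂μ - β / 2 * J ≤
      ∫ x, V (m + s * (x - m)) ∂μ - β / 2 * (Real.log s + J) := by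
    intro s hs
    set d : ℝ → ℝ := fun x => m + s * (x - m) with hd
    have hdm : Measurable d := by fun_prop
    have hdd : Measurable (Prod.map d d) := hdm.prodMap hdm
    have hprob : IsProbabilityMeasure (μ.map d) := Measure.isProbabilityMeasure_map hdm.aemeasurable
    have hprod : (μ.map d).prod (μ.map d) = (μ.prod μ).map (Prod.map d d) :=
      Measure.map_prod_map μ μ hdm hdm
    have hmeas : Measurable fun z : ℝ × ℝ => Real.log |z.1 - z.2| := by fun_prop
    have hdiag0 : ∀ᵐ z ∂(μ.prod μ), z.1 ≠ z.2 := ae_prod_ne hac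
    have hdiag : ∀ᵐ z ∂((μ.map d).prod (μ.map d)), z.1 ≠ z.2 := by
      rw [hprod]
      refine (ae_map_iff (p := fun z : ℝ × ℝ => z.1 ≠ z.2) hdd.aemeasurable
        (measurableSet_eq_fun (by fun_prop) (by fun_prop)).compl).2 ?_
      filter_upwards [hdiag0] with z hz h
      have h' : m + s * (z.1 - m) = m + s * (z.2 - m) := h
      exact hz (by have := mul_left_cancel₀ hs.ne' (add_left_cancel h'); linarith)
    have hlog : (fun z : ℝ × ℝ => Real.log |(Prod.map d d z).1 - (Prod.map d d z).2|)
        =ᵐ[μ.prod μ] fun z => Real.log s + Real.log |z.1 - z.2| := by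
      filter_upwards [hdiag0] with z hz
      simp only [Prod.map_fst, Prod.map_snd, hd]
      rw [show m + s * (z.1 - m) - (m + s * (z.2 - m)) = s * (z.1 - z.2) by ring, abs_mul,
        abs_of_pos hs, Real.log_mul hs.ne' (abs_ne_zero.2 (sub_ne_zero.2 hz))]
    have iLs : Integrable (fun z : ℝ × ℝ => Real.log |z.1 - z.2|)
        ((μ.map d).prod (μ.map d)) := by
      rw [hprod, integrable_map_measure hmeas.aestronglyMeasurable hdd.aemeasurable]
      exact ((integrable_const _).add iL).congr hlog.symm
    have hLs : ∫ z : ℝ × ℝ, Real.log |z.1 - z.2| ∂((μ.map d).prod (μ.map d)) =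
        Real.log s + J := by
      rw [hprod, integral_map hdd.aemeasurable hmeas.aestronglyMeasurable, integral_congr_ae hlog,
        integral_add (integrable_const _) iL, integral_const, probReal_univ, one_smul]
    have iVs : Integrable V (μ.map d) := by
      rw [integrable_map_measure hVc.aestronglyMeasurable hdm.aemeasurable]
      exact integrable_of_continuousOn_compact isCompact_Icc hsupp
        (hVc.comp (by fun_prop)).continuousOn
    have hle := hμ.2 (μ.map d) hprob
    rw [hE0, energy_eq hdiag iVs iLs, hLs, integral_map hdm.aemeasurable
      hVc.aestronglyMeasurable, EReal.coe_le_coe_iff] at hle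
    exact hle
  have hmin : IsLocalMin (fun s : ℝ => ∫ x, V (m + s * (x - m)) ∂μ - β / 2 * (Real.log s + J)) 1 := by
    filter_upwards [Ioi_mem_nhds (zero_lt_one' ℝ)] with s hs
    simpa using hEs s hs
  have hder : HasDerivAt (fun s : ℝ => ∫ x, V (m + s * (x - m)) ∂μ)
      (∫ x, (x - m) * deriv V (m + 1 * (x - m)) ∂μ) 1 := by
    refine hasDerivAt_integral_of_compact isCompact_Icc hsupp isOpen_univ
      (F := fun s x => V (m + s * (x - m)))
      (F' := fun s x => (x - m) * deriv V (m + s * (x - m)))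
      (fun s _ => by fun_prop) (by fun_prop) (fun s _ x _ => ?_) (mem_univ 1)
    have h1 : HasDerivAt (fun s => m + s * (x - m)) (x - m) s := by
      simpa using ((hasDerivAt_id s).mul_const (x - m)).const_add m
    exact (((hV.differentiable one_ne_zero) _).hasDerivAt.comp s h1).congr_deriv (mul_comm _ _)
  have hder2 := hder.sub (((Real.hasDerivAt_log one_ne_zero).add_const J).const_mul (β / 2))
  have := hmin.hasDerivAt_eq_zero hder2
  simp only [one_mul, add_sub_cancel, inv_one, mul_one] at this
  linarith

end

end BetaEnsemble

/-! ### The equilibrium density and the conjugation of Ξ with U. -/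

namespace BetaEnsemble

noncomputable section

variable {m ρ β : ℝ} {V : ℝ → ℝ} {μ : Measure ℝ}

/-- An equilibrium measure equivalent to the arcsine law of `[m - ρ, m + ρ]`. -/
structure IsOneCut (β : ℝ) (V : ℝ → ℝ) (μ : Measure ℝ) (m ρ : ℝ) : Prop where
  beta_pos : 0 < β
  radius_pos : 0 < ρ
  contDiff : ContDiff ℝ 3 V
  equilibrium : IsEquilibriumMeasure β V μ
  ae_mem : ∀ᵐ x ∂μ, x ∈ Icc (m - ρ) (m + ρ)
  ac_volume : μ ≪ volume
  arcsine_ac : arcsine m ρ ≪ μ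

namespace IsOneCut

lemma contDiff_deriv (H : IsOneCut β V μ m ρ) : ContDiff ℝ 2 (deriv V) := by
  have h : ContDiff ℝ (2 + 1) V := by exact_mod_cast H.contDiff
  exact (contDiff_succ_iff_deriv.1 h).2.2

lemma contDiff_deriv_one (H : IsOneCut β V μ m ρ) : ContDiff ℝ 1 (deriv V) :=
  H.contDiff_deriv.of_le one_le_two

/-- Integration by parts against Chebyshev polynomials. -/
lemma _root_.BetaEnsemble.integral_mul_cheb (hρ : 0 < ρ) (hV : ContDiff ℝ 1 V) (n : ℕ) :
    n * ∫ x, V x * (cheb m ρ n).eval x ∂(arcsine m ρ) =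
      ∫ x, deriv V x * (ρ ^ 2 - (x - m) ^ 2) * T m ρ (fun z => (cheb m ρ n).eval z) x
        ∂(arcsine m ρ) := by
  have c0 := hV.continuous
  have c1 : Continuous (deriv V) := hV.continuous_deriv le_rfl
  have c2 := continuous_T (m := m) hρ.le (contDiff_polynomial (cheb m ρ n) (n := 1))
  rw [integral_arcsine (Continuous.aestronglyMeasurable (by fun_prop)),
    integral_arcsine (Continuous.aestronglyMeasurable (by fun_prop)), mul_left_comm]
  congr 1
  have e : ∀ θ, deriv V (m + ρ * Real.cos θ) * (ρ ^ 2 - (m + ρ * Real.cos θ - m) ^ 2) *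
      T m ρ (fun z => (cheb m ρ n).eval z) (m + ρ * Real.cos θ) =
      -((deriv V (m + ρ * Real.cos θ) * (-(ρ * Real.sin θ))) * Real.sin (n * θ)) := fun θ => by
    have h1 : ρ ^ 2 - (m + ρ * Real.cos θ - m) ^ 2 =
        (ρ * Real.sin θ) * (ρ * Real.sin θ) := by
      have := Real.sin_sq_add_cos_sq θ
      linear_combination ρ ^ 2 * (-this)
    rw [h1, ← T_cheb_angle hρ n θ]
    ring
  simp_rw [e, eval_cheb_angle hρ.ne']
  have hu : ∀ θ ∈ uIcc 0 Real.pi, HasDerivAt (fun θ => V (m + ρ * Real.cos θ))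
      (deriv V (m + ρ * Real.cos θ) * (-(ρ * Real.sin θ))) θ := fun θ _ => by
    have h1 : HasDerivAt (fun θ => m + ρ * Real.cos θ) (-(ρ * Real.sin θ)) θ := by
      simpa using ((Real.hasDerivAt_cos θ).const_mul ρ).const_add m
    exact ((hV.differentiable one_ne_zero) _).hasDerivAt.comp θ h1
  have hv : ∀ θ ∈ uIcc 0 Real.pi, HasDerivAt (fun θ => Real.sin (n * θ))
      (n * Real.cos (n * θ)) θ := fun θ _ => by
    have := ((hasDerivAt_id θ).const_mul (n : ℝ)).sin
    simpa [mul_comm] using this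
  have := intervalIntegral.integral_mul_deriv_eq_deriv_mul hu hv
    (Continuous.intervalIntegrable (by fun_prop) _ _)
    (Continuous.intervalIntegrable (by fun_prop) _ _)
  simp only [Real.sin_nat_mul_pi, mul_zero, Real.sin_zero, sub_zero, zero_sub] at this
  rw [intervalIntegral.integral_neg, ← this, ← intervalIntegral.integral_const_mul]
  refine intervalIntegral.integral_congr fun θ _ => ?_
  ring

/-- Integrate the Euler–Lagrange equation against a Chebyshev polynomial: the constant drops out,
the potential becomes −1/n times the moment of μ, and V is integrated by parts. -/
lemma integral_cheb_equilibrium (H : IsOneCut β V μ m ρ) {n : ℕ} (hn : n ≠ 0) :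
    β * ∫ x, (cheb m ρ n).eval x ∂μ = - ∫ x, deriv V x * (ρ ^ 2 - (x - m) ^ 2) *
      T m ρ (fun z => (cheb m ρ n).eval z) x ∂(arcsine m ρ) := by
  have hρ := H.radius_pos
  have := H.equilibrium.1
  have hVc := H.contDiff.continuous
  have hn' : (n : ℝ) ≠ 0 := by exact_mod_cast hn
  set P := cheb m ρ n with hP
  rw [← integral_mul_cheb hρ (H.contDiff.of_le (by norm_num))]
  obtain ⟨c, hc⟩ := exists_potential_ae_eq H.beta_pos hVc hρ H.equilibrium H.ae_mem H.ac_volume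
  -- The equation is known only μ-a.e.; positivity of the density carries it over to ω.
  have hc' := H.arcsine_ac.ae_le hc
  have iL := integrable_log_prod (m := m) hρ H.ae_mem
  obtain ⟨B, hB⟩ := isCompact_Icc.exists_bound_of_continuousOn
    (s := Icc (m - ρ) (m + ρ)) P.continuous.continuousOn
  have iLP : Integrable (fun z : ℝ × ℝ => P.eval z.1 * Real.log |z.1 - z.2|)
      ((arcsine m ρ).prod μ) := by
    refine iL.bdd_mul (P.continuous.comp continuous_fst).aestronglyMeasurable (c := B) ?_
    have h1 := Measure.quasiMeasurePreserving_fst (μ := arcsine m ρ) (ν := μ) |>.ae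
      (arcsine_ae_mem hρ.le)
    filter_upwards [h1] with z hz using hB _ hz
  have h1 : ∫ x, P.eval x * ∫ y, Real.log |x - y| ∂μ ∂(arcsine m ρ) =
      -(1 / n) * ∫ y, P.eval y ∂μ := by
    have : ∀ x, P.eval x * ∫ y, Real.log |x - y| ∂μ = ∫ y, P.eval x * Real.log |x - y| ∂μ :=
      fun x => (integral_const_mul _ _).symm
    simp_rw [this]
    rw [integral_integral_swap (f := fun x y => P.eval x * Real.log |x - y|) iLP,
      ← integral_const_mul]
    refine integral_congr_ae ?_
    filter_upwards [H.ae_mem] with y hy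
    rw [← integral_log_mul_cheb hρ hn hy]
    simp_rw [mul_comm]
    rfl
  have i2 : Integrable (fun x => P.eval x * ∫ y, Real.log |x - y| ∂μ) (arcsine m ρ) := by
    have := iLP.integral_prod_left
    simpa only [integral_const_mul] using this
  have h2 : ∫ x, V x * P.eval x ∂(arcsine m ρ) =
      ∫ x, (c * P.eval x + β * (P.eval x * ∫ y, Real.log |x - y| ∂μ)) ∂(arcsine m ρ) := by
    refine integral_congr_ae ?_
    filter_upwards [hc'] with x hx
    rw [← hx]
    ring
  rw [h2, integral_add (Continuous.integrable_arcsine hρ.le (by fun_prop)) (i2.const_mul β),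
    integral_const_mul, integral_const_mul, h1, integral_cheb hρ.ne' hn]
  field_simp
  ring

/-- Duality turns the Chebyshev moments into those of (β − U V') ω. The constant β accounts for
total mass, since the moment formula fails to see n = 0. -/
lemma integral_polynomial (H : IsOneCut β V μ m ρ) (P : Polynomial ℝ) :
    β * ∫ x, P.eval x ∂μ = ∫ x, (β - U m ρ (deriv V) x) * P.eval x ∂(arcsine m ρ) := by
  have hρ := H.radius_pos
  have := H.equilibrium.1
  have cV : Continuous (deriv V) := H.contDiff_deriv.continuous
  have cU := continuous_U (m := m) hρ.le H.contDiff_deriv_one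
  have iμ : ∀ P : Polynomial ℝ, Integrable (fun x => P.eval x) μ := fun P =>
    integrable_of_continuousOn_compact isCompact_Icc H.ae_mem P.continuous.continuousOn
  have hT : ∀ P : Polynomial ℝ, Continuous (T m ρ fun z => P.eval z) := fun P =>
    continuous_T hρ.le (contDiff_polynomial P)
  have key : β * ∫ x, P.eval x ∂μ - β * ∫ x, P.eval x ∂(arcsine m ρ) =
      - ∫ x, deriv V x * (ρ ^ 2 - (x - m) ^ 2) * T m ρ (fun z => P.eval z) x ∂(arcsine m ρ) := by
    induction P using cheb_induction (m := m) hρ.ne' with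
    | hT n =>
      rcases eq_or_ne n 0 with rfl | hn
      · simp [cheb_zero, T_const]
      · rw [H.integral_cheb_equilibrium hn, integral_cheb hρ.ne' hn, mul_zero, sub_zero]
    | hadd P Q hP hQ =>
      have := hT P
      have := hT Q
      simp_rw [Polynomial.eval_add, T_add hρ.le (contDiff_polynomial P) (contDiff_polynomial Q),
        mul_add]
      rw [integral_add (iμ P) (iμ Q),
        integral_add (Continuous.integrable_arcsine hρ.le P.continuous)
        (Continuous.integrable_arcsine hρ.le Q.continuous),
        integral_add (Continuous.integrable_arcsine hρ.le (by fun_prop))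
        (Continuous.integrable_arcsine hρ.le (by fun_prop)), neg_add, ← hP, ← hQ]
      ring
    | hsmul c P hP =>
      simp_rw [Polynomial.eval_smul, smul_eq_mul, T_const_mul c (contDiff_polynomial P),
        mul_left_comm _ c]
      rw [integral_const_mul, integral_const_mul, integral_const_mul, ← mul_neg, ← hP]
      ring
  rw [← integral_U_mul hρ H.contDiff_deriv_one (contDiff_polynomial P)] at key
  simp_rw [sub_mul]
  rw [integral_sub (Continuous.integrable_arcsine hρ.le (by fun_prop))
    (Continuous.integrable_arcsine hρ.le (by fun_prop)), integral_const_mul]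
  linarith

/-- Criticality of the endpoints. -/
lemma integral_deriv (H : IsOneCut β V μ m ρ) :
    ∫ x, deriv V x ∂(arcsine m ρ) = 0 ∧ ∫ x, (x - m) * deriv V x ∂(arcsine m ρ) = β := by
  have hρ := H.radius_pos
  have := H.equilibrium.1
  have sv := H.contDiff_deriv_one
  have cv : Continuous (deriv V) := sv.continuous
  have cU := continuous_U (m := m) hρ.le sv
  have cT := continuous_T (m := m) hρ.le sv
  have h1 := integral_sub_mul_deriv (m := m) H.beta_pos (H.contDiff.of_le (by norm_num)) hρ
    H.equilibrium H.ae_mem H.ac_volume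
  -- Testing with (x−m)V' and using the dilation identity gives β²/2 = βE − X. Duality with the same
  -- function gives 2X = E² + ρ²v0². Together, (β−E)² + (ρv0)² = 0.
  have h2 := integral_eq_of_polynomial hρ H.ae_mem (G := fun x => β - U m ρ (deriv V) x)
    (by fun_prop) H.integral_polynomial (φ := fun x => (x - m) * deriv V x)
    (Continuous.continuousOn (by fun_prop))
  have hx : ContDiff ℝ 1 fun x => (x - m) * deriv V x := (contDiff_sub_const m).mul sv
  have h3 := integral_U_mul (m := m) hρ sv hx
  simp_rw [T_sub_mul hρ.le sv] at h3
  simp_rw [sub_mul β] at h2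
  rw [h1, integral_sub (Continuous.integrable_arcsine hρ.le (by fun_prop))
    (Continuous.integrable_arcsine hρ.le (by fun_prop)), integral_const_mul] at h2
  have hrel := U_add_mul_T (m := m) hρ sv
  set v0 := ∫ x, deriv V x ∂(arcsine m ρ) with hv0
  set E := ∫ x, (x - m) * deriv V x ∂(arcsine m ρ) with hE
  set X := ∫ x, U m ρ (deriv V) x * ((x - m) * deriv V x) ∂(arcsine m ρ) with hX
  have e : ∀ x, deriv V x * (ρ ^ 2 - (x - m) ^ 2) * (v0 + (x - m) * T m ρ (deriv V) x) =
      ρ ^ 2 * v0 * deriv V x + E * ((x - m) * deriv V x) -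
        U m ρ (deriv V) x * ((x - m) * deriv V x) := fun x => by
    linear_combination ((x - m) * deriv V x) * hrel x
  simp_rw [e] at h3
  rw [integral_sub (Continuous.integrable_arcsine hρ.le (by fun_prop))
    (Continuous.integrable_arcsine hρ.le (by fun_prop)),
    integral_add (Continuous.integrable_arcsine hρ.le (by fun_prop))
    (Continuous.integrable_arcsine hρ.le (by fun_prop)), integral_const_mul, integral_const_mul,
    ← hv0, ← hE, ← hX] at h3
  have hsum : (β - E) ^ 2 + (ρ * v0) ^ 2 = 0 := by linear_combination 2 * h2 - h3
  have hb : β - E = 0 := by nlinarith [sq_nonneg (β - E), sq_nonneg (ρ * v0)]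
  have hv : ρ * v0 = 0 := by nlinarith [sq_nonneg (β - E), sq_nonneg (ρ * v0)]
  exact ⟨(mul_eq_zero.1 hv).resolve_left hρ.ne', by linarith⟩

/-- The equilibrium measure has density proportional to `T V'`. -/
lemma integral_equilibrium (H : IsOneCut β V μ m ρ) {φ : ℝ → ℝ}
    (hφ : ContinuousOn φ (Icc (m - ρ) (m + ρ))) :
    β * ∫ x, φ x ∂μ =
      ∫ x, (ρ ^ 2 - (x - m) ^ 2) * T m ρ (deriv V) x * φ x ∂(arcsine m ρ) := by
  have hρ := H.radius_pos
  have := H.equilibrium.1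
  have cU := continuous_U (m := m) hρ.le H.contDiff_deriv_one
  have h2 := integral_eq_of_polynomial hρ H.ae_mem (G := fun x => β - U m ρ (deriv V) x)
    (by fun_prop) H.integral_polynomial hφ
  rw [h2]
  congr 1
  ext x
  congr 1
  have := U_add_mul_T (m := m) hρ H.contDiff_deriv_one x
  rw [H.integral_deriv.1, H.integral_deriv.2] at this
  linarith

lemma contDiff_T_deriv (H : IsOneCut β V μ m ρ) : ContDiff ℝ 1 (T m ρ (deriv V)) := by
  exact_mod_cast contDiff_T (n := 1) H.radius_pos.le (by exact_mod_cast H.contDiff_deriv)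

lemma U_T_deriv (H : IsOneCut β V μ m ρ) (x : ℝ) : U m ρ (T m ρ (deriv V)) x = deriv V x := by
  rw [U_T H.radius_pos H.contDiff_deriv, H.integral_deriv.1, sub_zero]

/-- The master operator is conjugate to `U`. -/
lemma Xi_eq_U (H : IsOneCut β V μ m ρ) {f : ℝ → ℝ} (hf : ContDiff ℝ 1 f) (x : ℝ) :
    Xi β V μ f x = U m ρ (fun z => f z * T m ρ (deriv V) z) x := by
  have hρ := H.radius_pos
  have := H.equilibrium.1
  have cT := H.contDiff_T_deriv.continuous
  have cd := continuous_dq_right hf x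
  have cd' := continuous_dq_right H.contDiff_T_deriv x
  have h1 : ∫ y, (f x - f y) / (x - y) ∂μ = ∫ y, dq f x y ∂μ := by
    refine integral_congr_ae ?_
    have h0 : ∀ᵐ y ∂μ, y ≠ x := by
      have : ∀ᵐ y : ℝ, y ≠ x := by simp [ae_iff, measure_singleton]
      exact H.ac_volume.ae_le this
    filter_upwards [h0] with y hy
    rw [dq_of_ne hf hy.symm]
  rw [Xi, h1, neg_mul, H.integral_equilibrium cd.continuousOn, ← H.U_T_deriv x, U, U]
  -- The product rule splits the divided difference into the integral against βμ and f(x) times the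
  -- integral occurring in U(T V') = V'.
  have e : ∀ y, dq (fun z => f z * T m ρ (deriv V) z) x y * (ρ ^ 2 - (y - m) ^ 2) =
      (ρ ^ 2 - (y - m) ^ 2) * T m ρ (deriv V) y * dq f x y +
        f x * (dq (T m ρ (deriv V)) x y * (ρ ^ 2 - (y - m) ^ 2)) := fun y => by
    rw [dq_mul hf H.contDiff_T_deriv]
    ring
  simp_rw [e]
  rw [integral_add (Continuous.integrable_arcsine hρ.le (by fun_prop))
    (Continuous.integrable_arcsine hρ.le (by fun_prop)), integral_const_mul]
  ring

/-- Outside the interval U(T V') = V' reads V'(x) = T V'(x)·(factor) + β∫ dμ(y)/(x−y); a zero of T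
V' would contradict `hout`. -/
lemma T_deriv_ne_zero_of_notMem (H : IsOneCut β V μ m ρ) {x : ℝ}
    (hx : x ∉ Icc (m - ρ) (m + ρ)) (hout : β * ∫ y, 1 / (x - y) ∂μ ≠ deriv V x) :
    T m ρ (deriv V) x ≠ 0 := by
  intro h0
  have hne : ∀ y ∈ Icc (m - ρ) (m + ρ), x - y ≠ 0 := fun y hy h =>
    hx (by rwa [sub_eq_zero.1 h])
  have h1 := U_of_notMem H.radius_pos H.contDiff_T_deriv hx
  rw [← H.integral_equilibrium (φ := fun y => 1 / (x - y)) (ContinuousOn.div (by fun_prop) (by fun_prop) hne),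
    H.U_T_deriv, h0, zero_mul, zero_add] at h1
  exact hout h1.symm

end IsOneCut

/-- Change of variables to the arcsine law. -/
lemma integral_sqrt_mul (hρ : 0 < ρ) {φ : ℝ → ℝ} (hφ : Continuous φ) :
    ∫ x in Icc (m - ρ) (m + ρ), Real.sqrt ((x - (m - ρ)) * (m + ρ - x)) * φ x =
      Real.pi * ∫ x, (ρ ^ 2 - (x - m) ^ 2) * φ x ∂(arcsine m ρ) := by
  rw [integral_arcsine (Continuous.aestronglyMeasurable (by fun_prop)),
    mul_inv_cancel_left₀ Real.pi_ne_zero, integral_Icc_eq_integral_Ioc,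
    ← intervalIntegral.integral_of_le (by linarith)]
  have h := intervalIntegral.integral_comp_mul_deriv (a := 0) (b := Real.pi)
    (f := fun θ => m + ρ * Real.cos θ) (f' := fun θ => -(ρ * Real.sin θ))
    (g := fun x => Real.sqrt ((x - (m - ρ)) * (m + ρ - x)) * φ x)
    (fun θ _ => by simpa using ((Real.hasDerivAt_cos θ).const_mul ρ).const_add m)
    (Continuous.continuousOn (by fun_prop)) (by fun_prop)
  simp only [Real.cos_pi, Real.cos_zero, mul_neg, mul_one, ← sub_eq_add_neg] at h
  rw [intervalIntegral.integral_symm, ← h, ← intervalIntegral.integral_neg]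
  refine intervalIntegral.integral_congr fun θ hθ => ?_
  rw [uIcc_of_le Real.pi_pos.le] at hθ
  have hs := Real.sin_nonneg_of_mem_Icc hθ
  have e : (m + ρ * Real.cos θ - (m - ρ)) * (m + ρ - (m + ρ * Real.cos θ)) =
      (ρ * Real.sin θ) ^ 2 := by
    have := Real.sin_sq_add_cos_sq θ
    linear_combination ρ ^ 2 * (-this)
  have e2 : ρ ^ 2 - (m + ρ * Real.cos θ - m) ^ 2 = (ρ * Real.sin θ) ^ 2 := by
    have := Real.sin_sq_add_cos_sq θ
    linear_combination ρ ^ 2 * (-this)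
  simp only [Function.comp_apply, e, e2, Real.sqrt_sq (mul_nonneg hρ.le hs)]
  ring

/-! ### Nonvanishing of T V' from the density of μ. -/

section Density

variable {S : ℝ → ℝ} {κ : ℝ}

/-- Off the endpoints the density is strictly positive, so Lebesgue measure on the interval, and
hence ω, is absolutely continuous with respect to μ. -/
lemma isOneCut_of_density (hβ : 0 < β) (hρ : 0 < ρ) (hV : ContDiff ℝ 3 V)
    (hμ : IsEquilibriumMeasure β V μ) (hκ : 0 < κ) (hS : Measurable S)
    (hSc : ∀ᵐ x ∂(volume.restrict (Icc (m - ρ) (m + ρ))), κ ≤ S x)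
    (hdens : μ = (volume.restrict (Icc (m - ρ) (m + ρ))).withDensity
      (fun x => ENNReal.ofReal (S x * Real.sqrt ((x - (m - ρ)) * (m + ρ - x))))) :
    IsOneCut β V μ m ρ := by
  have hac : μ ≪ volume.restrict (Icc (m - ρ) (m + ρ)) := by
    rw [hdens]; exact withDensity_absolutelyContinuous _ _
  refine ⟨hβ, hρ, hV, hμ, hac.ae_le (ae_restrict_mem measurableSet_Icc),
    hac.trans Measure.absolutelyContinuous_restrict, ?_⟩
  have h1 : arcsine m ρ ≪ volume.restrict (Icc (m - ρ) (m + ρ)) := by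
    rw [← Measure.restrict_eq_self_of_ae_mem (arcsine_ae_mem (m := m) hρ.le)]
    exact (arcsine_absolutelyContinuous hρ).restrict _
  refine h1.trans ?_
  rw [hdens]
  refine withDensity_absolutelyContinuous' (by fun_prop) ?_
  have ha : ∀ᵐ x ∂(volume.restrict (Icc (m - ρ) (m + ρ))), x ≠ m - ρ :=
    ae_restrict_of_ae (by simp [ae_iff, measure_singleton])
  have hb : ∀ᵐ x ∂(volume.restrict (Icc (m - ρ) (m + ρ))), x ≠ m + ρ :=
    ae_restrict_of_ae (by simp [ae_iff, measure_singleton])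
  filter_upwards [hSc, ha, hb, ae_restrict_mem measurableSet_Icc] with x hx hxa hxb hxI
  have p1 : 0 < x - (m - ρ) := sub_pos.2 (lt_of_le_of_ne hxI.1 (Ne.symm hxa))
  have p2 : 0 < m + ρ - x := sub_pos.2 (lt_of_le_of_ne hxI.2 hxb)
  exact (ENNReal.ofReal_pos.2 (mul_pos (hκ.trans_le hx) (Real.sqrt_pos.2 (mul_pos p1 p2)))).ne'

lemma le_integral_of_density [IsFiniteMeasure μ] (hρ : 0 < ρ) (hκ : 0 < κ) (hS : Measurable S)
    (hSc : ∀ᵐ x ∂(volume.restrict (Icc (m - ρ) (m + ρ))), κ ≤ S x)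
    (hsupp : ∀ᵐ x ∂μ, x ∈ Icc (m - ρ) (m + ρ))
    (hdens : μ = (volume.restrict (Icc (m - ρ) (m + ρ))).withDensity
      (fun x => ENNReal.ofReal (S x * Real.sqrt ((x - (m - ρ)) * (m + ρ - x)))))
    {φ : ℝ → ℝ} (hφ : Continuous φ) (hφ0 : ∀ x, 0 ≤ φ x) :
    κ * Real.pi * ∫ x, (ρ ^ 2 - (x - m) ^ 2) * φ x ∂(arcsine m ρ) ≤ ∫ x, φ x ∂μ := by
  have hm : Measurable fun x => ENNReal.ofReal (S x * Real.sqrt ((x - (m - ρ)) * (m + ρ - x))) := by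
    fun_prop
  have htop : ∀ᵐ x ∂(volume.restrict (Icc (m - ρ) (m + ρ))),
      ENNReal.ofReal (S x * Real.sqrt ((x - (m - ρ)) * (m + ρ - x))) < ⊤ :=
    Eventually.of_forall fun _ => ENNReal.ofReal_lt_top
  have iφ : Integrable φ μ :=
    integrable_of_continuousOn_compact isCompact_Icc hsupp hφ.continuousOn
  rw [hdens, integrable_withDensity_iff_integrable_smul' hm htop] at iφ
  rw [mul_assoc, ← integral_sqrt_mul hρ hφ, ← integral_const_mul, hdens,
    integral_withDensity_eq_integral_toReal_smul hm htop]
  refine integral_mono_of_nonneg (Eventually.of_forall fun x => ?_) iφ ?_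
  · exact mul_nonneg hκ.le (mul_nonneg (Real.sqrt_nonneg _) (hφ0 x))
  · filter_upwards [hSc] with x hx
    rw [ENNReal.toReal_ofReal (mul_nonneg (hκ.le.trans hx) (Real.sqrt_nonneg _)), smul_eq_mul,
      ← mul_assoc]
    exact mul_le_mul_of_nonneg_right (mul_le_mul_of_nonneg_right hx (Real.sqrt_nonneg _)) (hφ0 x)

/-- Comparing β dμ = w (T V') dω with μ ≥ κπ w ω gives T V' ≥ βκπ on the interval. As S is
controlled only a.e., the comparison is done by integration and finished by continuity. -/
lemma T_deriv_ne_zero (H : IsOneCut β V μ m ρ) (hκ : 0 < κ) (hS : Measurable S)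
    (hSc : ∀ᵐ x ∂(volume.restrict (Icc (m - ρ) (m + ρ))), κ ≤ S x)
    (hdens : μ = (volume.restrict (Icc (m - ρ) (m + ρ))).withDensity
      (fun x => ENNReal.ofReal (S x * Real.sqrt ((x - (m - ρ)) * (m + ρ - x)))))
    (hout : ∀ x : ℝ, x ∉ Icc (m - ρ) (m + ρ) → β * ∫ y, 1 / (x - y) ∂μ ≠ deriv V x) (x : ℝ) :
    T m ρ (deriv V) x ≠ 0 := by
  by_cases hx : x ∈ Icc (m - ρ) (m + ρ)
  swap
  · exact H.T_deriv_ne_zero_of_notMem hx (hout x hx)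
  have := H.equilibrium.1
  have hρ := H.radius_pos
  have cW := H.contDiff_T_deriv.continuous
  have hE : ∀ {φ : ℝ → ℝ}, ContinuousOn φ (Icc (m - ρ) (m + ρ)) → β * ∫ x, φ x ∂μ =
      ∫ x, (ρ ^ 2 - (x - m) ^ 2) * T m ρ (deriv V) x * φ x ∂(arcsine m ρ) :=
    H.integral_equilibrium
  generalize T m ρ (deriv V) = W at cW hE ⊢
  set δ := β * (κ * Real.pi) with hδ
  have hδ0 : 0 < δ := by have := H.beta_pos; positivity
  set φ : ℝ → ℝ := fun x => max (δ - W x) 0 with hφ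
  have cφ : Continuous φ := by fun_prop
  have h1 := le_integral_of_density hρ hκ hS hSc H.ae_mem hdens cφ (fun x => le_max_right _ _)
  have h2 := mul_le_mul_of_nonneg_left h1 H.beta_pos.le
  rw [hE cφ.continuousOn, ← mul_assoc, ← hδ, ← integral_const_mul,
    ← sub_nonneg, ← integral_sub (Continuous.integrable_arcsine hρ.le (by fun_prop))
    (Continuous.integrable_arcsine hρ.le (by fun_prop))] at h2
  -- For φ = (δ − W)⁺ one has (W − δ)φ = −φ², so the comparison forces ∫ w φ² dω ≤ 0.
  have e : ∀ x, (ρ ^ 2 - (x - m) ^ 2) * W x * φ x - δ * ((ρ ^ 2 - (x - m) ^ 2) * φ x) =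
      -((ρ ^ 2 - (x - m) ^ 2) * (φ x * φ x)) := fun x => by
    rcases le_total (δ - W x) 0 with h | h
    · simp [hφ, max_eq_right h]
    · simp only [hφ, max_eq_left h]; ring
  simp_rw [e] at h2
  rw [integral_neg] at h2
  have hq : ∀ x ∈ Icc (m - ρ) (m + ρ), 0 ≤ (ρ ^ 2 - (x - m) ^ 2) * (φ x * φ x) := fun x hx =>
    mul_nonneg (by nlinarith [hx.1, hx.2]) (mul_self_nonneg _)
  have h3 : 0 ≤ ∫ x, (ρ ^ 2 - (x - m) ^ 2) * (φ x * φ x) ∂(arcsine m ρ) :=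
    integral_nonneg_of_ae ((arcsine_ae_mem hρ.le).mono hq)
  have h4 := eq_zero_of_integral_arcsine_eq_zero hρ (by fun_prop) hq (le_antisymm (by linarith) h3)
  have h5 : EqOn φ (fun _ => 0) (Ioo (m - ρ) (m + ρ)) := fun y hy => by
    have := (mul_eq_zero.1 (h4 y (Ioo_subset_Icc_self hy))).resolve_left
      (by nlinarith [hy.1, hy.2])
    exact mul_self_eq_zero.1 this
  have h6 := h5.closure cφ continuous_const
  rw [closure_Ioo (by linarith)] at h6
  have h7 : δ - W x ≤ 0 := (le_max_left _ _).trans (h6 hx).le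
  exact (hδ0.trans_le (by linarith)).ne'

end Density

end

end BetaEnsemble

/-! ### Calculus of derivative bounds. -/

namespace BetaEnsemble

noncomputable section

/-- `h` is of class `C^j` at the points of `s`, with derivatives up to order `j` bounded by `B`. -/
def DerivBound (j : ℕ) (B : ℝ) (s : Set ℝ) (h : ℝ → ℝ) : Prop :=
  ∀ x ∈ s, ContDiffAt ℝ j h x ∧ ∀ i ≤ j, |iteratedDeriv i h x| ≤ B

namespace DerivBound

variable {j : ℕ} {A B : ℝ} {s t : Set ℝ} {f h : ℝ → ℝ}

lemma mono (hB : DerivBound j B s h) (hst : t ⊆ s) {C : ℝ} (hC : B ≤ C) : DerivBound j C t h :=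
  fun x hx => ⟨(hB x (hst hx)).1, fun i hi => ((hB x (hst hx)).2 i hi).trans hC⟩

lemma nonneg (hB : DerivBound j B s h) {x : ℝ} (hx : x ∈ s) : 0 ≤ B :=
  (abs_nonneg _).trans ((hB x hx).2 0 (Nat.zero_le _))

lemma contDiffAt_of_le (hB : DerivBound j B s h) {x : ℝ} (hx : x ∈ s) {i : ℕ} (hi : i ≤ j) :
    ContDiffAt ℝ i h x := (hB x hx).1.of_le (by exact_mod_cast hi)

lemma const (c : ℝ) : DerivBound j |c| s fun _ => c := fun x _ =>
  ⟨contDiffAt_const, fun i _ => by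
    rw [iteratedDeriv_const]
    split_ifs <;> simp⟩

lemma add (hA : DerivBound j A s f) (hB : DerivBound j B s h) :
    DerivBound j (A + B) s fun x => f x + h x := fun x hx =>
  ⟨(hA x hx).1.add (hB x hx).1, fun i hi => by
    have := iteratedDeriv_add (hA.contDiffAt_of_le hx hi) (hB.contDiffAt_of_le hx hi)
    rw [show (fun x => f x + h x) = f + h from rfl, this]
    exact (abs_add_le _ _).trans (add_le_add ((hA x hx).2 i hi) ((hB x hx).2 i hi))⟩

lemma sub (hA : DerivBound j A s f) (hB : DerivBound j B s h) :
    DerivBound j (A + B) s fun x => f x - h x := fun x hx =>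
  ⟨(hA x hx).1.sub (hB x hx).1, fun i hi => by
    have := iteratedDeriv_sub (hA.contDiffAt_of_le hx hi) (hB.contDiffAt_of_le hx hi)
    rw [show (fun x => f x - h x) = f - h from rfl, this]
    exact (abs_sub _ _).trans (add_le_add ((hA x hx).2 i hi) ((hB x hx).2 i hi))⟩

/-- Leibniz estimate at a point. -/
lemma _root_.BetaEnsemble.abs_iteratedDeriv_mul_le {x : ℝ} (hf : ContDiffAt ℝ j f x)
    (hh : ContDiffAt ℝ j h x) (hB : ∀ i ≤ j, |iteratedDeriv i h x| ≤ B) :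
    |iteratedDeriv j (fun y => f y * h y) x| ≤
      2 ^ j * B * ∑ i ∈ Finset.range (j + 1), |iteratedDeriv i f x| := by
  rw [show (fun y => f y * h y) = f * h from rfl, iteratedDeriv_mul hf hh, Finset.mul_sum]
  refine (Finset.abs_sum_le_sum_abs _ _).trans (Finset.sum_le_sum fun i hi => ?_)
  have hb := hB (j - i) (Nat.sub_le _ _)
  have h0 : 0 ≤ B := (abs_nonneg _).trans hb
  have hc : ((j.choose i : ℕ) : ℝ) ≤ 2 ^ j := by exact_mod_cast Nat.choose_le_two_pow j i
  rw [abs_mul, abs_mul, Nat.abs_cast, mul_right_comm]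
  gcongr

lemma mul (hA : DerivBound j A s f) (hB : DerivBound j B s h) :
    DerivBound j (2 ^ j * A * B) s fun x => f x * h x := fun x hx =>
  ⟨(hA x hx).1.mul (hB x hx).1, fun i hi => by
    have hA0 := hA.nonneg hx
    have hB0 := hB.nonneg hx
    rw [show (fun y => f y * h y) = f * h from rfl,
      iteratedDeriv_mul (hA.contDiffAt_of_le hx hi) (hB.contDiffAt_of_le hx hi)]
    calc _ ≤ ∑ l ∈ Finset.range (i + 1), (i.choose l : ℝ) * (A * B) := by
          refine (Finset.abs_sum_le_sum_abs _ _).trans (Finset.sum_le_sum fun l hl => ?_)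
          have hl' : l ≤ j := (Nat.lt_succ_iff.1 (Finset.mem_range.1 hl)).trans hi
          rw [abs_mul, abs_mul, Nat.abs_cast, mul_assoc]
          have h1 := (hA x hx).2 l hl'
          have h2 := (hB x hx).2 (i - l) ((Nat.sub_le _ _).trans hi)
          gcongr
      _ = 2 ^ i * (A * B) := by
          rw [← Finset.sum_mul]
          congr 1
          exact_mod_cast Nat.sum_range_choose i
      _ ≤ 2 ^ j * A * B := by
          rw [mul_assoc]
          gcongr
          exact one_le_two⟩

/-- Inverting a small perturbation of `1`. -/
lemma inv_sub_one (hε : DerivBound j A s h) (hA : 2 ^ (j + 1) * A ≤ 1) :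
    DerivBound j (2 ^ (j + 1) * A) s fun x => 1 / (1 + h x) - 1 := by
  intro x hx
  have hA0 := hε.nonneg hx
  have hp : (2 : ℝ) ≤ 2 ^ (j + 1) := by
    rw [pow_succ]; nlinarith [one_le_pow₀ (one_le_two : (1 : ℝ) ≤ 2) (n := j)]
  have hhalf : ∀ y, |h y| ≤ A → 1 / 2 ≤ 1 + h y := fun y hy => by
    have : A ≤ 1 / 2 := by nlinarith
    linarith [(abs_le.1 hy).1]
  have hx0 : |h x| ≤ A := by simpa using (hε x hx).2 0 (Nat.zero_le _)
  have hpos := hhalf x hx0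
  have hc : ContDiffAt ℝ j h x := (hε x hx).1
  have hc1 : ContDiffAt ℝ j (fun y => 1 + h y) x := contDiffAt_const.add hc
  set δ : ℝ → ℝ := fun y => 1 / (1 + h y) - 1 with hδ
  have hcδ : ContDiffAt ℝ j δ x := (contDiffAt_const.div hc1 (by linarith)).sub contDiffAt_const
  refine ⟨hcδ, ?_⟩
  have hne : ∀ᶠ y in 𝓝 x, 1 + h y ≠ 0 := hc1.continuousAt.eventually_ne (by linarith)
  -- From δh = −h − δ, Leibniz expresses (1 + h)δ⁽ⁱ⁾ through lower derivatives. These are at most 1,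
  -- so the right side is at most 2^i A, and 1 + h ≥ 1/2 doubles it.
  have hev : (fun y => δ y * h y) =ᶠ[𝓝 x] fun y => (-h y) - δ y := by
    filter_upwards [hne] with y hy
    simp only [hδ]
    field_simp
    ring
  suffices H : ∀ i ≤ j, |iteratedDeriv i δ x| ≤ 2 ^ (i + 1) * A by
    intro i hi
    refine (H i hi).trans ?_
    gcongr
    exact one_le_two
  intro i
  induction i using Nat.strong_induction_on with
  | _ i ih =>
    intro hi
    have hci : ContDiffAt ℝ i h x := hc.of_le (by exact_mod_cast hi)
    have hcδi : ContDiffAt ℝ i δ x := hcδ.of_le (by exact_mod_cast hi)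
    have hcn : ContDiffAt ℝ i (-h) x := hci.neg
    have e1 := hev.iteratedDeriv_eq i
    rw [show (fun y => δ y * h y) = δ * h from rfl, iteratedDeriv_mul hcδi hci,
      show (fun y => (-h y) - δ y) = (-h) - δ from rfl, iteratedDeriv_sub hcn hcδi,
      iteratedDeriv_neg, Finset.sum_range_succ] at e1
    simp only [Nat.choose_self, Nat.cast_one, one_mul, Nat.sub_self, iteratedDeriv_zero] at e1
    set D := ∑ l ∈ Finset.range i, (i.choose l : ℝ) * iteratedDeriv l δ x *
      iteratedDeriv (i - l) h x with hD
    have hsum : |D| ≤ (2 ^ i - 1) * A := by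
      calc |D| ≤ ∑ l ∈ Finset.range i, (i.choose l : ℝ) * A := by
            refine (Finset.abs_sum_le_sum_abs _ _).trans (Finset.sum_le_sum fun l hl => ?_)
            have hl' := Finset.mem_range.1 hl
            have h1 : |iteratedDeriv l δ x| ≤ 1 := by
              refine (ih l hl' (hl'.le.trans hi)).trans (le_trans ?_ hA)
              gcongr
              · exact one_le_two
              · exact hl'.le.trans hi
            have h2 := (hε x hx).2 (i - l) ((Nat.sub_le _ _).trans hi)
            rw [abs_mul, abs_mul, Nat.abs_cast, mul_assoc]
            gcongr
            calc _ ≤ 1 * A := by gcongr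
              _ = A := one_mul A
        _ = (2 ^ i - 1) * A := by
            rw [← Finset.sum_mul]
            congr 1
            have := Nat.sum_range_choose i
            rw [Finset.sum_range_succ, Nat.choose_self] at this
            have h' : (∑ l ∈ Finset.range i, (i.choose l : ℝ)) + 1 = 2 ^ i := by exact_mod_cast this
            linarith
    have e2 : iteratedDeriv i δ x * (1 + h x) = -(iteratedDeriv i h x + D) := by
      linear_combination e1
    have e3 : |iteratedDeriv i δ x| * (1 / 2) ≤ 2 ^ i * A := by
      calc |iteratedDeriv i δ x| * (1 / 2) ≤ |iteratedDeriv i δ x| * |1 + h x| := by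
            gcongr
            exact hpos.trans (le_abs_self _)
        _ = |iteratedDeriv i h x + D| := by rw [← abs_mul, e2, abs_neg]
        _ ≤ A + (2 ^ i - 1) * A := (abs_add_le _ _).trans (add_le_add ((hε x hx).2 i hi) hsum)
        _ = 2 ^ i * A := by ring
    rw [pow_succ]
    linarith

end DerivBound

/-- A `C^j` function has bounded derivatives on compact intervals. -/
lemma exists_derivBound_Icc {j : ℕ} {h : ℝ → ℝ} (hh : ContDiff ℝ j h) (R : ℝ) :
    ∃ B, 0 ≤ B ∧ DerivBound j B (Icc (-R) R) h := by
  have : ∀ i : ℕ, ∃ B, i ≤ j → ∀ x ∈ Icc (-R) R, |iteratedDeriv i h x| ≤ B := fun i => by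
    by_cases hi : i ≤ j
    · obtain ⟨B, hB⟩ := isCompact_Icc.exists_bound_of_continuousOn (s := Icc (-R) R)
        (hh.continuous_iteratedDeriv i (by exact_mod_cast hi)).continuousOn
      exact ⟨B, fun _ => hB⟩
    · exact ⟨0, fun h => absurd h hi⟩
  choose B hB using this
  refine ⟨∑ i ∈ Finset.range (j + 1), |B i|, by positivity, fun x hx =>
    ⟨hh.contDiffAt, fun i hi => ?_⟩⟩
  refine ((hB i hi x hx).trans (le_abs_self _)).trans ?_
  exact Finset.single_le_sum (f := fun i => |B i|) (fun i _ => abs_nonneg _)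
    (Finset.mem_range.2 (by omega))

/-! ### Cauchy transforms near infinity. -/

variable {m ρ : ℝ}

/-- The Cauchy transform of `φ ω` and its derivatives, up to constants. -/
def cauchy (m ρ : ℝ) (φ : ℝ → ℝ) (n : ℕ) (x : ℝ) : ℝ :=
  ∫ y, φ y / (x - y) ^ (n + 1) ∂(arcsine m ρ)

lemma isOpen_lt_abs (R : ℝ) : IsOpen {x : ℝ | R < |x|} := isOpen_lt continuous_const continuous_abs

lemma sub_le_abs_sub {x y : ℝ} (hy : y ∈ Icc (m - ρ) (m + ρ)) :
    |x| - (|m| + ρ) ≤ |x - y| := by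
  have h1 : |y| ≤ |m| + ρ :=
    abs_le.2 ⟨by linarith [hy.1, neg_abs_le m], by linarith [hy.2, le_abs_self m]⟩
  linarith [abs_sub_abs_le_abs_sub x y]

lemma hasDerivAt_cauchy (hρ : 0 ≤ ρ) {φ : ℝ → ℝ} (hφ : Continuous φ) (n : ℕ) {x : ℝ}
    (hx : |m| + ρ < |x|) :
    HasDerivAt (cauchy m ρ φ n) (-(n + 1) * cauchy m ρ φ (n + 1) x) x := by
  have hne : ∀ x : ℝ, |m| + ρ < |x| → ∀ y ∈ Icc (m - ρ) (m + ρ), x - y ≠ 0 := fun x hx y hy =>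
    abs_pos.1 ((sub_pos.2 hx).trans_le (sub_le_abs_sub hy))
  have := hasDerivAt_integral_of_compact isCompact_Icc (arcsine_ae_mem (m := m) hρ)
    (isOpen_lt_abs (|m| + ρ)) (F := fun x y => φ y / (x - y) ^ (n + 1))
    (F' := fun x y => -(n + 1) * (φ y / (x - y) ^ (n + 1 + 1)))
    (fun x hx => ContinuousOn.div (by fun_prop) (by fun_prop)
      fun y hy => pow_ne_zero _ (hne x hx y hy))
    (ContinuousOn.mul (by fun_prop) (ContinuousOn.div (by fun_prop) (by fun_prop)
      fun z hz => pow_ne_zero _ (hne z.1 hz.1 z.2 hz.2)))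
    (fun x hx y hy => by
      have h0 := hne x hx y hy
      have h1 : HasDerivAt (fun x => (x - y) ^ (n + 1)) ((n + 1) * (x - y) ^ n) x := by
        simpa using ((hasDerivAt_id x).sub_const y).fun_pow (n + 1)
      have h2 := (h1.fun_inv (pow_ne_zero _ h0)).const_mul (φ y)
      simp only [← div_eq_mul_inv] at h2
      refine h2.congr_deriv ?_
      field_simp
      ring) hx
  refine this.congr_deriv ?_
  rw [integral_const_mul, cauchy]

lemma contDiffOn_cauchy (hρ : 0 ≤ ρ) {φ : ℝ → ℝ} (hφ : Continuous φ) (j : ℕ) :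
    ∀ n, ContDiffOn ℝ j (cauchy m ρ φ n) {x | |m| + ρ < |x|} := by
  induction j with
  | zero =>
    intro n
    exact contDiffOn_zero.2 fun x hx =>
      (hasDerivAt_cauchy hρ hφ n hx).continuousAt.continuousWithinAt
  | succ j ih =>
    intro n
    push_cast
    rw [contDiffOn_succ_iff_deriv_of_isOpen (isOpen_lt_abs _)]
    refine ⟨fun x hx => (hasDerivAt_cauchy hρ hφ n hx).differentiableAt.differentiableWithinAt,
      by simp, ?_⟩
    exact ((contDiffOn_const (c := -((n : ℝ) + 1))).mul (ih (n + 1))).congr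
      fun x hx => (hasDerivAt_cauchy hρ hφ n hx).deriv

lemma iteratedDeriv_cauchy (hρ : 0 ≤ ρ) {φ : ℝ → ℝ} (hφ : Continuous φ) (i : ℕ) {x : ℝ}
    (hx : |m| + ρ < |x|) :
    iteratedDeriv i (cauchy m ρ φ 0) x = (-1) ^ i * i.factorial * cauchy m ρ φ i x := by
  induction i generalizing x with
  | zero => simp
  | succ i ih =>
    have hev : iteratedDeriv i (cauchy m ρ φ 0) =ᶠ[𝓝 x]
        fun x => (-1) ^ i * i.factorial * cauchy m ρ φ i x := by
      filter_upwards [(isOpen_lt_abs _).mem_nhds hx] with y hy using ih hy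
    rw [iteratedDeriv_succ, hev.deriv_eq,
      ((hasDerivAt_cauchy hρ hφ i hx).const_mul _).deriv, Nat.factorial_succ]
    push_cast
    ring

/-- At distance d ≥ 1 every power of |x − y| is at least d. Linearity of the bound in A is what
later makes the estimates uniform in g. -/
lemma derivBound_cauchy (hρ : 0 ≤ ρ) {φ : ℝ → ℝ} (hφ : Continuous φ) {A : ℝ}
    (hA : ∀ y ∈ Icc (m - ρ) (m + ρ), |φ y| ≤ A) (j : ℕ) {d : ℝ} (hd : 1 ≤ d) :
    DerivBound j (j.factorial * A / d) {x | |m| + ρ + d < |x|} (cauchy m ρ φ 0) := by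
  intro x hx
  have hx' : |m| + ρ + d < |x| := hx
  have hx0 : |m| + ρ < |x| := by linarith
  refine ⟨(contDiffOn_cauchy hρ hφ j 0).contDiffAt ((isOpen_lt_abs _).mem_nhds hx0),
    fun i hi => ?_⟩
  have hm : m ∈ Icc (m - ρ) (m + ρ) := ⟨by linarith, by linarith⟩
  have hA0 : 0 ≤ A := (abs_nonneg _).trans (hA m hm)
  have hb : |cauchy m ρ φ i x| ≤ A / d := by
    refine abs_integral_arcsine_le hρ fun y hy => ?_
    have h1 : d ≤ |x - y| := by linarith [sub_le_abs_sub hy (x := x)]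
    have h2 : d ≤ |x - y| ^ (i + 1) := by
      calc d ≤ |x - y| := h1
        _ ≤ |x - y| ^ (i + 1) := le_self_pow₀ (hd.trans h1) (by simp)
    rw [abs_div, abs_pow]
    exact div_le_div₀ hA0 (hA y hy) (by linarith) h2
  rw [iteratedDeriv_cauchy hρ hφ i hx0, abs_mul, abs_mul, abs_pow, abs_neg, abs_one, one_pow,
    one_mul, Nat.abs_cast, mul_div_assoc]
  have : (i.factorial : ℝ) ≤ j.factorial := by exact_mod_cast Nat.factorial_le hi
  gcongr

/-- The behaviour of `T g` outside the interval. -/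
lemma sub_mul_T_eq (hρ : 0 ≤ ρ) {g : ℝ → ℝ} (hg : ContDiff ℝ 1 g) {x : ℝ}
    (hx : |m| + ρ < |x|) :
    (x - m) * T m ρ g x = g x - ∫ y, g y ∂(arcsine m ρ) +
      (g x * cauchy m ρ (fun y => y - m) 0 x - cauchy m ρ (fun y => (y - m) * g y) 0 x) := by
  have hne : ∀ y ∈ Icc (m - ρ) (m + ρ), x - y ≠ 0 := fun y hy =>
    abs_pos.1 ((sub_pos.2 hx).trans_le (sub_le_abs_sub hy))
  have cg := hg.continuous
  have ig : Integrable g (arcsine m ρ) := Continuous.integrable_arcsine hρ cg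
  have i1 : Integrable (fun y => (y - m) / (x - y) ^ (0 + 1)) (arcsine m ρ) :=
    integrable_arcsine hρ (ContinuousOn.div (by fun_prop) (by fun_prop)
      fun y hy => pow_ne_zero _ (hne y hy))
  have i2 : Integrable (fun y => (y - m) * g y / (x - y) ^ (0 + 1)) (arcsine m ρ) :=
    integrable_arcsine hρ (ContinuousOn.div (by fun_prop) (by fun_prop)
      fun y hy => pow_ne_zero _ (hne y hy))
  have e : ∫ y, (x - m) * dq g x y ∂(arcsine m ρ) = ∫ y, ((g x - g y) +
      (g x * ((y - m) / (x - y) ^ (0 + 1)) - (y - m) * g y / (x - y) ^ (0 + 1)))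
        ∂(arcsine m ρ) := by
    refine integral_congr_ae ?_
    filter_upwards [arcsine_ae_mem hρ] with y hy
    have h0 := hne y hy
    rw [dq_of_ne hg (sub_ne_zero.1 h0)]
    field_simp
    ring
  have i3 : Integrable (fun y => g x - g y) (arcsine m ρ) := (integrable_const _).sub ig
  have i4 : Integrable (fun y => g x * ((y - m) / (x - y) ^ (0 + 1)) -
      (y - m) * g y / (x - y) ^ (0 + 1)) (arcsine m ρ) := (i1.const_mul _).sub i2
  rw [T, ← integral_const_mul, e, integral_add i3 i4, integral_sub (integrable_const _) ig,
    integral_sub (i1.const_mul _) i2, integral_const_mul]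
  simp [cauchy]

end

end BetaEnsemble

/-! ### Expansion at infinity and norm estimates. -/

namespace BetaEnsemble

noncomputable section

variable {j : ℕ} {m ρ : ℝ} {v u h : ℝ → ℝ}

/-- All derivatives of `h` up to order `j` tend to `0` at infinity. -/
def VanishesAtInfinity (j : ℕ) (h : ℝ → ℝ) : Prop :=
  ∀ ε > 0, ∃ R, DerivBound j ε {x | R < |x|} h

namespace VanishesAtInfinity

lemma exists_ge (hh : VanishesAtInfinity j h) {ε : ℝ} (hε : 0 < ε) (R₀ : ℝ) :
    ∃ R, R₀ ≤ R ∧ DerivBound j ε {x | R < |x|} h := by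
  obtain ⟨R, hR⟩ := hh ε hε
  exact ⟨max R₀ R, le_max_left _ _,
    hR.mono (fun x (hx : max R₀ R < |x|) => (le_max_right _ _).trans_lt hx) le_rfl⟩

lemma add (hh : VanishesAtInfinity j h) (hu : VanishesAtInfinity j u) :
    VanishesAtInfinity j fun x => h x + u x := fun ε hε => by
  obtain ⟨R₁, h₁⟩ := hh _ (half_pos hε)
  obtain ⟨R, hR, h₂⟩ := hu.exists_ge (half_pos hε) R₁
  exact ⟨R, ((h₁.mono (fun x (hx : R < |x|) => hR.trans_lt hx) le_rfl).add h₂).mono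
    Subset.rfl (add_halves ε).le⟩

lemma mul_derivBound (hh : VanishesAtInfinity j h) {B R₀ : ℝ}
    (hu : DerivBound j B {x | R₀ < |x|} u) : VanishesAtInfinity j fun x => h x * u x :=
  fun ε hε => by
  have hc : 0 < 2 ^ j * (|B| + 1) := by positivity
  obtain ⟨R, hR, h₁⟩ := hh.exists_ge (div_pos hε hc) R₀
  refine ⟨R, (h₁.mul (hu.mono (fun x (hx : R < |x|) => hR.trans_lt hx)
    ((le_abs_self B).trans (lt_add_one _).le))).mono Subset.rfl (le_of_eq ?_)⟩
  field_simp

lemma mul (hh : VanishesAtInfinity j h) (hu : VanishesAtInfinity j u) :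
    VanishesAtInfinity j fun x => h x * u x :=
  let ⟨_, hR⟩ := hu 1 one_pos
  hh.mul_derivBound hR

lemma neg (hh : VanishesAtInfinity j h) : VanishesAtInfinity j fun x => -h x := by
  simpa using hh.mul_derivBound (DerivBound.const (s := {x | 0 < |x|}) (-1))

lemma inv_sub_one (hh : VanishesAtInfinity j h) :
    VanishesAtInfinity j fun x => 1 / (1 + h x) - 1 := fun ε hε => by
  have h2 : (0 : ℝ) < 2 ^ (j + 1) := by positivity
  obtain ⟨R, hR⟩ := hh (min ε 1 / 2 ^ (j + 1)) (by positivity)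
  have e : 2 ^ (j + 1) * (min ε 1 / 2 ^ (j + 1)) = min ε 1 := by field_simp
  refine ⟨R, (hR.inv_sub_one ?_).mono Subset.rfl ?_⟩ <;> rw [e]
  exacts [min_le_right _ _, min_le_left _ _]

end VanishesAtInfinity

lemma vanishesAtInfinity_cauchy (hρ : 0 ≤ ρ) {φ : ℝ → ℝ} (hφ : Continuous φ) (j : ℕ) :
    VanishesAtInfinity j (cauchy m ρ φ 0) := fun ε hε => by
  obtain ⟨A, hA⟩ := isCompact_Icc.exists_bound_of_continuousOn (s := Icc (m - ρ) (m + ρ))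
    hφ.continuousOn
  refine ⟨_, (derivBound_cauchy hρ hφ hA j
    (le_max_left 1 (j.factorial * A / ε))).mono Subset.rfl ?_⟩
  rw [div_le_iff₀ (by positivity), mul_comm ε, ← div_le_iff₀ hε]
  exact le_max_right _ _

/-- The expansion of `T g / T v` at infinity, uniformly in `g`. -/
lemma exists_expansion (hρ : 0 ≤ ρ) (hv : ContDiff ℝ 1 v) (hint : ∫ y, v y ∂(arcsine m ρ) = 0)
    (hW : ∀ x, T m ρ v x ≠ 0) {R₀ B : ℝ} (hv0 : ∀ x, R₀ < |x| → v x ≠ 0)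
    (hu : DerivBound j B {x | R₀ < |x|} fun x => 1 / v x) {ε : ℝ} (hε : 0 < ε) :
    ∃ R, R₀ ≤ R ∧ ∃ δ, DerivBound j ε {x | R < |x|} δ ∧ ∀ g : ℝ → ℝ, ContDiff ℝ 1 g → ∀ M,
      (∀ y ∈ Icc (m - ρ) (m + ρ), |g y| ≤ M) → ∃ κ, DerivBound j (ε * M) {x | R < |x|} κ ∧
        ∀ x, R < |x| → T m ρ g x / T m ρ v x =
          (g x + -∫ y, g y ∂(arcsine m ρ)) / v x +
            ((g x + -∫ y, g y ∂(arcsine m ρ)) / v x * δ x - 1 / v x * κ x) := by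
  set a := cauchy m ρ (fun y => y - m) 0 with ha
  set b := cauchy m ρ (fun y => (y - m) * v y) 0 with hb
  have cv := hv.continuous
  have va : VanishesAtInfinity j a := vanishesAtInfinity_cauchy hρ (by fun_prop) j
  have vb : VanishesAtInfinity j b := vanishesAtInfinity_cauchy hρ (by fun_prop) j
  have vη := va.add (vb.mul_derivBound hu).neg
  -- Since v has ω-mean zero, (x−m) T v = v(1 + η). With 1/(1+η) = 1 + δ, the relative error in the
  -- quotient is (1+a)(1+δ) − 1 = a + (δ + aδ).
  set η : ℝ → ℝ := fun x => a x + -(b x * (1 / v x)) with hη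
  have vδ := vη.inv_sub_one
  set δ : ℝ → ℝ := fun x => 1 / (1 + η x) - 1 with hδ
  have vδ₁ := va.add (vδ.add (va.mul vδ))
  -- The remainder is κ = (c·a + q)(1 + δ), with |c| ≤ M, q bounded by ε'M and 1 + δ by 2. The
  -- Leibniz factors give 2^j(2^j + 1)·2·ε'M = εM.
  set ε' : ℝ := ε / (2 ^ j * (2 ^ j + 1) * 2) with hε'
  have hε'0 : 0 < ε' := by positivity
  obtain ⟨R₁, hR₁, b₁⟩ := vδ₁.exists_ge hε (max R₀ (|m| + ρ))
  obtain ⟨R₂, hR₂, b₂⟩ := va.exists_ge hε'0 R₁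
  obtain ⟨R₃, hR₃, b₃⟩ := vδ.exists_ge one_pos R₂
  set d : ℝ := max 1 (j.factorial * ρ / ε') with hd
  have hd1 : 1 ≤ d := le_max_left _ _
  have hdε : j.factorial * ρ / d ≤ ε' := by
    rw [div_le_iff₀ (by positivity), mul_comm ε', ← div_le_iff₀ hε'0]
    exact le_max_right _ _
  set R := max R₃ (|m| + ρ + d) with hR
  have hR3 : R₃ ≤ R := le_max_left _ _
  have h0 : R₀ ≤ R := (le_max_left _ _).trans (hR₁.trans (hR₂.trans (hR₃.trans hR3)))
  have hm : m ∈ Icc (m - ρ) (m + ρ) := ⟨by linarith, by linarith⟩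
  have hsub : ∀ {r}, r ≤ R → {x : ℝ | R < |x|} ⊆ {x | r < |x|} := fun h x hx => h.trans_lt hx
  refine ⟨R, h0, _, b₁.mono (hsub (hR₂.trans (hR₃.trans hR3))) le_rfl, fun g hg M hM => ?_⟩
  have hM0 : 0 ≤ M := (abs_nonneg _).trans (hM m hm)
  have cg := hg.continuous
  set c : ℝ := -∫ y, g y ∂(arcsine m ρ) with hc
  have hcM : |c| ≤ M := by
    rw [hc, abs_neg]; exact abs_integral_arcsine_le hρ hM
  set q := cauchy m ρ (fun y => (y - m) * g y) 0 with hq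
  have bq : DerivBound j (ε' * M) {x | R < |x|} q := by
    refine (derivBound_cauchy hρ (by fun_prop) (A := ρ * M) (fun y hy => ?_) j hd1).mono
      (hsub (le_max_right _ _)) ?_
    · rw [abs_mul]
      have : |y - m| ≤ ρ := abs_le.2 ⟨by linarith [hy.1], by linarith [hy.2]⟩
      have := hM y hy
      gcongr
    · calc j.factorial * (ρ * M) / d = j.factorial * ρ / d * M := by ring
        _ ≤ _ := by gcongr
  have bca : DerivBound j (2 ^ j * M * ε') {x | R < |x|} fun x => c * a x :=
    ((DerivBound.const c).mono Subset.rfl hcM).mul (b₂.mono (hsub (hR₃.trans hR3)) le_rfl)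
  have b1δ : DerivBound j 2 {x | R < |x|} fun x => 1 + δ x :=
    ((DerivBound.const 1).add (b₃.mono (hsub hR3) le_rfl)).mono Subset.rfl (by norm_num)
  refine ⟨_, ((bca.add bq).mul b1δ).mono Subset.rfl (le_of_eq ?_), fun x hx => ?_⟩
  · rw [hε']; field_simp
  · have hx0 : |m| + ρ < |x| := by
      linarith [le_max_right R₃ (|m| + ρ + d)]
    have hxm : x - m ≠ 0 := by
      intro h
      rw [sub_eq_zero.1 h] at hx0
      linarith
    have hvx := hv0 x (h0.trans_lt hx)
    have e₁ := sub_mul_T_eq hρ hg hx0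
    have e₂ := sub_mul_T_eq hρ hv hx0
    rw [hint] at e₂
    have e₃ : (x - m) * T m ρ v x = v x * (1 + η x) := by
      rw [e₂, hη]; field_simp; ring
    have hη0 : 1 + η x ≠ 0 := by
      intro h
      rw [h, mul_zero] at e₃
      exact mul_ne_zero hxm (hW x) e₃
    have e₄ : (x - m) * T m ρ g x = (g x + c) * (1 + a x) - (c * a x + q x) := by
      rw [e₁, hc]; ring
    rw [← mul_div_mul_left _ _ hxm, e₃, e₄, hδ]
    field_simp
    ring

/-- The error is ((g+c)/V')·δ − (1/V')·κ with δ and κ small up to order j. Leibniz spreads the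
derivative over all lower orders of both factors, hence the two sums. -/
lemma isLittleO_of_expansion (hρ : 0 ≤ ρ) (hv : ContDiff ℝ 1 v)
    (hint : ∫ y, v y ∂(arcsine m ρ) = 0)
    (hW : ∀ x, T m ρ v x ≠ 0) {R₀ B : ℝ} (hv0 : ∀ x, R₀ < |x| → v x ≠ 0)
    (hu : DerivBound j B {x | R₀ < |x|} fun x => 1 / v x) {g : ℝ → ℝ} (hg1 : ContDiff ℝ 1 g)
    (hg : ContDiff ℝ j g) {c : ℝ} (hc : c = -∫ y, g y ∂(arcsine m ρ)) :
    (fun x => iteratedDeriv j (fun y => T m ρ g y / T m ρ v y) x -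
        iteratedDeriv j (fun y => (g y + c) / v y) x)
      =o[cocompact ℝ] (fun x => ∑ i ∈ Finset.range (j + 1),
        (|iteratedDeriv i (fun y => (g y + c) / v y) x| +
          |iteratedDeriv i (fun y => 1 / v y) x|)) := by
  obtain ⟨M, hM⟩ := isCompact_Icc.exists_bound_of_continuousOn (s := Icc (m - ρ) (m + ρ))
    hg1.continuous.continuousOn
  rw [isLittleO_iff]
  intro ε hε
  set ε' : ℝ := ε / (2 ^ j * (|M| + 1)) with hε'
  obtain ⟨R, hR, δ, hδ, hex⟩ := exists_expansion hρ hv hint hW hv0 hu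
    (ε := ε') (by positivity)
  obtain ⟨κ, hκ, hexp⟩ := hex g hg1 (|M| + 1)
    fun y hy => (hM y hy).trans ((le_abs_self M).trans (lt_add_one _).le)
  rw [← hc] at hexp
  have hlarge : ∀ᶠ x : ℝ in cocompact ℝ, R < |x| :=
    (tendsto_norm_cocompact_atTop (E := ℝ)).eventually_gt_atTop R
  filter_upwards [hlarge] with x hx
  set G : ℝ → ℝ := fun y => (g y + c) / v y with hG
  set w : ℝ → ℝ := fun y => 1 / v y with hw
  have hwx : ContDiffAt ℝ j w x := (hu x (hR.trans_lt hx)).1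
  have hGx : ContDiffAt ℝ j G x := by
    have : ContDiffAt ℝ j (fun y => (g y + c) * w y) x :=
      (hg.contDiffAt.add contDiffAt_const).mul hwx
    simpa only [hG, hw, mul_one_div] using this
  have hδx := hδ x hx
  have hκx := hκ x hx
  have hev : (fun y => T m ρ g y / T m ρ v y) =ᶠ[𝓝 x] fun y => G y + (G y * δ y - w y * κ y) := by
    filter_upwards [(isOpen_lt_abs R).mem_nhds hx] with y hy using hexp y hy
  have k₁ : ContDiffAt ℝ j (fun y => G y * δ y) x := hGx.mul hδx.1
  have k₂ : ContDiffAt ℝ j (fun y => w y * κ y) x := hwx.mul hκx.1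
  have k₃ : ContDiffAt ℝ j (fun y => G y * δ y - w y * κ y) x := k₁.sub k₂
  rw [hev.iteratedDeriv_eq, iteratedDeriv_fun_add hGx k₃, iteratedDeriv_fun_sub k₁ k₂,
    add_sub_cancel_left, Real.norm_eq_abs, Real.norm_eq_abs,
    abs_of_nonneg (a := ∑ i ∈ Finset.range (j + 1), _) (by positivity)]
  have l₁ := abs_iteratedDeriv_mul_le hGx hδx.1 hδx.2
  have l₂ := abs_iteratedDeriv_mul_le hwx hκx.1 hκx.2
  have hs : 0 ≤ ∑ i ∈ Finset.range (j + 1), |iteratedDeriv i G x| :=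
    Finset.sum_nonneg fun i _ => abs_nonneg _
  have e₂ : 2 ^ j * (ε' * (|M| + 1)) = ε := by rw [hε']; field_simp
  have e₁ : 2 ^ j * ε' ≤ ε := by
    calc 2 ^ j * ε' = 2 ^ j * (ε' * 1) := by ring
      _ ≤ 2 ^ j * (ε' * (|M| + 1)) := by gcongr; linarith [abs_nonneg M]
      _ = ε := e₂
  rw [e₂] at l₂
  rw [Finset.sum_add_distrib, mul_add]
  exact (abs_sub _ _).trans (add_le_add (l₁.trans (by gcongr)) l₂)

/-- On a large compact interval T g costs one derivative and 1/T v is bounded with its derivatives;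
outside, the expansion with ε = 1 applies. Both bounds are linear in M. -/
lemma exists_derivBound_T_div_T (hρ : 0 ≤ ρ) (hv : ContDiff ℝ 1 v)
    (hint : ∫ y, v y ∂(arcsine m ρ) = 0) (hWj : ContDiff ℝ j (T m ρ v))
    (hW : ∀ x, T m ρ v x ≠ 0) {R₀ B : ℝ} (hv0 : ∀ x, R₀ < |x| → v x ≠ 0)
    (hu : DerivBound j B {x | R₀ < |x|} fun x => 1 / v x) :
    ∃ K, 0 ≤ K ∧ ∀ g : ℝ → ℝ, ContDiff ℝ (j + 1 : ℕ) g → ∀ M,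
      (∀ r ≤ j + 1, ∀ x, |iteratedDeriv r g x| ≤ M) →
        DerivBound j (K * M) univ fun y => T m ρ g y / T m ρ v y := by
  obtain ⟨R, hR, δ, hδ, hex⟩ := exists_expansion hρ hv hint hW hv0 hu one_pos
  obtain ⟨R₁, hR₁, hI, hRR₁⟩ := exists_Icc_subset m ρ R
  obtain ⟨B₁, hB₁0, hB₁⟩ := exists_derivBound_Icc
    (h := fun x => 1 / T m ρ v x) (contDiff_const.div hWj hW) R₁
  have hB0 : 0 ≤ B := hu.nonneg (x := |R₀| + 1)
    (show R₀ < |(|R₀| + 1)| by rw [abs_of_pos (by positivity)]; linarith [le_abs_self R₀])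
  set K : ℝ := 2 ^ j * 2 * B + (2 ^ j * (2 ^ j * 2 * B) * 1 + 2 ^ j * B * 1) with hK
  refine ⟨K + 2 ^ j * B₁, by positivity, fun g hg M hM => ?_⟩
  have hM0 : 0 ≤ M := (abs_nonneg _).trans (hM 0 (Nat.zero_le _) 0)
  have hg1 : ContDiff ℝ 1 g := hg.of_le (by exact_mod_cast Nat.succ_le_succ (Nat.zero_le j))
  have hg0 : ∀ y, |g y| ≤ M := fun y => by simpa using hM 0 (Nat.zero_le _) y
  obtain ⟨κ, hκ, hexp⟩ := hex g hg1 M fun y _ => hg0 y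
  have hc := abs_integral_arcsine_le (m := m) hρ (φ := g) fun y _ => hg0 y
  set c : ℝ := -∫ y, g y ∂(arcsine m ρ) with hcdef
  have hcM : |c| ≤ M := by rw [hcdef, abs_neg]; exact hc
  intro x _
  by_cases hx : x ∈ Icc (-R₁) R₁
  · have hTg : DerivBound j M (Icc (-R₁) R₁) (T m ρ g) := fun z hz =>
      ⟨(contDiff_T hρ hg).contDiffAt, fun i hi => abs_iteratedDeriv_T_le hρ
        (hg.of_le (by exact_mod_cast Nat.succ_le_succ hi)) hI
        (fun y _ => hM (i + 1) (Nat.succ_le_succ hi) y) hz⟩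
    have := ((hTg.mul hB₁).mono Subset.rfl
      (show _ ≤ (K + 2 ^ j * B₁) * M by nlinarith [show 0 ≤ K * M by positivity])) x hx
    simpa only [mul_one_div] using this
  · have hx' : R < |x| := by
      by_contra! h
      exact hx (abs_le.1 (h.trans hRR₁.2))
    have hu' := hu.mono (fun y (hy : R < |y|) => hR.trans_lt hy) le_rfl
    have hgc : DerivBound j (2 * M) {x | R < |x|} fun y => g y + c := by
      refine DerivBound.mono (DerivBound.add (A := M) (fun y _ => ⟨?_, fun i hi => ?_⟩)
        (DerivBound.const c)) Subset.rfl (show M + |c| ≤ 2 * M by linarith)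
      · exact hg.contDiffAt.of_le (by exact_mod_cast Nat.le_succ j)
      · exact hM i (hi.trans (Nat.le_succ j)) y
    have hG := hgc.mul hu'
    have hall := hG.add ((hG.mul hδ).sub (hu'.mul hκ))
    have := (hall.mono Subset.rfl (show _ ≤ (K + 2 ^ j * B₁) * M by
      rw [hK]; nlinarith [show 0 ≤ 2 ^ j * B₁ * M by positivity])) x hx'
    have hev : (fun y => T m ρ g y / T m ρ v y) =ᶠ[𝓝 x] fun y => (g y + c) * (1 / v y) +
        ((g y + c) * (1 / v y) * δ y - 1 / v y * κ y) := by
      filter_upwards [(isOpen_lt_abs R).mem_nhds hx'] with y hy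
      rw [hexp y hy, mul_one_div]
    refine ⟨this.1.congr_of_eventuallyEq hev, fun i hi => ?_⟩
    rw [hev.iteratedDeriv_eq]
    exact this.2 i hi

lemma cNorm_le {f : ℝ → ℝ} {K : ℝ} (hf : DerivBound j K univ f) :
    cNorm j f ≤ (j + 1 : ℕ) * ENNReal.ofReal K := by
  rw [cNorm]
  calc _ ≤ ∑ r ∈ Finset.range (j + 1), ENNReal.ofReal K := by
        refine Finset.sum_le_sum fun r hr => ?_
        rw [eLpNorm_exponent_top]
        exact eLpNormEssSup_le_of_ae_bound (Eventually.of_forall fun x =>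
          (hf x (mem_univ x)).2 r (Nat.lt_succ_iff.1 (Finset.mem_range.1 hr)))
    _ = _ := by simp

/-- An essential bound holds on a dense set, and continuity of the derivative makes the set closed.
-/
lemma abs_iteratedDeriv_le_cNorm {g : ℝ → ℝ} (hg : ContDiff ℝ j g) (hfin : cNorm j g ≠ ⊤)
    {r : ℕ} (hr : r ≤ j) (x : ℝ) : |iteratedDeriv r g x| ≤ (cNorm j g).toReal := by
  have hcont : Continuous (iteratedDeriv r g) :=
    hg.continuous_iteratedDeriv r (by exact_mod_cast hr)
  have hle : eLpNormEssSup (iteratedDeriv r g) volume ≤ cNorm j g := by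
    rw [← eLpNorm_exponent_top]
    exact Finset.single_le_sum (f := fun r => eLpNorm (iteratedDeriv r g) ∞ volume)
      (fun _ _ => zero_le) (Finset.mem_range.2 (Nat.lt_succ_of_le hr))
  have hae : ∀ᵐ x ∂(volume : Measure ℝ), |iteratedDeriv r g x| ≤ (cNorm j g).toReal := by
    filter_upwards [enorm_ae_le_eLpNormEssSup (iteratedDeriv r g) volume] with x hx
    have := ENNReal.toReal_mono hfin (hx.trans hle)
    simpa using this
  have hclosed : IsClosed {x | |iteratedDeriv r g x| ≤ (cNorm j g).toReal} :=
    isClosed_le hcont.abs continuous_const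
  have := (Measure.dense_of_ae hae).closure_eq
  rw [hclosed.closure_eq] at this
  exact this.symm.subset (mem_univ x)

lemma RegularAtInfinity.exists_derivBound {V : ℝ → ℝ} (hV : ContDiff ℝ j (deriv V))
    (h : RegularAtInfinity V j) : ∃ R₀ B : ℝ, (∀ x, R₀ < |x| → deriv V x ≠ 0) ∧
      DerivBound j B {x | R₀ < |x|} fun x => 1 / deriv V x := by
  obtain ⟨R, B, h⟩ := h
  exact ⟨R, B, fun x hx => (h x hx.le).1, fun x hx =>
    ⟨contDiffAt_const.div hV.contDiffAt (h x (le_of_lt hx)).1, (h x (le_of_lt hx)).2⟩⟩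

lemma exists_cNorm_T_div_T_le {V : ℝ → ℝ} (hρ : 0 ≤ ρ) (hv : ContDiff ℝ (j + 1 : ℕ) (deriv V))
    (hint : ∫ y, deriv V y ∂(arcsine m ρ) = 0) (hW : ∀ x, T m ρ (deriv V) x ≠ 0)
    (hreg : RegularAtInfinity V j) :
    ∃ C : ℝ≥0, ∀ g : ℝ → ℝ, ContDiff ℝ (j + 2 : ℕ) g →
      cNorm j (fun y => T m ρ g y / T m ρ (deriv V) y) ≤ (C : ℝ≥0∞) * cNorm (j + 2) g := by
  obtain ⟨R₀, B, hv0, hu⟩ := hreg.exists_derivBound (hv.of_le (by exact_mod_cast Nat.le_succ j))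
  obtain ⟨K, hK0, hK⟩ := exists_derivBound_T_div_T hρ
    (hv.of_le (by exact_mod_cast Nat.succ_le_succ (Nat.zero_le j))) hint (contDiff_T hρ hv) hW hv0 hu
  -- The extra 1 keeps the constant positive, so that it times ⊤ is ⊤ when g has infinite norm.
  refine ⟨(j + 1 : ℕ) * K.toNNReal + 1, fun g hg => ?_⟩
  by_cases hfin : cNorm (j + 2) g = ⊤
  · rw [hfin, ENNReal.mul_top (by positivity)]
    exact le_top
  refine (cNorm_le (hK g (hg.of_le (by exact_mod_cast Nat.le_succ (j + 1))) _ fun r hr x =>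
    abs_iteratedDeriv_le_cNorm hg hfin (hr.trans (Nat.le_succ _)) x)).trans ?_
  rw [ENNReal.ofReal_mul hK0, ENNReal.ofReal_toReal hfin, ← mul_assoc]
  gcongr
  push_cast
  rw [ENNReal.ofReal]
  exact le_self_add

/-- Existence and uniqueness for the master equation, in centred notation. -/
lemma IsOneCut.solution {β : ℝ} {V : ℝ → ℝ} {μ : Measure ℝ} (H : IsOneCut β V μ m ρ)
    (hW : ∀ x, T m ρ (deriv V) x ≠ 0) {n : ℕ} (hn : 1 ≤ n)
    (hVn : ContDiff ℝ (n + 1 : ℕ) (deriv V)) {g : ℝ → ℝ} (hg : ContDiff ℝ (n + 1 : ℕ) g)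
    {c : ℝ} (hc : c = -∫ y, g y ∂(arcsine m ρ)) :
    ContDiff ℝ n (fun x => T m ρ g x / T m ρ (deriv V) x) ∧
      (∀ x, Xi β V μ (fun x => T m ρ g x / T m ρ (deriv V) x) x = g x + c) ∧
      ∀ (c₁ : ℝ) (f₁ : ℝ → ℝ), ContDiff ℝ n f₁ → (∀ x, Xi β V μ f₁ x = g x + c₁) →
        c₁ = c ∧ f₁ = fun x => T m ρ g x / T m ρ (deriv V) x := by
  have hρ := H.radius_pos
  have h1n : (1 : WithTop ℕ∞) ≤ n := by exact_mod_cast hn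
  have hg2 : ContDiff ℝ 2 g := hg.of_le (by exact_mod_cast Nat.succ_le_succ hn)
  have hg1 : ContDiff ℝ 1 g := hg2.of_le one_le_two
  have cf : ContDiff ℝ n (fun x => T m ρ g x / T m ρ (deriv V) x) :=
    (contDiff_T hρ.le hg).div (contDiff_T hρ.le hVn) hW
  refine ⟨cf, fun x => ?_, fun c₁ f₁ hf₁ h₁ => ?_⟩
  · simp only [H.Xi_eq_U (cf.of_le h1n), div_mul_cancel₀ _ (hW _)]
    rw [U_T hρ hg2, hc, sub_eq_add_neg]
  -- Any solution makes f₁·T V' a solution of U h = g + c₁: mean zero fixes c₁, and f₁·T V' = T(g +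
  -- c₁) = T g.
  · obtain ⟨e₁, e₂⟩ := eq_T_of_U_eq hρ ((hf₁.of_le h1n).mul H.contDiff_T_deriv)
      (G := fun x => g x + c₁) (hg2.add contDiff_const)
      fun x => (H.Xi_eq_U (hf₁.of_le h1n) x).symm.trans (h₁ x)
    rw [integral_add (Continuous.integrable_arcsine hρ.le hg1.continuous) (integrable_const _)] at e₁
    simp only [integral_const, probReal_univ, one_smul] at e₁
    refine ⟨by linarith, funext fun x => ?_⟩
    have := congrFun e₂ x
    rw [T_add hρ.le hg1 contDiff_const, T_const, add_zero] at this
    rw [eq_div_iff (hW x)]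
    exact this

end

end BetaEnsemble

/-! ### Assembly. -/

theorem mainTheorem4
    (β : ℝ) (hβ : 0 < β) (V : ℝ → ℝ) (k p : ℕ) (hk : 3 ≤ k) (hp : 4 ≤ p)
    (hV : ContDiff ℝ p V)
    (hVlog : Tendsto (fun x => V x / (β * Real.log |x|)) (cocompact ℝ) atTop)
    (μ : Measure ℝ) (hμ : BetaEnsemble.IsEquilibriumMeasure β V μ)
    (a b cbar : ℝ) (hab : a < b) (hcbar : 0 < cbar)
    (S : ℝ → ℝ) (hS : Measurable S) (hSc : ∀ᵐ x ∂(volume.restrict (Icc a b)), cbar ≤ S x)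
    (hdens : μ = (volume.restrict (Icc a b)).withDensity
      (fun x => ENNReal.ofReal (S x * Real.sqrt ((x - a) * (b - x)))))
    (hout : ∀ x : ℝ, x ∉ Icc a b → β * ∫ y, 1 / (x - y) ∂μ ≠ deriv V x) :
    ∃ C : ℕ → ℝ≥0, ∀ g : ℝ → ℝ, ContDiff ℝ k g →
      ∃ (c : ℝ) (f : ℝ → ℝ),
        ContDiff ℝ (min (k - 2) (p - 3) : ℕ) f ∧
        (∀ x, BetaEnsemble.Xi β V μ f x = g x + c) ∧
        (∀ (c₁ : ℝ) (f₁ : ℝ → ℝ), ContDiff ℝ (min (k - 2) (p - 3) : ℕ) f₁ →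
          (∀ x, BetaEnsemble.Xi β V μ f₁ x = g x + c₁) → c₁ = c ∧ f₁ = f) ∧
        ∀ j ≤ min (k - 2) (p - 3), BetaEnsemble.RegularAtInfinity V j →
          BetaEnsemble.cNorm j f ≤ (C j : ℝ≥0∞) * BetaEnsemble.cNorm (j + 2) g ∧
          (fun x => iteratedDeriv j f x - iteratedDeriv j (fun y => (g y + c) / deriv V y) x)
            =o[cocompact ℝ]
          (fun x => ∑ i ∈ Finset.range (j + 1),
            (|iteratedDeriv i (fun y => (g y + c) / deriv V y) x|
              + |iteratedDeriv i (fun y => 1 / deriv V y) x|)) := by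
  obtain ⟨m, ρ, hρ, rfl, rfl⟩ : ∃ m ρ : ℝ, 0 < ρ ∧ a = m - ρ ∧ b = m + ρ :=
    ⟨(a + b) / 2, (b - a) / 2, by linarith, by ring, by ring⟩
  set n := min (k - 2) (p - 3) with hn
  -- From k ≥ 3 and p ≥ 4. Solutions are thus C¹, as required to extend divided differences to the
  -- diagonal and conjugate Ξ with U.
  have hn1 : 1 ≤ n := by omega
  have H := BetaEnsemble.isOneCut_of_density hβ hρ
    (hV.of_le (by exact_mod_cast (by omega : 3 ≤ p))) hμ hcbar hS hSc hdens
  have hW := BetaEnsemble.T_deriv_ne_zero H hcbar hS hSc hdens hout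
  have hVn : ContDiff ℝ (n + 1 : ℕ) (deriv V) := by
    have : ContDiff ℝ (((n + 1 : ℕ) : WithTop ℕ∞) + 1) V :=
      hV.of_le (by exact_mod_cast (by omega : n + 1 + 1 ≤ p))
    exact (contDiff_succ_iff_deriv.1 this).2.2
  have hint := H.integral_deriv.1
  have hC : ∀ j, ∃ C : ℝ≥0, j ≤ n → BetaEnsemble.RegularAtInfinity V j →
      ∀ g : ℝ → ℝ, ContDiff ℝ (j + 2 : ℕ) g →
        BetaEnsemble.cNorm j (fun y => BetaEnsemble.T m ρ g y / BetaEnsemble.T m ρ (deriv V) y) ≤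
          (C : ℝ≥0∞) * BetaEnsemble.cNorm (j + 2) g := fun j => by
    by_cases h : j ≤ n ∧ BetaEnsemble.RegularAtInfinity V j
    · obtain ⟨C, hC⟩ := BetaEnsemble.exists_cNorm_T_div_T_le hρ.le
        (hVn.of_le (by exact_mod_cast Nat.succ_le_succ h.1)) hint hW h.2
      exact ⟨C, fun _ _ => hC⟩
    · exact ⟨0, fun h₁ h₂ => absurd ⟨h₁, h₂⟩ h⟩
  choose C hC using hC
  refine ⟨C, fun g hg => ⟨-∫ y, g y ∂(BetaEnsemble.arcsine m ρ),
    fun x => BetaEnsemble.T m ρ g x / BetaEnsemble.T m ρ (deriv V) x, ?_⟩⟩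
  obtain ⟨hf, hXi, huniq⟩ := H.solution hW hn1 hVn
    (hg.of_le (by exact_mod_cast (by omega : n + 1 ≤ k))) rfl
  refine ⟨hf, hXi, huniq, fun j hj hreg => ⟨hC j hj hreg g
    (hg.of_le (by exact_mod_cast (by omega : j + 2 ≤ k))), ?_⟩⟩
  obtain ⟨R₀, B, hv0, hu⟩ := hreg.exists_derivBound
    (hVn.of_le (by exact_mod_cast hj.trans (Nat.le_succ n)))
  exact BetaEnsemble.isLittleO_of_expansion hρ.le H.contDiff_deriv_one hint hW hv0 hu
    (hg.of_le (by exact_mod_cast (by omega : 1 ≤ k)))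
    (hg.of_le (by exact_mod_cast (by omega : j ≤ k))) rfl
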